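/- **Session types and processes.** Types are $A ::= \oplus\{\ell:A_\ell\}_{\ell\in L}\mid \&\{\ell:A_\ell\}_{\ell\in L}\mid 1\mid t$ with $L$ finite; a finite signature $\Sigma$ defines each type variable by $t=^{i}_{a}A$ with priority $i\in\mathbb N$ and $a\in\{\mu,\nu\}$, where equal priorities have equal kinds; $n$ is the maximum priority. A process has at most one left channel $x^\alpha:A$ (generation $\alpha$) and one right channel $y^\beta:B$, is taken up to renaming of channels, and is one of $y\leftarrow x$; $(w:A)\leftarrow P;Q$; $\mathbf{close}\,Ry$; $\mathbf{wait}\,Lx;Q$; $Ry.k;P$; $Lx.k;P$; $\mathbf{case}\,Lx(\ell\Rightarrow P_\ell)_{\ell\in L}$; $\mathbf{case}\,Ry(\ell\Rightarrow P_\ell)_{\ell\in L}$; $Ry.\mu_t;P$; $\mathbf{case}\,Lx(\mu_t\Rightarrow P)$; $\mathbf{case}\,Ry(\nu_t\Rightarrow P)$; $Lx.\nu_t;P$; or a call $y\leftarrow X\leftarrow x$ of one of finitely many process definitions $\bar u:\omega\vdash X=P_X::(w:B)$. **Relations and snapshots.** $\Omega$ is a set of relations $a_i=b_i$, $a_i<b_i$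 ($i\in\mathbb N$) between generational variables $a,b$. $\Omega\vDash a_i\le b_i$ means that it follows from the reflexive transitive closure of $\Omega$; $\Omega\vDash a_i=b_i$ uses equalities only, and $\Omega\vDash a_i<b_i$ uses at least one $<$. For snapshots up to $m$, $\Omega\vDash\mathsf{snap}(a)<\mathsf{snap}(b)$ means that for some $j\le m$, $\Omega\vDash a_i=b_i$ for all $i<j$ and $\Omega\vDash a_j<b_j$. A *left (right) trace* on an infinite branch is an infinite sequence of generational variables $a^0,a^1,\dots$ occurring left (right) of the turnstile at strictly increasing positions of the branch with $\mathsf{snap}(a^{k+1})<\mathsf{snap}(a^k)$ for all $k$ with respect to the relations of the judgment at the position of $a^{k+1}$. **Typing.** An infinitary typing derivation of $\bar x^\alpha:\omega\vdash_\Omega P::(y^\beta:B)$ is a possibly infinite tree of instances of the standard rules ($\mathsf{Id}$, $\mathsf{Cut}$, left and right rules of $1,\oplus,\&,\mu,\nu$, and unfolding of calls), annotated as follows. $\oplus$ and $\&$ rules pass from $z^\gamma$ to $z^{\gamma+1}$ and add $z^\gamma_i=z^{\gamma+1}_i$ for all $i$. Unfolding $t=^j_aA$ at $z^\gamma:t$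 passes to $z^{\gamma+1}:A$ and adds $z^{\gamma+1}_i=z^\gamma_i$ for all $i\ne j$; $\mu L$ and $\nu R$ also add $z^{\gamma+1}_j<z^\gamma_j$. $\mathsf{Cut}$ on $(w:A)\leftarrow P;Q$ has the premises $\bar x^\alpha:\omega\vdash_\Omega P::(w^\eta:A)$ and $w^\eta:A\vdash_\Omega Q::(y^\beta:B)$ for a fresh name $w$ and a fresh generation variable $\eta$. The other rules keep the relations. The derivation is *guarded* if each infinite branch has a left trace ($\mu$-trace) or a right trace ($\nu$-trace), with snapshots up to $n$. **Metalogic.** $\mathit{FIMALL}^\infty_{\mu,\nu}$ is the infinitary sequent calculus for first order intuitionistic multiplicative additive linear logic with $n$-ary $\oplus,\&$, with $\exists,\forall$ and equality of terms (whose left rule has one premise for a most general unifier, and none if there is no unifier), and with predicates defined by fixed points $p(\bar s)=^i_aF$ (closed under substitution). Formulas are annotated by pairwise distinct generational position variables. Unfolding a defined predicate annotates relations exactly as above; $\otimes L$ and $\otimes R$ take a fresh position variable, equal at every priority to that of the principal formula; $\multimap L$, $\multimap R$ and cut take a fresh one without relations. A derivation is *valid* if each infinite branch has a left trace ($\mu$-trace)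 or a right trace ($\nu$-trace), with snapshots up to the maximum priority, here $n+2$. The signature of the metalogic consists of the following definitions, in which $\mathsf{Msg}$ is an undefined predicate. $[y^\beta:1]=^{n+2}_\mu\mathsf{Msg}(y^\beta.\mathsf{closed})\otimes[\cdot:\cdot]$; $[\cdot:\cdot]=^{n+2}_\mu 1$; $[y^\beta:\oplus\{\ell:A_\ell\}]=^{n+2}_\mu\oplus\{\mathsf{Msg}(y^\beta.\ell)\otimes[y^{\beta+1}:A_\ell]\}_\ell$; $[y^\beta:\&\{\ell:A_\ell\}]=^{n+2}_\mu\&\{\mathsf{Msg}(y^\beta.\ell)\multimap[y^{\beta+1}:A_\ell]\}_\ell$; for $t=^i_\mu A$, $[y^\beta:t]=^i_\mu\mathsf{Msg}(y^\beta.\mu_t)\otimes[y^{\beta+1}:A]$; for $t=^i_\nu A$, $[y^\beta:t]=^i_\nu\mathsf{Msg}(y^\beta.\nu_t)\multimap[y^{\beta+1}:A]$. $\mathsf{Cfg}_{l,r}(P)=^{n+2}_\mu F$, with $l=\bar x^\alpha:\omega$ and $r=y^\beta:B$, where $F$ is - $x^\alpha=y^\beta$ for $y\leftarrow x$; - $\exists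 z\exists\eta.\,\mathsf{Cfg}_{l,z^\eta:A}(P_1)\otimes\mathsf{Cfg}_{z^\eta:A,r}(P_2)$ for $(w:A)\leftarrow P_1;P_2$ (and for a composition of configurations along a channel of type $A$); - $\mathsf{Msg}(y^\beta.\mathsf{closed})\otimes1$ for $\mathbf{close}\,Ry$, and $1$ for the empty configuration; - $\mathsf{Msg}(x^\alpha.\mathsf{closed})\multimap\mathsf{Cfg}_{\cdot,r}(Q)$ for $\mathbf{wait}\,Lx;Q$; - $\mathsf{Msg}(z^\gamma.m)\otimes\mathsf{Cfg}(Q)$ for a process that sends the label or unfolding message $m$ along $z^\gamma$ and continues as $Q$; - $\&\{\mathsf{Msg}(z^\gamma.\ell)\multimap\mathsf{Cfg}(P_\ell)\}_{\ell}$ for a case on labels on $z^\gamma$; - $\mathsf{Msg}(z^\gamma.m)\multimap\mathsf{Cfg}(Q)$ for a case on the unfolding message $m$ on $z^\gamma$; in the last three cases the endpoint $z^\gamma$ of the continuation is $z^{\gamma+1}$ at the continuation type. Finally, for calls, $\mathsf{Cfg}_{l,r}(y\leftarrow X\leftarrow \bar x)=^{n+1}_\nu\mathsf{Cfg}_{l,r}(P_X)$.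 **The built derivation.** Write $\star$ for sequents $$\overline{\mathbf x^\alpha:[\bar x^\alpha:\omega]},\ \mathbf c^\eta:\mathsf{Cfg}_{\bar x^\alpha:\omega,\,y^\beta:B}(P)\vdash_{\Omega'}\mathbf y^\beta:[y^\beta:B].$$ Given a typing derivation of $\bar x^\alpha:\omega\vdash_\Omega P::(y^\beta:B)$ (endpoints distinct, all names recorded as used), the derivation of $\star$ is the infinite stacking of one finite block for each typing rule. The conclusion of a block is the $\star$ sequent of the conclusion of the rule, and its open assumptions are $\star$ sequents for the premises of the rule: - for a call, the block is the single $\nu L$ step on $\mathsf{Cfg}$ (at priority $n+1$); every other block starts with $\mu L$ on $\mathsf{Cfg}$ (at priority $n+2$); - forwarding: the left rule of equality on $x^\alpha=y^\beta$, then the identity axiom; - spawning: $\exists L$ twice (with the channel name and the generation chosen by the typing rule), then $\otimes L$, then cut with cut formula $\mathbf w^\eta:[w^\eta:A]$, one premise keeping $\mathsf{Cfg}(P_1)$ (at the fresh position variable of $\otimes L$) and the other one $\mathsf{Cfg}(P_2)$; - sending or receiving on a channel $z$: unfold $[z^\gamma:C]$; for labels, select the label sent, or branch over the labels received; pass the message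 by $\otimes L$ followed by $\otimes R$ (sending right) or $\multimap L$ (sending left), respectively by $\otimes L$ (receiving from the left) or $\multimap R$ (receiving from the right) followed by $\multimap L$ on the continuation, the message premise being an identity axiom; - $\mathbf{wait}$: receive $\mathsf{closed}$ from the left in the same way, then unfold $[\cdot:\cdot]$ and apply $1L$; $\mathbf{close}$: send $\mathsf{closed}$ to the right, then unfold $[\cdot:\cdot]$ on the right and finish with $1L$, $1R$. **Steps and the relation $\mathcal R$.** $\hookrightarrow$ goes from the conclusion of a typing rule to one of its premises; $\Rightarrow$ goes from the conclusion of a block to one of its $\star$ assumptions. A judgment $\bar x^\alpha:\omega\vdash_\Omega P::(y^\beta:B)$ is $\mathcal R$-related to the $\star$ sequent above (any $\mathbf c^\eta,\Omega'$) if for all $i\le n$, each endpoint $a\in\{\bar x^\alpha,y^\beta\}$ and each generational channel $w^\zeta$: $\Omega\vDash a_i\le w^\zeta_i$ iff $\Omega'\vDash\mathbf a_i\le\mathbf w^\zeta_i$. Here $\mathbf w^\zeta$ is the position variable that matches $w^\zeta$. On the two derivations, $\mathcal R$ relates a node of the typing derivation to $\star$ sequents that were built for this node. **Theorem.** Let $\mathcal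 D_1$ be a typing derivation of $\bar x^\alpha:\omega\vdash_\Omega P::(y^\beta:B)$, and let $\mathcal D_2$ be the object built from it with conclusion $\star$, for a set $\Omega'$ and any generation $\eta$ of $\mathbf c$. 1. Suppose that $\Omega$ relates only generations of one and the same used channel, and contains no later generation of $x^\alpha$ or $y^\beta$; suppose the same of $\Omega'$ for the matching position variables; and suppose that the two conclusions are $\mathcal R$-related. Then $\mathcal D_2$ is a derivation in $\mathit{FIMALL}^\infty_{\mu,\nu}$, and $\mathcal R$ relates the roots and is a bisimulation between $(\mathcal D_1,\hookrightarrow)$ and $(\mathcal D_2,\Rightarrow)$. 2. Suppose $\Omega=\Omega'=\emptyset$. Then $\mathcal D_2$ is a derivation of $\overline{\mathbf x^\alpha:[\bar x^\alpha:\omega]},\mathbf c^\eta:\mathsf{Cfg}_{\bar x^\alpha:\omega,\,y^\beta:B}(P)\vdash_\emptyset\mathbf y^\beta:[y^\beta:B]$, the roots are $\mathcal R$-related, and $\mathcal R$ is a bisimulation. It preserves snapshot inequalities: whenever $\mathcal R$-related nodes with left channel $x^\alpha$ (right channel $y^\beta$) simultaneously step, in finitely many steps through $\mathcal R$-related nodes,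 to nodes with left channel $z^\gamma$ (right channel $w^\delta$) and relations $\Lambda$, $\Lambda'$, then $\Lambda\vDash\mathsf{snap}(z^\gamma)<\mathsf{snap}(x^\alpha)$ implies $\Lambda'\vDash\mathsf{snap}(\mathbf z^\gamma)<\mathsf{snap}(\mathbf x^\alpha)$ (and $\Lambda\vDash\mathsf{snap}(w^\delta)<\mathsf{snap}(y^\beta)$ implies $\Lambda'\vDash\mathsf{snap}(\mathbf w^\delta)<\mathsf{snap}(\mathbf y^\beta)$), where snapshots go up to $n$ in $\mathcal D_1$ and up to $n+2$ in $\mathcal D_2$. Moreover, if $\mathcal D_1$ is guarded, then $\mathcal D_2$ is valid. -/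

import Mathlib

namespace SP

/-- Kind of a fixed point: least or greatest. -/
inductive FP
  | mu
  | nu

/-- Session types `⊕{ℓ : A_ℓ}`, `&{ℓ : A_ℓ}`, `1` and type variables.  Labels are natural numbers. -/
inductive Ty
  | one
  | plus (L : Finset ℕ) (A : L → Ty)
  | wth (L : Finset ℕ) (A : L → Ty)
  | tv (t : ℕ)

/-- A finite signature of session types: each `t ∈ dom` is defined by `t =^{prio t}_{kind t} body t`.
Definitions with the same priority have the same kind.  The values outside `dom` are never used. -/
structure TySig where
  dom : Finset ℕ
  kind : ℕ → FP
  prio : ℕ → ℕ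
  body : ℕ → Ty
  kind_eq : ∀ s ∈ dom, ∀ t ∈ dom, prio s = prio t → kind s = kind t

/-- The maximum priority in the signature. -/
def TySig.n (S : TySig) : ℕ := S.dom.sup S.prio

/-- Processes with at most one left channel and exactly one right channel.  The free channels of a
process are the two endpoints of its typing judgment, and every action is marked with the side it
acts on, so that channel names need not be repeated in the syntax: processes are taken up to
renaming of channels.
`fwd` is `y ← x`; `cut A P Q` is `(w : A) ← P; Q`; `close` is `close Ry`; `wait Q` is `wait Lx; Q`;
`sendR k P` is `Ry.k; P`; `sendL k P` is `Lx.k; P`; `caseL` and `caseR` receive a label;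
`muR t P` is `Ry.μ_t; P`; `muL t P` is `case Lx (μ_t ⇒ P)`; `nuR t P` is `case Ry (ν_t ⇒ P)`;
`nuL t P` is `Lx.ν_t; P`; `call X` is `y ← X ← x`. -/
inductive Proc
  | fwd
  | cut (A : Ty) (P Q : Proc)
  | close
  | wait (Q : Proc)
  | sendR (k : ℕ) (P : Proc)
  | sendL (k : ℕ) (P : Proc)
  | caseL (L : Finset ℕ) (P : L → Proc)
  | caseR (L : Finset ℕ) (P : L → Proc)
  | muR (t : ℕ) (P : Proc)
  | muL (t : ℕ) (P : Proc)
  | nuR (t : ℕ) (P : Proc)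
  | nuL (t : ℕ) (P : Proc)
  | call (X : ℕ)

/-- Configurations: empty, a single process, and composition along a private channel of type `A`. -/
inductive Conf
  | emp
  | proc (P : Proc)
  | comp (A : Ty) (C₁ C₂ : Conf)

/-- A finite set of process definitions `u : left X ⊢ X = body X :: (w : right X)`, `X ∈ dom`. -/
structure Defs where
  dom : Finset ℕ
  left : ℕ → Option Ty
  right : ℕ → Ty
  body : ℕ → Proc

/-- Generations `g + off`, where `g` is either a generation variable or (for `none`) zero. -/
structure Gen where
  base : Option ℕ
  off : ℕ

def Gen.next (g : Gen) : Gen := ⟨g.base, g.off + 1⟩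

/-- Generational variables `x^α` with names in `N`: generational channels of processes, and
generational position variables of the metalogic. -/
structure GV (N : Type) where
  name : N
  gen : Gen

def GV.next {N : Type} (a : GV N) : GV N := ⟨a.name, a.gen.next⟩

/-- The relations collected in `Ω`: `a_i = b_i` and `a_i < b_i` at priority `i`. -/
inductive Rel (N : Type)
  | eq (i : ℕ) (a b : GV N)
  | lt (i : ℕ) (a b : GV N)

def Rel.lhs {N : Type} : Rel N → GV N
  | .eq _ a _ => a
  | .lt _ a _ => a

def Rel.rhs {N : Type} : Rel N → GV N
  | .eq _ _ b => b
  | .lt _ _ b => b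

section Order
variable {N : Type}

/-- `a = b`: equality at every priority. -/
def same (a b : GV N) : Set (Rel N) := {r | ∃ i, r = .eq i a b}

/-- The relations `{a'_i = a_i | i ≠ j}`. -/
def unfEq (j : ℕ) (a' a : GV N) : Set (Rel N) := {r | ∃ i, i ≠ j ∧ r = .eq i a' a}

/-- The relations `{a'_i = a_i | i ≠ j} ∪ {a'_j < a_j}`. -/
def unfLt (j : ℕ) (a' a : GV N) : Set (Rel N) := unfEq j a' a ∪ {.lt j a' a}

/-- `Ω ⊨ a_i ≤ b_i`: derivable from the reflexive transitive closure of `Ω`. -/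
def Le (Ω : Set (Rel N)) (i : ℕ) : GV N → GV N → Prop :=
  Relation.ReflTransGen fun a b => .eq i a b ∈ Ω ∨ .eq i b a ∈ Ω ∨ .lt i a b ∈ Ω

/-- `Ω ⊨ a_i = b_i`. -/
def Eqv (Ω : Set (Rel N)) (i : ℕ) : GV N → GV N → Prop :=
  Relation.ReflTransGen fun a b => .eq i a b ∈ Ω ∨ .eq i b a ∈ Ω

/-- `Ω ⊨ a_i < b_i`. -/
def Lt (Ω : Set (Rel N)) (i : ℕ) (a b : GV N) : Prop :=
  ∃ c d, Le Ω i a c ∧ .lt i c d ∈ Ω ∧ Le Ω i d b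

/-- `snap a <_Ω snap b`, for snapshots listing the priorities up to `n`: lexicographic order. -/
def SnapLt (Ω : Set (Rel N)) (n : ℕ) (a b : GV N) : Prop :=
  ∃ j ≤ n, (∀ i < j, Eqv Ω i a b) ∧ Lt Ω j a b

end Order

section Derivations
variable {J : Type}

/-- No premise. -/
def noPrem : ℕ → Option J := fun _ => none
/-- One premise. -/
def prem1 (a : J) : ℕ → Option J := fun i => if i = 0 then some a else none
/-- Two premises. -/
def prem2 (a b : J) : ℕ → Option J := fun i => if i = 0 then some a else if i = 1 then some b else none
/-- One premise for each label in `L`. -/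
def premL (L : Finset ℕ) (f : L → J) : ℕ → Option J :=
  fun i => if h : i ∈ L then some (f ⟨i, h⟩) else none

/-- A (possibly infinite) tree of judgments, presented as a rooted graph of nodes: `prem v i` is the
node above `v` at the `i`-th premise. -/
structure Graph (J : Type) where
  Node : Type
  root : Node
  concl : Node → J
  prem : Node → ℕ → Option Node

variable (G : Graph J)

/-- `v` is a premise of `u`. -/
def Graph.Step (u v : G.Node) : Prop := ∃ i, G.prem u i = some v

/-- `v` occurs in the tree. -/
def Graph.Reach (v : G.Node) : Prop := Relation.ReflTransGen G.Step G.root v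

/-- `G` is a (possibly infinite) derivation: each of its nodes is an instance of a rule. -/
def Graph.IsDerivation (rule : J → (ℕ → Option J) → Prop) : Prop :=
  ∀ v, G.Reach v → rule (G.concl v) fun i => (G.prem v i).map G.concl

/-- Infinite branches. -/
def Graph.IsBranch (b : ℕ → G.Node) : Prop := b 0 = G.root ∧ ∀ k, G.Step (b k) (b (k + 1))

/-- Along the branch `b` there are infinitely many generational variables `x 0, x 1, …`, the `k`-th
one occurring in `vars` of the judgment at position `f k`, with
`snap (x 0) > snap (x 1) > …`, each inequality with respect to the relations `om` of the judgment in
which the smaller variable occurs. -/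
def Graph.IsTrace {N : Type} (n : ℕ) (om : J → Set (Rel N)) (vars : J → Set (GV N))
    (b : ℕ → G.Node) : Prop :=
  ∃ (f : ℕ → ℕ) (x : ℕ → GV N), StrictMono f ∧ (∀ k, x k ∈ vars (G.concl (b (f k)))) ∧
    ∀ k, SnapLt (om (G.concl (b (f (k + 1))))) n (x (k + 1)) (x k)

end Derivations

/-- Variables of the first order metalogic that are used here: channel variables and
generation variables. -/
inductive Var
  | chan (x : ℕ)
  | gen (g : ℕ)

/-- An endpoint `x^α : A` of a process. -/
structure Ep where
  ch : ℕ
  gen : Gen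
  ty : Ty

def Ep.gv (e : Ep) : GV ℕ := ⟨e.ch, e.gen⟩

/-- The next generation of the channel, at type `A`. -/
def Ep.next (e : Ep) (A : Ty) : Ep := ⟨e.ch, e.gen.next, A⟩

/-- Annotated process typing judgments `x^α : ω ⊢_Ω P :: (y^β : B)`.  `seen` holds the channel names
and generation variables used so far; it serves only for the freshness condition of the cut rule. -/
structure PJ where
  left : Option Ep
  om : Set (Rel ℕ)
  proc : Proc
  right : Ep
  seen : Set Var

/-- Infinitary typing rules for processes (conclusion, premises).  In the cut rule both the name and
the generation of the spawned channel are fresh. -/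
inductive PRule (S : TySig) (V : Defs) : PJ → (ℕ → Option PJ) → Prop
  | id {Ω s x α A y β} :
      PRule S V ⟨some ⟨x, α, A⟩, Ω, .fwd, ⟨y, β, A⟩, s⟩ noPrem
  | cut {l Ω A P Q y s w g} : Var.chan w ∉ s → Var.gen g ∉ s →
      PRule S V ⟨l, Ω, .cut A P Q, y, s⟩
        (prem2 ⟨l, Ω, P, ⟨w, ⟨some g, 0⟩, A⟩, insert (.chan w) (insert (.gen g) s)⟩
          ⟨some ⟨w, ⟨some g, 0⟩, A⟩, Ω, Q, y, insert (.chan w) (insert (.gen g) s)⟩)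
  | oneR {Ω y β s} : PRule S V ⟨none, Ω, .close, ⟨y, β, .one⟩, s⟩ noPrem
  | oneL {Ω x α Q y s} :
      PRule S V ⟨some ⟨x, α, .one⟩, Ω, .wait Q, y, s⟩ (prem1 ⟨none, Ω, Q, y, s⟩)
  | plusR {l Ω k P s y β} {L : Finset ℕ} {A : L → Ty} (hk : k ∈ L) :
      PRule S V ⟨l, Ω, .sendR k P, ⟨y, β, .plus L A⟩, s⟩
        (prem1 ⟨l, Ω ∪ same ⟨y, β⟩ ⟨y, β.next⟩, P, ⟨y, β.next, A ⟨k, hk⟩⟩, s⟩)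
  | plusL {Ω s x α y} {L : Finset ℕ} {A : L → Ty} {P : L → Proc} :
      PRule S V ⟨some ⟨x, α, .plus L A⟩, Ω, .caseL L P, y, s⟩
        (premL L fun l => ⟨some ⟨x, α.next, A l⟩, Ω ∪ same ⟨x, α⟩ ⟨x, α.next⟩, P l, y, s⟩)
  | wthR {l Ω s y β} {L : Finset ℕ} {A : L → Ty} {P : L → Proc} :
      PRule S V ⟨l, Ω, .caseR L P, ⟨y, β, .wth L A⟩, s⟩
        (premL L fun k => ⟨l, Ω ∪ same ⟨y, β⟩ ⟨y, β.next⟩, P k, ⟨y, β.next, A k⟩, s⟩)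
  | wthL {Ω k P s x α y} {L : Finset ℕ} {A : L → Ty} (hk : k ∈ L) :
      PRule S V ⟨some ⟨x, α, .wth L A⟩, Ω, .sendL k P, y, s⟩
        (prem1 ⟨some ⟨x, α.next, A ⟨k, hk⟩⟩, Ω ∪ same ⟨x, α⟩ ⟨x, α.next⟩, P, y, s⟩)
  | muR {l Ω t P s y β} : t ∈ S.dom → S.kind t = .mu →
      PRule S V ⟨l, Ω, .muR t P, ⟨y, β, .tv t⟩, s⟩
        (prem1 ⟨l, Ω ∪ unfEq (S.prio t) ⟨y, β.next⟩ ⟨y, β⟩, P, ⟨y, β.next, S.body t⟩, s⟩)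
  | muL {Ω t P s x α y} : t ∈ S.dom → S.kind t = .mu →
      PRule S V ⟨some ⟨x, α, .tv t⟩, Ω, .muL t P, y, s⟩
        (prem1 ⟨some ⟨x, α.next, S.body t⟩, Ω ∪ unfLt (S.prio t) ⟨x, α.next⟩ ⟨x, α⟩, P, y, s⟩)
  | nuR {l Ω t P s y β} : t ∈ S.dom → S.kind t = .nu →
      PRule S V ⟨l, Ω, .nuR t P, ⟨y, β, .tv t⟩, s⟩
        (prem1 ⟨l, Ω ∪ unfLt (S.prio t) ⟨y, β.next⟩ ⟨y, β⟩, P, ⟨y, β.next, S.body t⟩, s⟩)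
  | nuL {Ω t P s x α y} : t ∈ S.dom → S.kind t = .nu →
      PRule S V ⟨some ⟨x, α, .tv t⟩, Ω, .nuL t P, y, s⟩
        (prem1 ⟨some ⟨x, α.next, S.body t⟩, Ω ∪ unfEq (S.prio t) ⟨x, α.next⟩ ⟨x, α⟩, P, y, s⟩)
  | call {l Ω X y s} : X ∈ V.dom → l.map Ep.ty = V.left X → y.ty = V.right X →
      PRule S V ⟨l, Ω, .call X, y, s⟩ (prem1 ⟨l, Ω, V.body X, y, s⟩)

/-- The generational channels to the left of the turnstile. -/
def PJ.leftVars (j : PJ) : Set (GV ℕ) := {a | ∃ e, j.left = some e ∧ a = e.gv}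

/-- The generational channel to the right of the turnstile. -/
def PJ.rightVars (j : PJ) : Set (GV ℕ) := {j.right.gv}

/-- A typing derivation is guarded if each of its infinite branches is a left `μ`-trace or a right
`ν`-trace. -/
def Guarded (S : TySig) (D : Graph PJ) : Prop :=
  ∀ b, D.IsBranch b →
    D.IsTrace S.n PJ.om PJ.leftVars b ∨ D.IsTrace S.n PJ.om PJ.rightVars b

/-- Messages: `closed`, labels, and unfolding messages `μ_t`, `ν_t`. -/
inductive Msg
  | closed
  | label (k : ℕ)
  | mu (t : ℕ)
  | nu (t : ℕ)

/-- Terms of the metalogic, in locally nameless style: `bv` are bound variables (de Bruijn indices),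
`fv` free variables.  Session types, configurations and messages are closed expressions and serve as
constants; `gch x α` is the term `x^α`. -/
inductive Term
  | bv (k : ℕ)
  | fv (v : Var)
  | zero
  | succ (t : Term)
  | gch (x α : Term)
  | ty (A : Ty)
  | conf (C : Conf)
  | msg (m : Msg)

def Term.opn (k : ℕ) (u : Term) : Term → Term
  | .bv i => if i = k then u else .bv i
  | .succ t => .succ (Term.opn k u t)
  | .gch x α => .gch (Term.opn k u x) (Term.opn k u α)
  | t => t

def Term.subst (θ : Var → Term) : Term → Term
  | .fv v => θ v
  | .succ t => .succ (t.subst θ)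
  | .gch x α => .gch (x.subst θ) (α.subst θ)
  | t => t

/-- The free variable `v` occurs. -/
def Term.Occ (v : Var) : Term → Prop
  | .fv u => u = v
  | .succ t => t.Occ v
  | .gch x α => x.Occ v ∨ α.Occ v
  | _ => False

/-- No dangling bound variable. -/
def Term.LC : Term → Prop
  | .bv _ => False
  | .succ t => t.LC
  | .gch x α => x.LC ∧ α.LC
  | _ => True

/-- Predicate symbols. -/
inductive Pred
  | cfg
  | prog
  | msg

/-- Formulas, with `n`-ary `⊕` and `&` over finite sets of labels; `0` and `⊤` are the nullary ones. -/
inductive Form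
  | one
  | tens (A B : Form)
  | lolli (A B : Form)
  | plus (I : Finset ℕ) (A : I → Form)
  | wth (I : Finset ℕ) (A : I → Form)
  | ex (A : Form)
  | all (A : Form)
  | eq (s t : Term)
  | atom (p : Pred) (ts : List Term)

/-- Instantiate the bound variable with index `k`. -/
def Form.opn (k : ℕ) (u : Term) : Form → Form
  | .one => .one
  | .tens A B => .tens (A.opn k u) (B.opn k u)
  | .lolli A B => .lolli (A.opn k u) (B.opn k u)
  | .plus I A => .plus I fun i => (A i).opn k u
  | .wth I A => .wth I fun i => (A i).opn k u
  | .ex A => .ex (A.opn (k + 1) u)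
  | .all A => .all (A.opn (k + 1) u)
  | .eq s t => .eq (Term.opn k u s) (Term.opn k u t)
  | .atom p ts => .atom p (ts.map (Term.opn k u))

def Form.subst (θ : Var → Term) : Form → Form
  | .one => .one
  | .tens A B => .tens (A.subst θ) (B.subst θ)
  | .lolli A B => .lolli (A.subst θ) (B.subst θ)
  | .plus I A => .plus I fun i => (A i).subst θ
  | .wth I A => .wth I fun i => (A i).subst θ
  | .ex A => .ex (A.subst θ)
  | .all A => .all (A.subst θ)
  | .eq s t => .eq (s.subst θ) (t.subst θ)
  | .atom p ts => .atom p (ts.map (Term.subst θ))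

/-- The free variable `v` occurs. -/
def Form.Occ (v : Var) : Form → Prop
  | .one => False
  | .tens A B => A.Occ v ∨ B.Occ v
  | .lolli A B => A.Occ v ∨ B.Occ v
  | .plus _ A => ∃ i, (A i).Occ v
  | .wth _ A => ∃ i, (A i).Occ v
  | .ex A => A.Occ v
  | .all A => A.Occ v
  | .eq s t => s.Occ v ∨ t.Occ v
  | .atom _ ts => ∃ t ∈ ts, t.Occ v

/-- `θ` unifies `s` and `t`. -/
def Unifies (θ : Var → Term) (s t : Term) : Prop :=
  (∀ v, (θ v).LC) ∧ s.subst θ = t.subst θ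

/-- `θ` is a most general unifier of `s` and `t`. -/
def IsMGU (θ : Var → Term) (s t : Term) : Prop :=
  Unifies θ s t ∧ ∀ σ, Unifies σ s t → ∃ τ : Var → Term, (∀ v, (τ v).LC) ∧ ∀ v, σ v = (θ v).subst τ

/-- Signatures of the metalogic.  `defn p t a i A` says that the instance `p(t)` of a predicate is
defined by `p(t) =^i_a A`.  Definitions may be given by pattern matching: an instance has at most one
definition, and definitions are closed under substitution. -/
structure Sig where
  defn : Pred → List Term → FP → ℕ → Form → Prop
  functional : ∀ {p ts a i A a' i' A'}, defn p ts a i A → defn p ts a' i' A' →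
    a = a' ∧ i = i' ∧ A = A'
  subst : ∀ {p ts a i A} (θ : Var → Term), defn p ts a i A →
    defn p (ts.map (Term.subst θ)) a i (A.subst θ)
  kind_eq : ∀ {p ts a i A p' ts' a' A'}, defn p ts a i A → defn p' ts' a' i A' → a = a'

/-- Names of position variables.  `ch x` is the position variable that matches the channel `x`; the
other ones are further names, indexed by natural numbers. -/
inductive PN
  | ch (x : ℕ)
  | cfg (d : ℕ)
  | msgL (d : ℕ)
  | msgR (d : ℕ)

/-- Annotated sequents `Δ ⊢_Ω z^β : C`. -/
structure Seq where
  ante : Multiset (GV PN × Form)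
  om : Set (Rel PN)
  succ : GV PN × Form

/-- The position variable name `w` does not occur in the sequent. -/
def Seq.FreshName (s : Seq) (w : PN) : Prop :=
  (∀ p ∈ s.ante, p.1.name ≠ w) ∧ s.succ.1.name ≠ w ∧
    ∀ r ∈ s.om, r.lhs.name ≠ w ∧ r.rhs.name ≠ w

/-- The first order variable `v` does not occur in the sequent. -/
def Seq.FreshVar (s : Seq) (v : Var) : Prop :=
  (∀ p ∈ s.ante, ¬ p.2.Occ v) ∧ ¬ s.succ.2.Occ v

/-- The position variables annotating the formulas of the sequent are pairwise distinct. -/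
def Seq.Distinct (s : Seq) : Prop := (s.succ.1 ::ₘ s.ante.map Prod.fst).Nodup

/-- The infinitary sequent calculus for first order intuitionistic multiplicative additive linear
logic with fixed points, annotated with generational position variables (conclusion, premises). -/
inductive LRule (Sg : Sig) : Seq → (ℕ → Option Seq) → Prop
  | id {x z A Ω} : LRule Sg ⟨{(x, A)}, Ω, (z, A)⟩ noPrem
  | cut {Δ Δ' Ω w A z C} : Seq.FreshName ⟨Δ + Δ', Ω, (z, C)⟩ w.name →
      LRule Sg ⟨Δ + Δ', Ω, (z, C)⟩ (prem2 ⟨Δ, Ω, (w, A)⟩ ⟨(w, A) ::ₘ Δ', Ω, (z, C)⟩)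
  | oneR {Ω z} : LRule Sg ⟨0, Ω, (z, .one)⟩ noPrem
  | oneL {Δ Ω y z C} : LRule Sg ⟨(y, .one) ::ₘ Δ, Ω, (z, C)⟩ (prem1 ⟨Δ, Ω, (z, C)⟩)
  | tensR {Δ Δ' Ω w z A B} : Seq.FreshName ⟨Δ + Δ', Ω, (z, .tens A B)⟩ w.name →
      LRule Sg ⟨Δ + Δ', Ω, (z, .tens A B)⟩
        (prem2 ⟨Δ, Ω ∪ same w z, (w, A)⟩ ⟨Δ', Ω, (z, B)⟩)
  | tensL {Δ Ω w y z A B C} : Seq.FreshName ⟨(y, .tens A B) ::ₘ Δ, Ω, (z, C)⟩ w.name →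
      LRule Sg ⟨(y, .tens A B) ::ₘ Δ, Ω, (z, C)⟩
        (prem1 ⟨(w, A) ::ₘ (y, B) ::ₘ Δ, Ω ∪ same w y, (z, C)⟩)
  | lolliR {Δ Ω w z A B} : Seq.FreshName ⟨Δ, Ω, (z, .lolli A B)⟩ w.name →
      LRule Sg ⟨Δ, Ω, (z, .lolli A B)⟩ (prem1 ⟨(w, A) ::ₘ Δ, Ω, (z, B)⟩)
  | lolliL {Δ Δ' Ω w y z A B C} : Seq.FreshName ⟨(y, .lolli A B) ::ₘ (Δ + Δ'), Ω, (z, C)⟩ w.name →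
      LRule Sg ⟨(y, .lolli A B) ::ₘ (Δ + Δ'), Ω, (z, C)⟩
        (prem2 ⟨Δ, Ω, (w, A)⟩ ⟨(y, B) ::ₘ Δ', Ω, (z, C)⟩)
  | plusR {Δ Ω z} {I : Finset ℕ} {A : I → Form} (k : I) :
      LRule Sg ⟨Δ, Ω, (z, .plus I A)⟩ (prem1 ⟨Δ, Ω, (z, A k)⟩)
  | plusL {Δ Ω y z C} {I : Finset ℕ} {A : I → Form} :
      LRule Sg ⟨(y, .plus I A) ::ₘ Δ, Ω, (z, C)⟩ (premL I fun i => ⟨(y, A i) ::ₘ Δ, Ω, (z, C)⟩)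
  | wthR {Δ Ω z} {I : Finset ℕ} {A : I → Form} :
      LRule Sg ⟨Δ, Ω, (z, .wth I A)⟩ (premL I fun i => ⟨Δ, Ω, (z, A i)⟩)
  | wthL {Δ Ω y z C} {I : Finset ℕ} {A : I → Form} (k : I) :
      LRule Sg ⟨(y, .wth I A) ::ₘ Δ, Ω, (z, C)⟩ (prem1 ⟨(y, A k) ::ₘ Δ, Ω, (z, C)⟩)
  | exR {Δ Ω z A} (t : Term) : t.LC →
      LRule Sg ⟨Δ, Ω, (z, .ex A)⟩ (prem1 ⟨Δ, Ω, (z, A.opn 0 t)⟩)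
  | exL {Δ Ω y z A C} (v : Var) : Seq.FreshVar ⟨(y, .ex A) ::ₘ Δ, Ω, (z, C)⟩ v →
      LRule Sg ⟨(y, .ex A) ::ₘ Δ, Ω, (z, C)⟩ (prem1 ⟨(y, A.opn 0 (.fv v)) ::ₘ Δ, Ω, (z, C)⟩)
  | allR {Δ Ω z A} (v : Var) : Seq.FreshVar ⟨Δ, Ω, (z, .all A)⟩ v →
      LRule Sg ⟨Δ, Ω, (z, .all A)⟩ (prem1 ⟨Δ, Ω, (z, A.opn 0 (.fv v))⟩)
  | allL {Δ Ω y z A C} (t : Term) : t.LC →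
      LRule Sg ⟨(y, .all A) ::ₘ Δ, Ω, (z, C)⟩ (prem1 ⟨(y, A.opn 0 t) ::ₘ Δ, Ω, (z, C)⟩)
  | muR {Δ Ω z p ts j A} : Sg.defn p ts .mu j A →
      LRule Sg ⟨Δ, Ω, (z, .atom p ts)⟩ (prem1 ⟨Δ, Ω ∪ unfEq j z.next z, (z.next, A)⟩)
  | muL {Δ Ω y z p ts j A C} : Sg.defn p ts .mu j A →
      LRule Sg ⟨(y, .atom p ts) ::ₘ Δ, Ω, (z, C)⟩
        (prem1 ⟨(y.next, A) ::ₘ Δ, Ω ∪ unfLt j y.next y, (z, C)⟩)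
  | nuR {Δ Ω z p ts j A} : Sg.defn p ts .nu j A →
      LRule Sg ⟨Δ, Ω, (z, .atom p ts)⟩ (prem1 ⟨Δ, Ω ∪ unfLt j z.next z, (z.next, A)⟩)
  | nuL {Δ Ω y z p ts j A C} : Sg.defn p ts .nu j A →
      LRule Sg ⟨(y, .atom p ts) ::ₘ Δ, Ω, (z, C)⟩
        (prem1 ⟨(y.next, A) ::ₘ Δ, Ω ∪ unfEq j y.next y, (z, C)⟩)
  | eqR {Ω z s} : LRule Sg ⟨0, Ω, (z, .eq s s)⟩ noPrem
  | eqL {Δ Ω y z s t C} (θ : Var → Term) : IsMGU θ s t →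
      LRule Sg ⟨(y, .eq s t) ::ₘ Δ, Ω, (z, C)⟩
        (prem1 ⟨Δ.map fun p => (p.1, p.2.subst θ), Ω, (z, C.subst θ)⟩)
  | eqLnone {Δ Ω y z s t C} : (¬ ∃ θ, Unifies θ s t) →
      LRule Sg ⟨(y, .eq s t) ::ₘ Δ, Ω, (z, C)⟩ noPrem

/-- Inferences of the calculus: rule instances whose conclusion has distinct position variables. -/
def LStep (Sg : Sig) (s : Seq) (ps : ℕ → Option Seq) : Prop := s.Distinct ∧ LRule Sg s ps

def Seq.leftVars (s : Seq) : Set (GV PN) := {a | ∃ p ∈ s.ante, a = p.1}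

def Seq.rightVars (s : Seq) : Set (GV PN) := {s.succ.1}

/-- A derivation is valid if each of its infinite branches is a left `μ`-trace or a right `ν`-trace;
`n` is the maximum priority of the signature. -/
def Valid (n : ℕ) (G : Graph Seq) : Prop :=
  ∀ b, G.IsBranch b → G.IsTrace n Seq.om Seq.leftVars b ∨ G.IsTrace n Seq.om Seq.rightVars b

/-- Endpoints `x^α : A` in the metalogic, where `x` and `α` are terms. -/
structure TEp where
  nm : Term
  gen : Term
  ty : Ty

/-- The next generation of an endpoint, at type `A`. -/
def TEp.next (e : TEp) (A : Ty) : TEp := ⟨e.nm, .succ e.gen, A⟩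

def TEp.args (e : TEp) : List Term := [e.nm, e.gen, .ty e.ty]

/-- The formula `Msg(x^α.m)`. -/
def msgF (e : TEp) (m : Msg) : Form := .atom .msg [e.nm, e.gen, .msg m]

/-- Arguments of the predicate `[y^β : B]`, respectively `[· : ·]`. -/
def progArgs : Option TEp → List Term
  | some e => e.args
  | none => []

/-- The formula `[y^β : B]`, respectively `[· : ·]`. -/
def progF (e : Option TEp) : Form := .atom .prog (progArgs e)

/-- Arguments of the predicate `Cfg_{x^α:ω, y^β:B}(C)`. -/
def cfgArgs (l : Option TEp) (r : TEp) (C : Conf) : List Term := progArgs l ++ r.args ++ [.conf C]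

/-- The formula `Cfg_{x^α:ω, y^β:B}(C)`. -/
def cfgF (l : Option TEp) (r : TEp) (C : Conf) : Form := .atom .cfg (cfgArgs l r C)

/-- The formula `∃ z. ∃ η. Cfg_{l, z^η:A}(C₁) ⊗ Cfg_{z^η:A, r}(C₂)`. -/
def spawnF (l : Option TEp) (r : TEp) (A : Ty) (C₁ C₂ : Conf) : Form :=
  .ex (.ex (.tens (cfgF l ⟨.bv 1, .bv 0, A⟩ C₁) (cfgF (some ⟨.bv 1, .bv 0, A⟩) r C₂)))

/-- Definition of the strong progress predicate `[y^β : B]`. -/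
inductive ProgDefn (S : TySig) : Option TEp → FP → ℕ → Form → Prop
  | one {y β} : ProgDefn S (some ⟨y, β, .one⟩) .mu (S.n + 2)
      (.tens (msgF ⟨y, β, .one⟩ .closed) (progF none))
  | wth {y β} {L : Finset ℕ} {A : L → Ty} : ProgDefn S (some ⟨y, β, .wth L A⟩) .mu (S.n + 2)
      (.wth L fun l => .lolli (msgF ⟨y, β, .wth L A⟩ (.label l)) (progF (some ⟨y, .succ β, A l⟩)))
  | nu {y β t} : t ∈ S.dom → S.kind t = .nu → ProgDefn S (some ⟨y, β, .tv t⟩) .nu (S.prio t)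
      (.lolli (msgF ⟨y, β, .tv t⟩ (.nu t)) (progF (some ⟨y, .succ β, S.body t⟩)))
  | plus {y β} {L : Finset ℕ} {A : L → Ty} : ProgDefn S (some ⟨y, β, .plus L A⟩) .mu (S.n + 2)
      (.plus L fun l => .tens (msgF ⟨y, β, .plus L A⟩ (.label l)) (progF (some ⟨y, .succ β, A l⟩)))
  | mu {y β t} : t ∈ S.dom → S.kind t = .mu → ProgDefn S (some ⟨y, β, .tv t⟩) .mu (S.prio t)
      (.tens (msgF ⟨y, β, .tv t⟩ (.mu t)) (progF (some ⟨y, .succ β, S.body t⟩)))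
  | emp : ProgDefn S none .mu (S.n + 2) .one

/-- Definition of the predicate `Cfg`: the asynchronous semantics of configurations. -/
inductive CfgDefn (S : TySig) (V : Defs) : Option TEp → TEp → Conf → FP → ℕ → Form → Prop
  | emp {x} : CfgDefn S V (some x) x .emp .mu (S.n + 2) .one
  | comp {l r A C₁ C₂} : CfgDefn S V l r (.comp A C₁ C₂) .mu (S.n + 2) (spawnF l r A C₁ C₂)
  | fwd {x α A y β} : CfgDefn S V (some ⟨x, α, A⟩) ⟨y, β, A⟩ (.proc .fwd) .mu (S.n + 2)
      (.eq (.gch x α) (.gch y β))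
  | cut {l r A P Q} : CfgDefn S V l r (.proc (.cut A P Q)) .mu (S.n + 2)
      (spawnF l r A (.proc P) (.proc Q))
  | close {y β} : CfgDefn S V none ⟨y, β, .one⟩ (.proc .close) .mu (S.n + 2)
      (.tens (msgF ⟨y, β, .one⟩ .closed) .one)
  | wait {x α r Q} : CfgDefn S V (some ⟨x, α, .one⟩) r (.proc (.wait Q)) .mu (S.n + 2)
      (.lolli (msgF ⟨x, α, .one⟩ .closed) (cfgF none r (.proc Q)))
  | caseR {l y β} {L : Finset ℕ} {P} {B : L → Ty} :
      CfgDefn S V l ⟨y, β, .wth L B⟩ (.proc (.caseR L P)) .mu (S.n + 2)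
      (.wth L fun k => .lolli (msgF ⟨y, β, .wth L B⟩ (.label k))
        (cfgF l ⟨y, .succ β, B k⟩ (.proc (P k))))
  | sendL {x α r k Q} {L : Finset ℕ} {A : L → Ty} (hk : k ∈ L) :
      CfgDefn S V (some ⟨x, α, .wth L A⟩) r (.proc (.sendL k Q)) .mu (S.n + 2)
      (.tens (msgF ⟨x, α, .wth L A⟩ (.label k))
        (cfgF (some ⟨x, .succ α, A ⟨k, hk⟩⟩) r (.proc Q)))
  | sendR {l y β k Q} {L : Finset ℕ} {B : L → Ty} (hk : k ∈ L) :
      CfgDefn S V l ⟨y, β, .plus L B⟩ (.proc (.sendR k Q)) .mu (S.n + 2)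
      (.tens (msgF ⟨y, β, .plus L B⟩ (.label k)) (cfgF l ⟨y, .succ β, B ⟨k, hk⟩⟩ (.proc Q)))
  | caseL {x α r} {L : Finset ℕ} {P} {A : L → Ty} :
      CfgDefn S V (some ⟨x, α, .plus L A⟩) r (.proc (.caseL L P)) .mu (S.n + 2)
      (.wth L fun k => .lolli (msgF ⟨x, α, .plus L A⟩ (.label k))
        (cfgF (some ⟨x, .succ α, A k⟩) r (.proc (P k))))
  | nuR {l y β t Q} : t ∈ S.dom → S.kind t = .nu →
      CfgDefn S V l ⟨y, β, .tv t⟩ (.proc (.nuR t Q)) .mu (S.n + 2)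
      (.lolli (msgF ⟨y, β, .tv t⟩ (.nu t)) (cfgF l ⟨y, .succ β, S.body t⟩ (.proc Q)))
  | nuL {x α r t Q} : t ∈ S.dom → S.kind t = .nu →
      CfgDefn S V (some ⟨x, α, .tv t⟩) r (.proc (.nuL t Q)) .mu (S.n + 2)
      (.tens (msgF ⟨x, α, .tv t⟩ (.nu t)) (cfgF (some ⟨x, .succ α, S.body t⟩) r (.proc Q)))
  | muR {l y β t Q} : t ∈ S.dom → S.kind t = .mu →
      CfgDefn S V l ⟨y, β, .tv t⟩ (.proc (.muR t Q)) .mu (S.n + 2)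
      (.tens (msgF ⟨y, β, .tv t⟩ (.mu t)) (cfgF l ⟨y, .succ β, S.body t⟩ (.proc Q)))
  | muL {x α r t Q} : t ∈ S.dom → S.kind t = .mu →
      CfgDefn S V (some ⟨x, α, .tv t⟩) r (.proc (.muL t Q)) .mu (S.n + 2)
      (.lolli (msgF ⟨x, α, .tv t⟩ (.mu t)) (cfgF (some ⟨x, .succ α, S.body t⟩) r (.proc Q)))
  | call {l r X} : X ∈ V.dom → l.map TEp.ty = V.left X → r.ty = V.right X →
      CfgDefn S V l r (.proc (.call X)) .nu (S.n + 1) (cfgF l r (.proc (V.body X)))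

def TEp.subst (θ : Var → Term) (e : TEp) : TEp := ⟨e.nm.subst θ, e.gen.subst θ, e.ty⟩

theorem progArgs_subst (θ : Var → Term) (e : Option TEp) :
    (progArgs e).map (Term.subst θ) = progArgs (e.map (TEp.subst θ)) := by
  cases e <;> simp [progArgs, TEp.args, TEp.subst, Term.subst]

theorem cfgArgs_subst (θ : Var → Term) (l : Option TEp) (r : TEp) (C : Conf) :
    (cfgArgs l r C).map (Term.subst θ) = cfgArgs (l.map (TEp.subst θ)) (r.subst θ) C := by
  simp only [cfgArgs, List.map_append, progArgs_subst]
  simp [TEp.args, TEp.subst, Term.subst]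

theorem progArgs_inj {e e' : Option TEp} (h : progArgs e = progArgs e') : e = e' := by
  rcases e with _ | ⟨a, b, c⟩ <;> rcases e' with _ | ⟨a', b', c'⟩ <;>
    simp_all [progArgs, TEp.args]

theorem cfgArgs_inj {l l' : Option TEp} {r r' : TEp} {C C' : Conf}
    (h : cfgArgs l r C = cfgArgs l' r' C') : l = l' ∧ r = r' ∧ C = C' := by
  rcases l with _ | ⟨a, b, c⟩ <;> rcases l' with _ | ⟨a', b', c'⟩ <;> rcases r with ⟨d, e, f⟩ <;>
    rcases r' with ⟨d', e', f'⟩ <;> simp_all [cfgArgs, progArgs, TEp.args]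

theorem ProgDefn.functional {S : TySig} {e a i A a' i' A'} (h : ProgDefn S e a i A)
    (h' : ProgDefn S e a' i' A') : a = a' ∧ i = i' ∧ A = A' := by
  cases h <;> cases h' <;> simp_all

theorem CfgDefn.functional {S : TySig} {V : Defs} {l r C a i A a' i' A'}
    (h : CfgDefn S V l r C a i A) (h' : CfgDefn S V l r C a' i' A') :
    a = a' ∧ i = i' ∧ A = A' := by
  cases h <;> cases h' <;> simp_all

theorem ProgDefn.subst {S : TySig} {e a i A} (θ : Var → Term) (h : ProgDefn S e a i A) :
    ProgDefn S (e.map (TEp.subst θ)) a i (A.subst θ) := by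
  cases h <;>
    simp [TEp.subst, Form.subst, msgF, progF, progArgs, TEp.args, Term.subst] <;>
    first
    | exact .one
    | exact .wth
    | exact .plus
    | exact .nu ‹_› ‹_›
    | exact .mu ‹_› ‹_›
    | exact .emp

theorem spawnF_subst (θ : Var → Term) (l r A C₁ C₂) :
    (spawnF l r A C₁ C₂).subst θ = spawnF (l.map (TEp.subst θ)) (r.subst θ) A C₁ C₂ := by
  simp only [spawnF, cfgF, Form.subst, cfgArgs_subst]
  simp [TEp.subst, Term.subst]

theorem cfgF_subst (θ : Var → Term) (l r C) :
    (cfgF l r C).subst θ = cfgF (l.map (TEp.subst θ)) (r.subst θ) C := by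
  simp only [cfgF, Form.subst, cfgArgs_subst]

theorem msgF_subst (θ : Var → Term) (e m) : (msgF e m).subst θ = msgF (e.subst θ) m := by
  simp [msgF, Form.subst, TEp.subst, Term.subst]

theorem CfgDefn.subst {S : TySig} {V : Defs} {l r C a i A} (θ : Var → Term)
    (h : CfgDefn S V l r C a i A) :
    CfgDefn S V (l.map (TEp.subst θ)) (r.subst θ) C a i (A.subst θ) := by
  cases h <;>
    simp only [spawnF_subst, cfgF_subst, msgF_subst, Form.subst, TEp.subst, Term.subst,
      Option.map_some, Option.map_none]
  case call hX hl hr =>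
    refine .call hX ?_ hr
    rw [← hl]; cases l <;> rfl
  all_goals first
    | exact .emp
    | exact .comp
    | exact .fwd
    | exact .cut
    | exact .close
    | exact .wait
    | exact .caseR
    | exact .sendL _
    | exact .sendR _
    | exact .caseL
    | exact .nuR ‹_› ‹_›
    | exact .nuL ‹_› ‹_›
    | exact .muR ‹_› ‹_›
    | exact .muL ‹_› ‹_›

/-- Definitions of all predicates; `Msg` is not defined by a fixed point. -/
def stDefn (S : TySig) (V : Defs) (p : Pred) (ts : List Term) (a : FP) (i : ℕ) (A : Form) : Prop :=
  match p with
  | .cfg => ∃ l r C, ts = cfgArgs l r C ∧ CfgDefn S V l r C a i A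
  | .prog => ∃ e, ts = progArgs e ∧ ProgDefn S e a i A
  | .msg => False

theorem stDefn.kind {S : TySig} {V : Defs} {p ts a i A} (h : stDefn S V p ts a i A) :
    (∃ t ∈ S.dom, i = S.prio t ∧ a = S.kind t) ∨ (i = S.n + 1 ∧ a = .nu) ∨
      (i = S.n + 2 ∧ a = .mu) := by
  cases p with
  | cfg => obtain ⟨l, r, C, -, h⟩ := h; cases h <;> simp
  | prog =>
    obtain ⟨e, -, h⟩ := h
    cases h with
    | nu ht hk => exact .inl ⟨_, ht, rfl, hk.symm⟩
    | mu ht hk => exact .inl ⟨_, ht, rfl, hk.symm⟩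
    | _ => simp
  | msg => exact h.elim

/-- The signature of the metalogic determined by the session types and the process definitions.  Its
maximum priority is `S.n + 2`. -/
def stSig (S : TySig) (V : Defs) : Sig where
  defn := stDefn S V
  functional := by
    intro p ts a i A a' i' A' h h'
    cases p with
    | cfg =>
      obtain ⟨l, r, C, rfl, h⟩ := h
      obtain ⟨l', r', C', e, h'⟩ := h'
      obtain ⟨rfl, rfl, rfl⟩ := cfgArgs_inj e
      exact h.functional h'
    | prog =>
      obtain ⟨l, rfl, h⟩ := h
      obtain ⟨l', e, h'⟩ := h'
      obtain rfl := progArgs_inj e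
      exact h.functional h'
    | msg => exact h.elim
  subst := by
    intro p ts a i A θ h
    cases p with
    | cfg =>
      obtain ⟨l, r, C, rfl, h⟩ := h
      exact ⟨_, _, _, cfgArgs_subst θ l r C, h.subst θ⟩
    | prog =>
      obtain ⟨l, rfl, h⟩ := h
      exact ⟨_, progArgs_subst θ l, h.subst θ⟩
    | msg => exact h.elim
  kind_eq := by
    intro p ts a i A p' ts' a' A' h h'
    have key : ∀ t ∈ S.dom, S.prio t ≤ S.n := fun t ht => Finset.le_sup (f := S.prio) ht
    rcases stDefn.kind h with ⟨t, ht, e, rfl⟩ | ⟨e, rfl⟩ | ⟨e, rfl⟩ <;>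
    rcases stDefn.kind h' with ⟨t', ht', e', rfl⟩ | ⟨e', rfl⟩ | ⟨e', rfl⟩ <;>
    first
    | rfl
    | exact S.kind_eq _ ht _ ht' (e.symm.trans e')
    | (exfalso; have := key _ ht; omega)
    | (exfalso; have := key _ ht'; omega)
    | (exfalso; omega)

/-- The term for a generation. -/
def genTerm (b : Option ℕ) : ℕ → Term
  | 0 => match b with
    | none => .zero
    | some g => .fv (.gen g)
  | k + 1 => .succ (genTerm b k)

/-- The endpoint `x^α : A` of a process as an endpoint in the metalogic. -/
def Ep.toT (e : Ep) : TEp := ⟨.fv (.chan e.ch), genTerm e.gen.base e.gen.off, e.ty⟩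

/-- The position variable matching a generational channel. -/
def lift (a : GV ℕ) : GV PN := ⟨.ch a.name, a.gen⟩

/-- The annotated formula `𝐱^α : [x^α : A]`. -/
def Ep.progA (e : Ep) : GV PN × Form := (lift e.gv, progF (some e.toT))

/-- The antecedent `𝐱^α : [x^α : ω]`, empty if there is no left channel. -/
def leftA : Option Ep → Multiset (GV PN × Form)
  | none => 0
  | some e => {e.progA}

/-- The formula `Cfg_{x^α:ω, y^β:B}(P)`. -/
def procF (l : Option Ep) (r : Ep) (P : Proc) : Form := cfgF (l.map Ep.toT) r.toT (.proc P)

/-- The sequent `𝐱^α : [x^α : ω], c : Cfg_{x^α:ω, y^β:B}(P) ⊢_Ω 𝐲^β : [y^β : B]`. -/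
def starSeq (l : Option Ep) (P : Proc) (r : Ep) (c : GV PN) (Ω : Set (Rel PN)) : Seq :=
  ⟨(c, procF l r P) ::ₘ leftA l, Ω, r.progA⟩

/-- Finite pieces of derivations with open leaves in `α`: no premise, one, two, or one for each
label. -/
inductive Blk (α : Type)
  | leaf (a : α)
  | ax (s : Seq)
  | un (s : Seq) (t : Blk α)
  | bin (s : Seq) (t₁ t₂ : Blk α)
  | fam (s : Seq) (L : Finset ℕ) (t : L → Blk α)

/-- The open leaves. -/
def Blk.leaves {α : Type} : Blk α → Set α
  | .leaf a => {a}
  | .ax _ => ∅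
  | .un _ t => t.leaves
  | .bin _ t₁ t₂ => t₁.leaves ∪ t₂.leaves
  | .fam _ _ t => ⋃ l, (t l).leaves

/-- An open goal `⋆` of the construction: the process typing judgment at `node` is to be translated;
`depth` is the number of translated steps below it, `c` annotates the predicate `Cfg`, and `om` holds
the relations collected so far. -/
structure St (Node : Type) where
  node : Node
  depth : ℕ
  c : GV PN
  om : Set (Rel PN)

section Build
variable (S : TySig) (V : Defs) (D : Graph PJ)

/-- The sequent of an open goal. -/
def starOf (s : St D.Node) : Seq :=
  starSeq (D.concl s.node).left (D.concl s.node).proc (D.concl s.node).right s.c s.om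

/-- The open goal for the `i`-th premise of the typing judgment at `s.node`. -/
def kid (s : St D.Node) (i : ℕ) (c : GV PN) (Ω : Set (Rel PN)) : Blk (St D.Node) :=
  .leaf ⟨(D.prem s.node i).getD s.node, s.depth + 1, c, Ω⟩

/-- The fresh position variables of a block. -/
def freshL (d : ℕ) : GV PN := ⟨.msgL d, ⟨none, 0⟩⟩
def freshR (d : ℕ) : GV PN := ⟨.msgR d, ⟨none, 0⟩⟩
def freshC (d : ℕ) : GV PN := ⟨.cfg (d + 1), ⟨none, 0⟩⟩

variable {α : Type}

/-- A message is passed from the process to the right: `⊗L` on `c : M ⊗ K`, then `⊗R` on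
`y : M ⊗ B`. -/
def toRight (d : ℕ) (c : GV PN) (M K : Form) (Γ : Multiset (GV PN × Form)) (Ω : Set (Rel PN))
    (y : GV PN) (B : Form) (rest : Set (Rel PN) → Blk α) : Blk α :=
  let Ω' := Ω ∪ same (freshL d) c
  .un ⟨(c, .tens M K) ::ₘ Γ, Ω, (y, .tens M B)⟩ <|
  .bin ⟨(freshL d, M) ::ₘ (c, K) ::ₘ Γ, Ω', (y, .tens M B)⟩
    (.ax ⟨{(freshL d, M)}, Ω' ∪ same (freshR d) y, (freshR d, M)⟩) (rest Ω')

/-- A message is passed from the process to the left: `⊗L` on `c : M ⊗ K`, then `⊸L` on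
`x : M ⊸ A`. -/
def toLeft (d : ℕ) (c : GV PN) (M K : Form) (x : GV PN) (A : Form) (Ω : Set (Rel PN))
    (z : GV PN × Form) (rest : Set (Rel PN) → Blk α) : Blk α :=
  let Ω' := Ω ∪ same (freshL d) c
  .un ⟨(c, .tens M K) ::ₘ {(x, .lolli M A)}, Ω, z⟩ <|
  .bin ⟨(freshL d, M) ::ₘ (c, K) ::ₘ {(x, .lolli M A)}, Ω', z⟩
    (.ax ⟨{(freshL d, M)}, Ω', (freshR d, M)⟩) (rest Ω')

/-- The process receives a message from the left: `⊗L` on `x : M ⊗ A`, then `⊸L` on `c : M ⊸ K`. -/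
def fromLeft (d : ℕ) (c : GV PN) (M K : Form) (x : GV PN) (A : Form) (Ω : Set (Rel PN))
    (z : GV PN × Form) (rest : Set (Rel PN) → Blk α) : Blk α :=
  let Ω' := Ω ∪ same (freshL d) x
  .un ⟨(c, .lolli M K) ::ₘ {(x, .tens M A)}, Ω, z⟩ <|
  .bin ⟨(freshL d, M) ::ₘ (c, .lolli M K) ::ₘ {(x, A)}, Ω', z⟩
    (.ax ⟨{(freshL d, M)}, Ω', (freshR d, M)⟩) (rest Ω')

/-- The process receives a message from the right: `⊸R` on `y : M ⊸ B`, then `⊸L` on `c : M ⊸ K`. -/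
def fromRight (d : ℕ) (c : GV PN) (M K : Form) (Γ : Multiset (GV PN × Form)) (Ω : Set (Rel PN))
    (y : GV PN) (B : Form) (rest : Set (Rel PN) → Blk α) : Blk α :=
  .un ⟨(c, .lolli M K) ::ₘ Γ, Ω, (y, .lolli M B)⟩ <|
  .bin ⟨(freshL d, M) ::ₘ (c, .lolli M K) ::ₘ Γ, Ω, (y, B)⟩
    (.ax ⟨{(freshL d, M)}, Ω, (freshR d, M)⟩) (rest Ω)

open Classical in
/-- The block of the construction for the process of the open goal `s`.  Its conclusion is the
sequent of `s` and its open leaves are the goals for the premises of the typing rule.  The last case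
does not occur for well-typed processes. -/
noncomputable def block (s : St D.Node) : Blk (St D.Node) :=
  let j := D.concl s.node
  let d := s.depth
  let y := j.right
  let Γ := leftA j.left
  let c' := s.c.next
  let N := S.n + 2
  let Λ := s.om ∪ unfLt N c' s.c
  let Y := lift y.gv
  let go := kid D s
  match j.proc, j.left, y.ty with
  | .fwd, some x, _ =>
    let u := Term.gch x.toT.nm x.toT.gen
    let v := Term.gch y.toT.nm y.toT.gen
    let s₁ : Seq := ⟨(c', .eq u v) ::ₘ Γ, Λ, y.progA⟩
    .un (starOf D s) <|
      if h : ∃ θ, IsMGU θ u v then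
        .un s₁ <| .ax ⟨Γ.map fun p => (p.1, p.2.subst h.choose), Λ, (Y, y.progA.2.subst h.choose)⟩
      else .ax s₁
  | .close, none, .one =>
    let M := msgF y.toT .closed
    let Y' := Y.next
    let Λ₂ := Λ ∪ unfEq N Y' Y
    .un (starOf D s) <|
    .un ⟨{(c', .tens M .one)}, Λ, y.progA⟩ <|
    toRight d c' M .one 0 Λ₂ Y' (progF none) fun Λ₃ =>
    .un ⟨{(c', .one)}, Λ₃, (Y', progF none)⟩ <|
    .un ⟨{(c', .one)}, Λ₃ ∪ unfEq N Y'.next Y', (Y'.next, .one)⟩ <|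
    .ax ⟨0, Λ₃ ∪ unfEq N Y'.next Y', (Y'.next, .one)⟩
  | .wait Q, some x, _ =>
    let M := msgF x.toT .closed
    let K := procF none y Q
    let X' := (lift x.gv).next
    let Λ₂ := Λ ∪ unfLt N X' (lift x.gv)
    .un (starOf D s) <|
    .un ⟨(c', .lolli M K) ::ₘ Γ, Λ, y.progA⟩ <|
    fromLeft d c' M K X' (progF none) Λ₂ y.progA fun Λ₃ =>
    .un ⟨(c', K) ::ₘ {(X', progF none)}, Λ₃, y.progA⟩ <|
    .un ⟨(c', K) ::ₘ {(X'.next, .one)}, Λ₃ ∪ unfLt N X'.next X', y.progA⟩ <|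
    go 0 c' (Λ₃ ∪ unfLt N X'.next X')
  | .cut A P Q, l, _ =>
    -- the spawned channel, as chosen in the typing derivation
    let e := ((D.prem s.node 0).elim j fun u => D.concl u).right
    let l' := l.map Ep.toT
    let K := spawnF l' y.toT A (.proc P) (.proc Q)
    let K₁ := Form.ex (.tens (cfgF l' ⟨e.toT.nm, .bv 0, A⟩ (.proc P))
      (cfgF (some ⟨e.toT.nm, .bv 0, A⟩) y.toT (.proc Q)))
    let KP := procF l e P
    let KQ := procF (some e) y Q
    let Λ₂ := Λ ∪ same (freshC d) c'
    .un (starOf D s) <|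
    .un ⟨(c', K) ::ₘ Γ, Λ, y.progA⟩ <|
    .un ⟨(c', K₁) ::ₘ Γ, Λ, y.progA⟩ <|
    .un ⟨(c', .tens KP KQ) ::ₘ Γ, Λ, y.progA⟩ <|
    .bin ⟨(freshC d, KP) ::ₘ (c', KQ) ::ₘ Γ, Λ₂, y.progA⟩ (go 0 (freshC d) Λ₂) (go 1 c' Λ₂)
  | .sendL k Q, some ⟨x, α, .wth L A⟩, _ =>
    if hk : k ∈ L then
      let x₀ : Ep := ⟨x, α, .wth L A⟩
      let x₁ := x₀.next (A ⟨k, hk⟩)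
      let M := fun l => msgF x₀.toT (.label l)
      let K := procF (some x₁) y Q
      let X' := lift x₁.gv
      let Λ₂ := Λ ∪ unfLt N X' (lift x₀.gv)
      .un (starOf D s) <|
      .un ⟨(c', .tens (M k) K) ::ₘ Γ, Λ, y.progA⟩ <|
      .un ⟨(c', .tens (M k) K) ::ₘ
        {(X', .wth L fun l => .lolli (M l) (progF (some (x₀.next (A l)).toT)))}, Λ₂, y.progA⟩ <|
      toLeft d c' (M k) K X' (progF (some x₁.toT)) Λ₂ y.progA fun Λ₃ => go 0 c' Λ₃
    else .ax (starOf D s)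
  | .sendR k Q, l, .plus L A =>
    if hk : k ∈ L then
      let y₁ := y.next (A ⟨k, hk⟩)
      let M := fun l => msgF y.toT (.label l)
      let K := procF l y₁ Q
      let Y' := lift y₁.gv
      let Λ₂ := Λ ∪ unfEq N Y' Y
      .un (starOf D s) <|
      .un ⟨(c', .tens (M k) K) ::ₘ Γ, Λ, y.progA⟩ <|
      .un ⟨(c', .tens (M k) K) ::ₘ Γ, Λ₂,
        (Y', .plus L fun l => .tens (M l) (progF (some (y.next (A l)).toT)))⟩ <|
      toRight d c' (M k) K Γ Λ₂ Y' (progF (some y₁.toT)) fun Λ₃ => go 0 c' Λ₃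
    else .ax (starOf D s)
  | .caseL L' P, some ⟨x, α, .plus L A⟩, _ =>
    if h : L' = L then
      let x₀ : Ep := ⟨x, α, .plus L A⟩
      let x₁ := fun l => x₀.next (A l)
      let M := fun l => msgF x₀.toT (.label l)
      let K : L → Form := fun l => procF (some (x₁ l)) y (P ⟨l, h ▸ l.2⟩)
      let X' := (lift x₀.gv).next
      let Λ₂ := Λ ∪ unfLt N X' (lift x₀.gv)
      let C := Form.wth L fun l => .lolli (M l) (K l)
      .un (starOf D s) <|
      .un ⟨(c', C) ::ₘ Γ, Λ, y.progA⟩ <|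
      .fam ⟨(c', C) ::ₘ {(X', .plus L fun l => .tens (M l) (progF (some (x₁ l).toT)))},
        Λ₂, y.progA⟩ L fun k =>
      .un ⟨(c', C) ::ₘ {(X', .tens (M k) (progF (some (x₁ k).toT)))}, Λ₂, y.progA⟩ <|
      fromLeft d c' (M k) (K k) X' (progF (some (x₁ k).toT)) Λ₂ y.progA fun Λ₃ => go k c' Λ₃
    else .ax (starOf D s)
  | .caseR L' P, l, .wth L A =>
    if h : L' = L then
      let y₁ := fun k => y.next (A k)
      let M := fun k => msgF y.toT (.label k)
      let K : L → Form := fun k => procF l (y₁ k) (P ⟨k, h ▸ k.2⟩)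
      let Y' := Y.next
      let Λ₂ := Λ ∪ unfEq N Y' Y
      let C := Form.wth L fun k => .lolli (M k) (K k)
      .un (starOf D s) <|
      .un ⟨(c', C) ::ₘ Γ, Λ, y.progA⟩ <|
      .fam ⟨(c', C) ::ₘ Γ, Λ₂, (Y', .wth L fun k => .lolli (M k) (progF (some (y₁ k).toT)))⟩
        L fun k =>
      .un ⟨(c', C) ::ₘ Γ, Λ₂, (Y', .lolli (M k) (progF (some (y₁ k).toT)))⟩ <|
      fromRight d c' (M k) (K k) Γ Λ₂ Y' (progF (some (y₁ k).toT)) fun Λ₃ => go k c' Λ₃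
    else .ax (starOf D s)
  | .nuL t Q, some x, _ =>
    let x₁ := x.next (S.body t)
    let M := msgF x.toT (.nu t)
    let K := procF (some x₁) y Q
    let X' := lift x₁.gv
    let Λ₂ := Λ ∪ unfEq (S.prio t) X' (lift x.gv)
    .un (starOf D s) <|
    .un ⟨(c', .tens M K) ::ₘ Γ, Λ, y.progA⟩ <|
    toLeft d c' M K X' (progF (some x₁.toT)) Λ₂ y.progA fun Λ₃ => go 0 c' Λ₃
  | .muR t Q, l, _ =>
    let y₁ := y.next (S.body t)
    let M := msgF y.toT (.mu t)
    let K := procF l y₁ Q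
    let Y' := lift y₁.gv
    let Λ₂ := Λ ∪ unfEq (S.prio t) Y' Y
    .un (starOf D s) <|
    .un ⟨(c', .tens M K) ::ₘ Γ, Λ, y.progA⟩ <|
    toRight d c' M K Γ Λ₂ Y' (progF (some y₁.toT)) fun Λ₃ => go 0 c' Λ₃
  | .muL t Q, some x, _ =>
    let x₁ := x.next (S.body t)
    let M := msgF x.toT (.mu t)
    let K := procF (some x₁) y Q
    let X' := lift x₁.gv
    let Λ₂ := Λ ∪ unfLt (S.prio t) X' (lift x.gv)
    .un (starOf D s) <|
    .un ⟨(c', .lolli M K) ::ₘ Γ, Λ, y.progA⟩ <|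
    fromLeft d c' M K X' (progF (some x₁.toT)) Λ₂ y.progA fun Λ₃ => go 0 c' Λ₃
  | .nuR t Q, l, _ =>
    let y₁ := y.next (S.body t)
    let M := msgF y.toT (.nu t)
    let K := procF l y₁ Q
    let Y' := lift y₁.gv
    let Λ₂ := Λ ∪ unfLt (S.prio t) Y' Y
    .un (starOf D s) <|
    .un ⟨(c', .lolli M K) ::ₘ Γ, Λ, y.progA⟩ <|
    fromRight d c' M K Γ Λ₂ Y' (progF (some y₁.toT)) fun Λ₃ => go 0 c' Λ₃
  | .call X, l, _ =>
    .un (starOf D s) <|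
    go 0 c' (s.om ∪ unfEq (S.n + 1) c' s.c)
  | _, _, _ => .ax (starOf D s)

/-- Open leaves are continued by their blocks. -/
noncomputable def force : Blk (St D.Node) → Blk (St D.Node)
  | .leaf s => block S D s
  | t => t

/-- The derivation of the metalogic built from the process typing derivation `D`: the blocks are
stacked on each other, starting with the sequent for the root of `D` in which the predicate `Cfg` is
annotated with generation `η` and the relations are `Ω`.  The nodes `Blk.leaf s` are the sequents
`⋆`. -/
noncomputable def build (η : Gen) (Ω : Set (Rel PN)) : Graph Seq where
  Node := Blk (St D.Node)
  root := .leaf ⟨D.root, 0, ⟨.cfg 0, η⟩, Ω⟩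
  concl t := match force S D t with
    | .leaf s => starOf D s
    | .ax s => s
    | .un s _ => s
    | .bin s _ _ => s
    | .fam s _ _ => s
  prem t := match force S D t with
    | .leaf _ => noPrem
    | .ax _ => noPrem
    | .un _ t => prem1 t
    | .bin _ t₁ t₂ => prem2 t₁ t₂
    | .fam _ L t => premL L t

/-- The step `⇒` from the conclusion of a block to one of its `⋆` assumptions. -/
def StarStep (v v' : Blk (St D.Node)) : Prop :=
  ∃ s s', v = .leaf s ∧ v' = .leaf s' ∧ s' ∈ (block S D s).leaves

/-- The generational channels occurring in a process typing judgment. -/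
def PJ.vars (j : PJ) : Set (GV ℕ) := j.leftVars ∪ j.rightVars

/-- The relation `R` between process typing judgments and annotated sequents. -/
def RelR (j : PJ) (q : Seq) : Prop :=
  ∃ c Ω, q = starSeq j.left j.proc j.right c Ω ∧
    ∀ a ∈ j.vars, ∀ i ≤ S.n, ∀ w : GV ℕ, Le j.om i a w ↔ Le Ω i (lift a) (lift w)

/-- `R` between the nodes `u` of the typing derivation and the sequents `⋆` that were built for
`u` in the derivation of the metalogic. -/
def NodeR (η : Gen) (Ω : Set (Rel PN)) (u : D.Node) (v : Blk (St D.Node)) : Prop :=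
  (build S D η Ω).Reach v ∧ (∃ s, v = .leaf s ∧ s.node = u) ∧
    RelR S (D.concl u) ((build S D η Ω).concl v)

/-- A relation is a bisimulation between two transition systems. -/
def IsBisim {A B : Type} (stepA : A → A → Prop) (stepB : B → B → Prop) (r : A → B → Prop) : Prop :=
  ∀ u v, r u v →
    (∀ u', stepA u u' → ∃ v', stepB v v' ∧ r u' v') ∧
    (∀ v', stepB v v' → ∃ u', stepA u u' ∧ r u' v')

/-- Simultaneous steps of two related nodes to related nodes. -/
def JointStep (η : Gen) (Ω : Set (Rel PN)) (p p' : D.Node × Blk (St D.Node)) : Prop :=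
  D.Step p.1 p'.1 ∧ StarStep S D p.2 p'.2 ∧ NodeR S D η Ω p'.1 p'.2

end Build

/-- The two endpoints are different channels, and all names of a judgment are recorded as used. -/
def PJ.WF (j : PJ) : Prop :=
  (∀ e, j.left = some e → e.ch ≠ j.right.ch) ∧
    ∀ a ∈ j.vars, .chan a.name ∈ j.seen ∧ ∀ g, a.gen.base = some g → .gen g ∈ j.seen

/-- The relations in `Ω` only relate generations of one and the same channel, the channels are among
those used so far, and no later generation of a channel in `ends` occurs. -/
def OwnGens {N : Type} (used : Set N) (ends : Set (GV N)) (Ω : Set (Rel N)) : Prop :=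
  ∀ r ∈ Ω, r.lhs.name = r.rhs.name ∧ r.lhs.name ∈ used ∧
    ∀ a ∈ ends, ∀ k, r.lhs ≠ ⟨a.name, ⟨a.gen.base, a.gen.off + k + 1⟩⟩ ∧
      r.rhs ≠ ⟨a.name, ⟨a.gen.base, a.gen.off + k + 1⟩⟩

end SP

/-!
The construction `build` stacks blocks, one for each typing rule, so everything reduces to an
invariant of its open goals (`Inv`) and to the correctness of a single block (`blockSpec`).

*Relations.* A typing rule that advances a channel `x^α` adds relations between `x^α` and the fresh
`x^{α+1}`; its block adds the same relations between the matching position variables, up to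
priorities above `n` and the orientation of equalities (`Mirror`).  All other relations that reach
the open goals of a block attach a fresh position variable that matches no channel, such as the next
generation of the annotation of `Cfg` or the annotation of a message.  When a fresh `p` is attached
to `q`, paths between other variables do not change, and paths from or to `p` pass through `q`
(`le_union_iff`, `le_union_from`, `le_union_to`).  Hence the orders in the two derivations keep agreeing on the
endpoints (`Agree`), which is the relation `R`.  The only other case is a channel that is closed by
`wait`, whose position variable is unfolded twice; it is not above the remaining endpoint
because process relations never connect different channels (`Inv.closedStep`).

*Freshness.* The position variable names in the relations are bounded by the depth of the goal and
by the channel names used so far, and no later generation of an endpoint or of the annotation of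
`Cfg` occurs.  This gives the side conditions of all rules.  In the block for forwarding, a most
general unifier of two channel terms exists as soon as they are unifiable (`exists_isMGU`), so one of
the two left rules of equality always applies.

*Traces.* If the process relations are empty at the root, each of them is mirrored in the
metalogic (`Mirrored`), so snapshot inequalities carry over, the two additional priorities `n + 1`
and `n + 2` being larger than those that decide them.  As blocks are finite, an infinite branch of
the built derivation passes through infinitely many open goals (`exists_goals`); these follow an
infinite branch of the typing derivation, and a trace on the latter is lifted along them
(`isTrace_lift`).
-/

namespace SP

/-! ### Relations between generational variables -/

section Relations
variable {N : Type}

/-- The generational variables occurring in a set of relations. -/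
def relVars (Ω : Set (Rel N)) : Set (GV N) := {a | ∃ r ∈ Ω, r.lhs = a ∨ r.rhs = a}

/-- All relations in `E` are between `p` and `q`, in either order. -/
def Links (E : Set (Rel N)) (p q : GV N) : Prop :=
  ∀ r ∈ E, (r.lhs = p ∧ r.rhs = q) ∨ (r.lhs = q ∧ r.rhs = p)

/-- A single step of the relation `Ω ⊨ a_i ≤ b_i`. -/
def Edge (Ω : Set (Rel N)) (i : ℕ) (a b : GV N) : Prop :=
  .eq i a b ∈ Ω ∨ .eq i b a ∈ Ω ∨ .lt i a b ∈ Ω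

theorem relVars_union (Ω E : Set (Rel N)) : relVars (Ω ∪ E) = relVars Ω ∪ relVars E := by
  ext a
  simp only [relVars, Set.mem_union, Set.mem_ofPred_eq, or_and_right, exists_or]

theorem Links.relVars {E : Set (Rel N)} {p q b : GV N} (h : Links E p q) (hb : b ∈ relVars E) :
    b = p ∨ b = q := by
  obtain ⟨r, hr, hb⟩ := hb
  grind [h r hr]

theorem links_same (a b : GV N) : Links (same a b) a b := by
  rintro _ ⟨i, rfl⟩; exact .inl ⟨rfl, rfl⟩

theorem links_unfEq (j : ℕ) (a b : GV N) : Links (unfEq j a b) a b := by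
  rintro _ ⟨i, -, rfl⟩; exact .inl ⟨rfl, rfl⟩

theorem links_unfLt (j : ℕ) (a b : GV N) : Links (unfLt j a b) a b := by
  rintro _ (⟨i, -, rfl⟩ | rfl) <;> exact .inl ⟨rfl, rfl⟩

theorem Links.symm {E : Set (Rel N)} {p q : GV N} (h : Links E p q) : Links E q p :=
  fun r hr => (h r hr).symm

theorem Edge.left_mem {Ω : Set (Rel N)} {i a b} (h : Edge Ω i a b) : a ∈ relVars Ω := by
  rcases h with h | h | h
  exacts [⟨_, h, .inl rfl⟩, ⟨_, h, .inr rfl⟩, ⟨_, h, .inl rfl⟩]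

theorem Edge.right_mem {Ω : Set (Rel N)} {i a b} (h : Edge Ω i a b) : b ∈ relVars Ω := by
  rcases h with h | h | h
  exacts [⟨_, h, .inr rfl⟩, ⟨_, h, .inl rfl⟩, ⟨_, h, .inr rfl⟩]

theorem edge_union {Ω E : Set (Rel N)} {i a b} :
    Edge (Ω ∪ E) i a b ↔ Edge Ω i a b ∨ Edge E i a b := by
  simp only [Edge, Set.mem_union]; tauto

theorem Links.edge {E : Set (Rel N)} {p q : GV N} (h : Links E p q) {i a b} (e : Edge E i a b) :
    (a = p ∧ b = q) ∨ (a = q ∧ b = p) := by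
  rcases e with e | e | e <;> grind [h _ e, Rel.lhs, Rel.rhs]

theorem le_mono {Ω Ω' : Set (Rel N)} (h : Ω ⊆ Ω') {i a b} (hl : Le Ω i a b) : Le Ω' i a b :=
  Relation.ReflTransGen.mono (fun _ _ => Or.imp (@h _) (Or.imp (@h _) (@h _))) _ _ hl

theorem le_iff_eq_of_notMem {Ω : Set (Rel N)} {i a b} (h : a ∉ relVars Ω) : Le Ω i a b ↔ a = b := by
  constructor
  · intro hl
    rcases Relation.ReflTransGen.cases_head hl with e | ⟨c, e, -⟩
    · exact e
    · exact (h (Edge.left_mem e)).elim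
  · rintro rfl; exact .refl

theorem le_name {Ω : Set (Rel N)} (h : ∀ r ∈ Ω, r.lhs.name = r.rhs.name) {i a b}
    (hl : Le Ω i a b) : a.name = b.name := by
  induction hl with
  | refl => rfl
  | tail _ e ih =>
    rcases e with e | e | e
    exacts [ih.trans (h _ e), ih.trans (h _ e).symm, ih.trans (h _ e)]

section Attach
variable {Ω E : Set (Rel N)} {p q : GV N}

/-- Relations that attach a fresh variable `p` to `q` do not change the order between the other
variables: a path that visits `p` returns to `q`. -/
theorem le_union_iff (hp : p ∉ relVars Ω) (hE : Links E p q) {i a b} (ha : a ≠ p) (hb : b ≠ p) :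
    Le (Ω ∪ E) i a b ↔ Le Ω i a b := by
  refine ⟨fun h => ?_, le_mono Set.subset_union_left⟩
  have key : (b ≠ p → Le Ω i a b) ∧ (b = p → Le Ω i a q) := by
    clear hb
    induction h with
    | refl => exact ⟨fun _ => .refl, fun h => (ha h).elim⟩
    | @tail b c _ e ih =>
      rcases edge_union.1 e with e | e
      · have hb : b ≠ p := fun h => hp (h ▸ e.left_mem)
        exact ⟨fun _ => (ih.1 hb).tail e, fun h => (hp (h ▸ e.right_mem)).elim⟩
      · rcases hE.edge e with ⟨rfl, rfl⟩ | ⟨rfl, rfl⟩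
        · exact ⟨fun _ => ih.2 rfl, fun _ => ih.2 rfl⟩
        · refine ⟨fun h => (h rfl).elim, fun _ => ?_⟩
          by_cases h : b = c
          · exact ih.2 h
          · exact ih.1 h
  exact key.1 hb

theorem le_union_to (hp : p ∉ relVars Ω) (hpq : p ≠ q) (hE : Links E p q) {i a} (ha : a ≠ p) :
    Le (Ω ∪ E) i a p ↔ Le Ω i a q ∧ Edge E i q p := by
  constructor
  · intro h
    rcases Relation.ReflTransGen.cases_tail h with e | ⟨c, hc, e⟩
    · exact (ha e.symm).elim
    · rcases edge_union.1 e with e | e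
      · exact (hp e.right_mem).elim
      · rcases hE.edge e with ⟨rfl, h⟩ | ⟨rfl, -⟩
        · exact (hpq h).elim
        · exact ⟨(le_union_iff hp hE ha hpq.symm).1 hc, e⟩
  · rintro ⟨h, e⟩
    exact .tail (le_mono Set.subset_union_left h) (edge_union.2 (.inr e))

theorem le_union_from (hp : p ∉ relVars Ω) (hpq : p ≠ q) (hE : Links E p q) {i b} (hb : b ≠ p) :
    Le (Ω ∪ E) i p b ↔ Edge E i p q ∧ Le Ω i q b := by
  constructor
  · intro h
    rcases Relation.ReflTransGen.cases_head h with e | ⟨c, e, hc⟩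
    · exact (hb e.symm).elim
    · rcases edge_union.1 e with e | e
      · exact (hp e.left_mem).elim
      · rcases hE.edge e with ⟨-, rfl⟩ | ⟨h, rfl⟩
        · exact ⟨e, (le_union_iff hp hE hpq.symm hb).1 hc⟩
        · exact (hpq h).elim
  · rintro ⟨e, h⟩
    exact .head (edge_union.2 (.inr e)) (le_mono Set.subset_union_left h)

end Attach

/-- `b` is not a later generation of `a`. -/
def NotLater (a b : GV N) : Prop :=
  a.name = b.name → a.gen.base = b.gen.base → b.gen.off ≤ a.gen.off

theorem NotLater.next {a b : GV N} (h : NotLater a b) : NotLater a.next b :=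
  fun h₁ h₂ => (h h₁ h₂).trans (Nat.le_succ _)

theorem notLater_of_name {a b : GV N} (h : a.name ≠ b.name) : NotLater a b := fun e => (h e).elim

theorem notLater_next_self (a : GV N) : NotLater a.next a := fun _ _ => Nat.le_succ _

theorem notLater_refl (a : GV N) : NotLater a a := fun _ _ => le_rfl

theorem next_ne (a : GV N) : a.next ≠ a := by
  rcases a with ⟨x, g, k⟩
  simp [GV.next, Gen.next]

theorem next_notMem {Ω : Set (Rel N)} {a : GV N} (h : ∀ b ∈ relVars Ω, NotLater a b) :
    a.next ∉ relVars Ω :=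
  fun hm => absurd (h _ hm rfl rfl) (Nat.not_succ_le_self _)

end Relations

theorem lift_injective : Function.Injective lift := by
  rintro ⟨x, g⟩ ⟨y, g'⟩ h
  simpa [lift] using h

/-! ### Agreement of the orders -/

/-- Below `n`, the process relations `om` and the relations `Ω` of the metalogic put the same
channels above each `a ∈ A`. -/
def Agree (n : ℕ) (A : Set (GV ℕ)) (om : Set (Rel ℕ)) (Ω : Set (Rel PN)) : Prop :=
  ∀ a ∈ A, ∀ i ≤ n, ∀ w : GV ℕ, Le om i a w ↔ Le Ω i (lift a) (lift w)

section Agree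
variable {n : ℕ} {A : Set (GV ℕ)} {om : Set (Rel ℕ)} {Ω E' : Set (Rel PN)}

/-- Attaching a fresh position variable that matches no channel. -/
theorem Agree.attach {p q : GV PN} (h : Agree n A om Ω) (hp : p ∉ relVars Ω) (hE : Links E' p q)
    (hl : ∀ x, p.name ≠ .ch x) : Agree n A om (Ω ∪ E') := by
  intro a ha i hi w
  have hne : ∀ b, lift b ≠ p := fun b e => hl b.name (e ▸ rfl)
  rw [le_union_iff hp hE (hne _) (hne _)]
  exact h a ha i hi w

/-- Attaching a later generation of a channel that is above no endpoint. -/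
theorem Agree.attachLater {p q : GV ℕ} (h : Agree n A om Ω) (hp : lift p ∉ relVars Ω) (hpq : p ≠ q)
    (hE : Links E' (lift p) (lift q)) (hA : p ∉ A)
    (hom : ∀ a ∈ A, ∀ i, ¬ Le om i a p ∧ ¬ Le om i a q) : Agree n A om (Ω ∪ E') := by
  intro a ha i hi w
  have hap : a ≠ p := fun e => hA (e ▸ ha)
  by_cases hw : w = p
  · subst hw
    rw [le_union_to hp (lift_injective.ne hpq) hE (lift_injective.ne hap), ← h a ha i hi]
    simp [hom a ha i]
  · rw [le_union_iff hp hE (lift_injective.ne hap) (lift_injective.ne hw)]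
    exact h a ha i hi w

/-- `E` relates the channel `a` and its next generation, `E'` relates the matching position
variables, and up to priority `n` the two sets contain the same relations, up to the orientation of
equalities. -/
structure Mirror (n : ℕ) (E : Set (Rel ℕ)) (E' : Set (Rel PN)) (a : GV ℕ) : Prop where
  links : Links E a.next a
  links' : Links E' (lift a.next) (lift a)
  edge : ∀ i ≤ n, Edge E i a.next a ↔ Edge E' i (lift a.next) (lift a)
  edge' : ∀ i ≤ n, Edge E i a a.next ↔ Edge E' i (lift a) (lift a.next)
  eq_mem : ∀ i ≤ n, ∀ b c, .eq i b c ∈ E →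
    .eq i (lift b) (lift c) ∈ E' ∨ .eq i (lift c) (lift b) ∈ E'
  lt_mem : ∀ i ≤ n, ∀ b c, .lt i b c ∈ E → .lt i (lift b) (lift c) ∈ E'

theorem Mirror.unfEq (n j : ℕ) (a : GV ℕ) :
    Mirror n (unfEq j a.next a) (SP.unfEq j (lift a.next) (lift a)) a where
  links := links_unfEq _ _ _
  links' := links_unfEq _ _ _
  edge i _ := by simp [Edge, SP.unfEq, next_ne, lift_injective.eq_iff]
  edge' i _ := by simp [Edge, SP.unfEq, lift_injective.eq_iff]
  eq_mem i _ b c := by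
    rintro ⟨_, hi, h⟩; cases h; exact .inl ⟨i, hi, rfl⟩
  lt_mem i _ b c := by rintro ⟨_, hi, h⟩; cases h

theorem Mirror.unfLt (n j : ℕ) (a : GV ℕ) :
    Mirror n (unfLt j a.next a) (SP.unfLt j (lift a.next) (lift a)) a where
  links := links_unfLt _ _ _
  links' := links_unfLt _ _ _
  edge i _ := by simp [Edge, SP.unfLt, SP.unfEq, next_ne, lift_injective.eq_iff]
  edge' i _ := by simp [Edge, SP.unfLt, SP.unfEq, lift_injective.eq_iff]
  eq_mem i _ b c := by
    rintro (⟨_, hi, h⟩ | h) <;> cases h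
    exact .inl (.inl ⟨i, hi, rfl⟩)
  lt_mem i _ b c := by
    rintro (⟨_, hi, h⟩ | h) <;> cases h
    exact .inr rfl

theorem Mirror.same_unfEq (n : ℕ) (a : GV ℕ) :
    Mirror n (same a a.next) (SP.unfEq (n + 2) (lift a.next) (lift a)) a where
  links := (links_same _ _).symm
  links' := links_unfEq _ _ _
  edge i hi := by
    have : i ≠ n + 2 := by omega
    simp [Edge, SP.unfEq, SP.same, this]
  edge' i hi := by
    have : i ≠ n + 2 := by omega
    simp [Edge, SP.unfEq, SP.same, this]
  eq_mem i hi b c := by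
    rintro ⟨_, h⟩; cases h; exact .inr ⟨i, by omega, rfl⟩
  lt_mem i _ b c := by rintro ⟨_, h⟩; cases h

theorem Mirror.same_unfLt (n : ℕ) (a : GV ℕ) :
    Mirror n (same a a.next) (SP.unfLt (n + 2) (lift a.next) (lift a)) a where
  links := (links_same _ _).symm
  links' := links_unfLt _ _ _
  edge i hi := by
    have : i ≠ n + 2 := by omega
    simp [Edge, SP.unfLt, SP.unfEq, SP.same, this]
  edge' i hi := by
    have : i ≠ n + 2 := by omega
    simp [Edge, SP.unfLt, SP.unfEq, SP.same, this]
  eq_mem i hi b c := by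
    rintro ⟨_, h⟩; cases h; exact .inr (.inl ⟨i, by omega, rfl⟩)
  lt_mem i _ b c := by rintro ⟨_, h⟩; cases h

/-- A step of an endpoint to its next generation in both derivations. -/
theorem Agree.advance {a : GV ℕ} {E : Set (Rel ℕ)} {B : Set (GV ℕ)} (h : Agree n A om Ω)
    (ha : a ∈ A) (hp : a.next ∉ relVars om) (hp' : lift a.next ∉ relVars Ω)
    (hM : Mirror n E E' a) (hB : ∀ b ∈ B, b = a.next ∨ b ∈ A) :
    Agree n B (om ∪ E) (Ω ∪ E') := by
  intro b hb i hi w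
  have hne := next_ne a
  have hne' := lift_injective.ne hne
  by_cases hbp : b = a.next
  · subst hbp
    by_cases hw : w = a.next
    · subst hw; exact ⟨fun _ => .refl, fun _ => .refl⟩
    · rw [le_union_from hp hne hM.links hw,
        le_union_from hp' hne' hM.links' (lift_injective.ne hw), hM.edge i hi, h a ha i hi]
  · have hbA := (hB b hb).resolve_left hbp
    by_cases hw : w = a.next
    · subst hw
      rw [le_union_to hp hne hM.links hbp,
        le_union_to hp' hne' hM.links' (lift_injective.ne hbp), hM.edge' i hi, h b hbA i hi]
    · rw [le_union_iff hp hM.links hbp hw,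
        le_union_iff hp' hM.links' (lift_injective.ne hbp) (lift_injective.ne hw)]
      exact h b hbA i hi w

end Agree

/-! ### The invariant of the construction -/

/-- Position variable names that may occur at depth `d` of the construction, when `s` are the first
order variables used so far. -/
def NameUsed (s : Set Var) (d : ℕ) : PN → Prop
  | .ch x => .chan x ∈ s
  | .cfg k => k ≤ d
  | .msgL k => k < d
  | .msgR _ => False

/-- Every relation in `om` up to priority `n` is in `om₀` or has its counterpart in `Ω`. -/
structure Mirrored (n : ℕ) (om₀ om : Set (Rel ℕ)) (Ω : Set (Rel PN)) : Prop where
  eq_mem : ∀ i ≤ n, ∀ a b, .eq i a b ∈ om → .eq i a b ∈ om₀ ∨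
    .eq i (lift a) (lift b) ∈ Ω ∨ .eq i (lift b) (lift a) ∈ Ω
  lt_mem : ∀ i ≤ n, ∀ a b, .lt i a b ∈ om → .lt i a b ∈ om₀ ∨ .lt i (lift a) (lift b) ∈ Ω

theorem Mirrored.mono {n om₀ om} {Ω Ω' : Set (Rel PN)} (h : Mirrored n om₀ om Ω) (hs : Ω ⊆ Ω') :
    Mirrored n om₀ om Ω' where
  eq_mem i hi a b hm := (h.eq_mem i hi a b hm).imp_right (Or.imp (@hs _) (@hs _))
  lt_mem i hi a b hm := (h.lt_mem i hi a b hm).imp_right (@hs _)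

theorem Mirrored.union {n om₀ om Ω E E' a} (h : Mirrored n om₀ om Ω) (hM : Mirror n E E' a) :
    Mirrored n om₀ (om ∪ E) (Ω ∪ E') where
  eq_mem i hi b c := by
    rintro (hm | hm)
    · exact (h.eq_mem i hi b c hm).imp_right (Or.imp .inl .inl)
    · exact .inr ((hM.eq_mem i hi b c hm).imp .inr .inr)
  lt_mem i hi b c := by
    rintro (hm | hm)
    · exact (h.lt_mem i hi b c hm).imp_right .inl
    · exact .inr (.inr (hM.lt_mem i hi b c hm))

/-- If `om₀` is empty, snapshot inequalities carry over, also to more priorities. -/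
theorem Mirrored.snapLt {n m om Ω} (h : Mirrored n ∅ om Ω) (hm : n ≤ m) {a b : GV ℕ}
    (hs : SnapLt om n a b) : SnapLt Ω m (lift a) (lift b) := by
  have he : ∀ i ≤ n, ∀ a b, .eq i a b ∈ om →
      .eq i (lift a) (lift b) ∈ Ω ∨ .eq i (lift b) (lift a) ∈ Ω :=
    fun i hi a b e => (h.eq_mem i hi a b e).resolve_left id
  have hl : ∀ i ≤ n, ∀ a b, .lt i a b ∈ om → .lt i (lift a) (lift b) ∈ Ω :=
    fun i hi a b e => (h.lt_mem i hi a b e).resolve_left id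
  have hle : ∀ i ≤ n, ∀ {a b}, Le om i a b → Le Ω i (lift a) (lift b) := fun i hi a b =>
    Relation.ReflTransGen.lift lift (fun c d (e : Edge om i c d) => by
      rcases e with e | e | e
      · exact (he i hi _ _ e).imp_right .inl
      · exact (he i hi _ _ e).symm.imp_right .inl
      · exact .inr (.inr (hl i hi _ _ e))) _ _
  obtain ⟨j, hj, heq, c, d, hc, hcd, hd⟩ := hs
  refine ⟨j, hj.trans hm, fun i hi => ?_, _, _, hle j hj hc, hl j hj _ _ hcd, hle j hj hd⟩
  refine Relation.ReflTransGen.lift lift (fun c d (e : Rel.eq i c d ∈ om ∨ Rel.eq i d c ∈ om) => ?_) _ _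
    (heq i hi)
  rcases e with e | e
  · exact he i (hi.le.trans hj) _ _ e
  · exact (he i (hi.le.trans hj) _ _ e).symm

/-- The invariant relating a process typing judgment `j` and the goal of the construction for it, at
depth `d`, with `Cfg` annotated by `c` and relations `Ω`.  Besides the agreement of the orders it
says that the variables needed next are fresh.  The set `om₀` holds the relations with which the
process typing derivation starts. -/
structure Inv (n : ℕ) (om₀ : Set (Rel ℕ)) (j : PJ) (d : ℕ) (c : GV PN) (Ω : Set (Rel PN)) :
    Prop where
  wf : j.WF
  om_vars : ∀ b ∈ relVars j.om, .chan b.name ∈ j.seen ∧ ∀ a ∈ j.vars, NotLater a b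
  om_name : ∀ r ∈ j.om, r.lhs.name = r.rhs.name
  c_name : ∃ k ≤ d, c.name = .cfg k
  vars : ∀ b ∈ relVars Ω, NotLater c b ∧ (∀ a ∈ j.vars, NotLater (lift a) b) ∧
    NameUsed j.seen d b.name
  agree : Agree n j.vars j.om Ω
  mirrored : Mirrored n om₀ j.om Ω

theorem NameUsed.mono {s s' : Set Var} {d d' : ℕ} (hs : s ⊆ s') (hd : d ≤ d') {w : PN}
    (h : NameUsed s d w) : NameUsed s' d' w := by
  cases w with
  | ch x => exact hs h
  | cfg k => exact le_trans (a := k) h hd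
  | msgL k => exact lt_of_lt_of_le (a := k) h hd
  | msgR k => exact h

section Steps
variable {n : ℕ} {om₀ : Set (Rel ℕ)} {j j' : PJ} {d : ℕ} {c : GV PN} {Ω C : Set (Rel PN)}

theorem mem_vars_left {e : Ep} {om P y s} : e.gv ∈ (PJ.mk (some e) om P y s).vars :=
  .inl ⟨e, rfl, rfl⟩

theorem mem_vars_right {l : Option Ep} {om P y s} : y.gv ∈ (PJ.mk l om P y s).vars := .inr rfl

theorem Inv.notMem_ch (h : Inv n om₀ j d c Ω) {x : ℕ} (hx : .chan x ∉ j.seen) {b : GV PN}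
    (hb : b ∈ relVars Ω) : b.name ≠ .ch x := by
  intro e
  have := (h.vars b hb).2.2
  rw [e] at this
  exact hx this

/-- The unfolding of `Cfg` to the next generation of its position variable. -/
theorem Inv.cfgStep (h : Inv n om₀ j d c Ω) (hC : Links C c.next c) :
    Inv n om₀ j d c.next (Ω ∪ C) where
  wf := h.wf
  om_vars := h.om_vars
  om_name := h.om_name
  c_name := h.c_name
  vars b hb := by
    obtain ⟨k, hk, hc⟩ := h.c_name
    rw [relVars_union] at hb
    rcases hb with hb | hb
    · exact ⟨(h.vars b hb).1.next, (h.vars b hb).2⟩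
    · have hbn : b.name = .cfg k := by rcases hC.relVars hb with rfl | rfl <;> exact hc
      refine ⟨?_, fun a _ => notLater_of_name (by simp [lift, hbn]), by rw [hbn]; exact hk⟩
      rcases hC.relVars hb with rfl | rfl
      exacts [notLater_refl _, notLater_next_self _]
  agree := by
    obtain ⟨k, hk, hc⟩ := h.c_name
    exact h.agree.attach (next_notMem fun b hb => (h.vars b hb).1) hC (by simp [GV.next, hc])
  mirrored := h.mirrored.mono Set.subset_union_left

theorem Inv.deeper (h : Inv n om₀ j d c Ω) : Inv n om₀ j (d + 1) c Ω where
  wf := h.wf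
  om_vars := h.om_vars
  om_name := h.om_name
  c_name := h.c_name.imp fun _ h => ⟨h.1.trans (Nat.le_succ d), h.2⟩
  vars b hb := ⟨(h.vars b hb).1, (h.vars b hb).2.1,
    (h.vars b hb).2.2.mono subset_rfl (Nat.le_succ d)⟩
  agree := h.agree
  mirrored := h.mirrored

/-- A message is annotated by the fresh position variable `freshL d`. -/
theorem Inv.msgStep {F : Set (Rel PN)} {q : GV PN} (h : Inv n om₀ j d c Ω)
    (hF : Links F (freshL d) q)
    (hq : q = c ∨ ∃ a, .chan a.name ∈ j.seen ∧ q = lift a ∧ ∀ b ∈ j.vars, NotLater b a) :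
    Inv n om₀ j (d + 1) c (Ω ∪ F) where
  wf := h.wf
  om_vars := h.om_vars
  om_name := h.om_name
  c_name := h.deeper.c_name
  vars b hb := by
    obtain ⟨k, hk, hc⟩ := h.c_name
    rw [relVars_union] at hb
    rcases hb with hb | hb
    · exact h.deeper.vars b hb
    · rcases hF.relVars hb with rfl | rfl
      · exact ⟨notLater_of_name (by simp [hc, freshL]),
          fun a _ => notLater_of_name (by simp [lift, freshL]), Nat.lt_succ_self d⟩
      · rcases hq with rfl | ⟨a, ha, rfl, hv⟩
        · refine ⟨notLater_refl _, fun a _ => notLater_of_name (by simp [hc, lift]), ?_⟩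
          rw [hc]; exact hk.trans (Nat.le_succ d)
        · refine ⟨notLater_of_name (by simp [hc, lift]), fun b hb e₁ e₂ => ?_, ha⟩
          exact hv b hb (by simpa [lift] using e₁) e₂
  agree := by
    refine h.agree.attach (fun hm => ?_) hF (by simp [freshL])
    exact lt_irrefl d (h.vars _ hm).2.2
  mirrored := h.mirrored.mono Set.subset_union_left

/-- Both derivations pass to the next generation of the endpoint `a`. -/
theorem Inv.advance {a : GV ℕ} {E : Set (Rel ℕ)} {E' : Set (Rel PN)} (h : Inv n om₀ j d c Ω)
    (ha : a ∈ j.vars) (hwf : j'.WF) (hseen : j'.seen = j.seen) (hom : j'.om = j.om ∪ E)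
    (hv : ∀ b ∈ j'.vars, b = a.next ∨ (b ∈ j.vars ∧ b.name ≠ a.name)) (hM : Mirror n E E' a) :
    Inv n om₀ j' d c (Ω ∪ E') := by
  have hlater : ∀ b ∈ j'.vars, NotLater b a ∧ NotLater b a.next := by
    intro b hb
    rcases hv b hb with rfl | ⟨-, hn⟩
    · exact ⟨notLater_next_self _, notLater_refl _⟩
    · exact ⟨notLater_of_name hn, notLater_of_name hn⟩
  refine ⟨hwf, ?_, ?_, h.c_name, ?_, ?_, hom ▸ h.mirrored.union hM⟩
  · intro b hb
    rw [hom, relVars_union] at hb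
    rw [hseen]
    rcases hb with hb | hb
    · refine ⟨(h.om_vars b hb).1, fun b' hb' => ?_⟩
      rcases hv b' hb' with rfl | ⟨hm, -⟩
      exacts [((h.om_vars b hb).2 a ha).next, (h.om_vars b hb).2 b' hm]
    · rcases hM.links.relVars hb with rfl | rfl
      exacts [⟨(h.wf.2 a ha).1, fun b hb => (hlater b hb).2⟩,
        ⟨(h.wf.2 _ ha).1, fun b hb => (hlater b hb).1⟩]
  · intro r hr
    rw [hom] at hr
    rcases hr with hr | hr
    · exact h.om_name r hr
    · rcases hM.links r hr with ⟨e₁, e₂⟩ | ⟨e₁, e₂⟩ <;> rw [e₁, e₂] <;> rfl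
  · obtain ⟨k, hk, hc⟩ := h.c_name
    have hl : ∀ b a : GV ℕ, NotLater b a → NotLater (lift b) (lift a) :=
      fun b a h e₁ e₂ => h (by simpa [lift] using e₁) e₂
    intro b hb
    rw [hseen]
    rw [relVars_union] at hb
    rcases hb with hb | hb
    · refine ⟨(h.vars b hb).1, fun b' hb' => ?_, (h.vars b hb).2.2⟩
      rcases hv b' hb' with rfl | ⟨hm, -⟩
      exacts [((h.vars b hb).2.1 a ha).next, (h.vars b hb).2.1 b' hm]
    · rcases hM.links'.relVars hb with rfl | rfl
      · exact ⟨notLater_of_name (by simp [hc, lift]), fun b hb => hl _ _ (hlater b hb).2,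
          (h.wf.2 a ha).1⟩
      · exact ⟨notLater_of_name (by simp [hc, lift]), fun b hb => hl _ _ (hlater b hb).1,
          (h.wf.2 a ha).1⟩
  · rw [hom]
    exact h.agree.advance ha (next_notMem fun b hb => (h.om_vars b hb).2 a ha)
      (next_notMem (a := lift a) fun b hb => (h.vars b hb).2.1 a ha) hM
      fun b hb => (hv b hb).imp_right And.left

variable {l : Option Ep} {e y : Ep} {om E : Set (Rel ℕ)} {E' : Set (Rel PN)} {P Q : Proc}
  {s : Set Var}

theorem Inv.advanceLeft (h : Inv n om₀ ⟨some e, om, P, y, s⟩ d c Ω) (A : Ty)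
    (hM : Mirror n E E' e.gv) :
    Inv n om₀ ⟨some (e.next A), om ∪ E, Q, y, s⟩ d c (Ω ∪ E') := by
  have hne := h.wf.1 e rfl
  have hv : ∀ b ∈ (PJ.mk (some (e.next A)) (om ∪ E) Q y s).vars, b = e.gv.next ∨
      (b ∈ (PJ.mk (some e) om P y s).vars ∧ b.name ≠ e.gv.name) := by
    rintro b (⟨_, h, rfl⟩ | rfl)
    · cases h; exact .inl rfl
    · exact .inr ⟨mem_vars_right, hne.symm⟩
  refine h.advance mem_vars_left ⟨?_, ?_⟩ rfl rfl hv hM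
  · rintro _ ⟨⟩; exact hne
  · intro b hb
    rcases hv b hb with rfl | ⟨hb, -⟩
    exacts [h.wf.2 e.gv mem_vars_left, h.wf.2 b hb]

theorem Inv.advanceRight (h : Inv n om₀ ⟨l, om, P, y, s⟩ d c Ω) (A : Ty)
    (hM : Mirror n E E' y.gv) :
    Inv n om₀ ⟨l, om ∪ E, Q, y.next A, s⟩ d c (Ω ∪ E') := by
  have hv : ∀ b ∈ (PJ.mk l (om ∪ E) Q (y.next A) s).vars, b = y.gv.next ∨
      (b ∈ (PJ.mk l om P y s).vars ∧ b.name ≠ y.gv.name) := by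
    rintro b (⟨e, he, rfl⟩ | rfl)
    · exact .inr ⟨.inl ⟨e, he, rfl⟩, h.wf.1 e he⟩
    · exact .inl rfl
  refine h.advance mem_vars_right ⟨h.wf.1, ?_⟩ rfl rfl hv hM
  intro b hb
  rcases hv b hb with rfl | ⟨hb, -⟩
  exacts [h.wf.2 y.gv mem_vars_right, h.wf.2 b hb]

theorem Inv.proc (h : Inv n om₀ ⟨l, om, P, y, s⟩ d c Ω) : Inv n om₀ ⟨l, om, Q, y, s⟩ d c Ω :=
  ⟨h.wf, h.om_vars, h.om_name, h.c_name, h.vars, h.agree, h.mirrored⟩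

theorem Inv.dropLeft (h : Inv n om₀ ⟨some e, om, P, y, s⟩ d c Ω) :
    Inv n om₀ ⟨none, om, P, y, s⟩ d c Ω := by
  have hv : (PJ.mk none om P y s).vars ⊆ (PJ.mk (some e) om P y s).vars := by
    rintro b (⟨_, h, rfl⟩ | rfl)
    · cases h
    · exact mem_vars_right
  exact ⟨⟨fun _ h => (by cases h), fun a ha => h.wf.2 a (hv ha)⟩,
    fun b hb => ⟨(h.om_vars b hb).1, fun a ha => (h.om_vars b hb).2 a (hv ha)⟩, h.om_name, h.c_name,
    fun b hb => ⟨(h.vars b hb).1, fun a ha => (h.vars b hb).2.1 a (hv ha), (h.vars b hb).2.2⟩,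
    fun a ha => h.agree a (hv ha), h.mirrored⟩

/-- The position variable of a channel that is closed may still be unfolded: the channel is not
above the remaining endpoint, as relations are between generations of the same channel. -/
theorem Inv.closedStep {a : GV ℕ} (h : Inv n om₀ ⟨none, om, P, y, s⟩ d c Ω) (ha : a.name ≠ y.ch)
    (hs : .chan a.name ∈ s) (hm : lift a.next ∉ relVars Ω)
    (hE : Links E' (lift a.next) (lift a)) : Inv n om₀ ⟨none, om, P, y, s⟩ d c (Ω ∪ E') := by
  have hv : ∀ b ∈ (PJ.mk none om P y s).vars, b = y.gv := by
    rintro b (⟨_, h, rfl⟩ | rfl)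
    · cases h
    · rfl
  obtain ⟨k, hk, hc⟩ := h.c_name
  refine ⟨h.wf, h.om_vars, h.om_name, h.c_name, fun b hb => ?_, ?_,
    h.mirrored.mono Set.subset_union_left⟩
  · rw [relVars_union] at hb
    rcases hb with hb | hb
    · exact h.vars b hb
    · have hbn : b.name = .ch a.name := by rcases hE.relVars hb with rfl | rfl <;> rfl
      refine ⟨notLater_of_name (by simp [hbn, hc]), fun a' ha' => notLater_of_name ?_,
        by rw [hbn]; exact hs⟩
      rw [hv a' ha', hbn]
      simpa [lift, Ep.gv] using ha.symm
  · refine h.agree.attachLater hm (next_ne a) hE (fun hm => ?_) fun b hb i => ?_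
    · exact ha (congrArg GV.name (hv _ hm))
    · rw [hv b hb]
      exact ⟨fun hl => ha (le_name h.om_name hl).symm, fun hl => ha (le_name h.om_name hl).symm⟩

/-- Spawning, for the two premises of the cut rule at once: each endpoint of the new judgment is old
or is the fresh channel. -/
theorem Inv.spawn {l' : Option Ep} {y' : Ep} {A : Ty} {w g : ℕ} {c' : GV PN}
    (h : Inv n om₀ ⟨l, om, P, y, s⟩ d c Ω) (hw : .chan w ∉ s)
    (hne : ∀ e, l' = some e → e.ch ≠ y'.ch)
    (hv : ∀ b ∈ (PJ.mk l' om Q y' s).vars,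
      b = (Ep.mk w ⟨some g, 0⟩ A).gv ∨ b ∈ (PJ.mk l om P y s).vars)
    (hc' : c' = c ∨ c' = freshC d) :
    Inv n om₀ ⟨l', om, Q, y', insert (.chan w) (insert (.gen g) s)⟩ (d + 1) c'
      (Ω ∪ same (freshC d) c) := by
  obtain ⟨k, hk, hc⟩ := h.c_name
  have hsub : s ⊆ insert (Var.chan w) (insert (Var.gen g) s) := fun v hv => .inr (.inr hv)
  have hE := links_same (freshC d) c
  have hfr : freshC d ∉ relVars Ω := fun hm =>
    absurd (h.vars _ hm).2.2 (Nat.not_succ_le_self d)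
  have hag : Agree n (PJ.mk l om P y s).vars om (Ω ∪ same (freshC d) c) :=
    h.agree.attach hfr hE (by simp [freshC])
  have hnames : ∀ b ∈ relVars (Ω ∪ same (freshC d) c), b ∈ relVars Ω ∨ b = freshC d ∨ b = c := by
    intro b hb
    rw [relVars_union] at hb
    exact hb.imp_right hE.relVars
  have hw' : ∀ b ∈ relVars (Ω ∪ same (freshC d) c), b.name ≠ .ch w := by
    intro b hb
    rcases hnames b hb with hb | rfl | rfl
    exacts [h.notMem_ch hw hb, by simp [freshC], by simp [hc]]
  have hwom : ∀ b ∈ relVars om, b.name ≠ w := fun b hb e => hw (e ▸ (h.om_vars b hb).1)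
  have hck : k ≠ d + 1 := by omega
  refine ⟨⟨hne, fun b hb => ?_⟩, fun b hb => ⟨hsub (h.om_vars b hb).1, fun a ha => ?_⟩, h.om_name, ?_,
    fun b hb => ⟨?_, fun a ha => ?_, ?_⟩, fun a ha i hi v => ?_,
    h.mirrored.mono Set.subset_union_left⟩
  · rcases hv b hb with rfl | hb
    · refine ⟨.inl rfl, fun g' e => ?_⟩
      obtain rfl : g = g' := by simpa [Ep.gv] using e
      exact .inr (.inl rfl)
    · exact ⟨hsub (h.wf.2 b hb).1, fun g hg => hsub ((h.wf.2 b hb).2 g hg)⟩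
  · rcases hv a ha with rfl | ha
    · exact notLater_of_name (hwom b hb).symm
    · exact (h.om_vars b hb).2 a ha
  · rcases hc' with rfl | rfl
    exacts [⟨k, hk.trans (Nat.le_succ d), hc⟩, ⟨d + 1, le_rfl, rfl⟩]
  · rcases hc' with rfl | rfl
    · rcases hnames b hb with hb | rfl | rfl
      exacts [(h.vars b hb).1, notLater_of_name (by simp [hc, freshC, hck]), notLater_refl _]
    · rcases hnames b hb with hb | rfl | rfl
      · refine notLater_of_name fun e => ?_
        have := (h.vars b hb).2.2
        rw [← e] at this
        exact Nat.not_succ_le_self d this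
      · exact notLater_refl _
      · exact notLater_of_name (by simp [hc, freshC, hck.symm])
  · rcases hv a ha with rfl | ha
    · exact notLater_of_name (hw' b hb).symm
    · rcases hnames b hb with hb | rfl | rfl
      exacts [(h.vars b hb).2.1 a ha, notLater_of_name (by simp [lift, freshC]),
        notLater_of_name (by simp [lift, hc])]
  · rcases hnames b hb with hb | rfl | rfl
    · exact (h.vars b hb).2.2.mono hsub (Nat.le_succ d)
    · exact le_refl (d + 1)
    · rw [hc]; exact hk.trans (Nat.le_succ d)
  · rcases hv a ha with rfl | ha
    · rw [le_iff_eq_of_notMem fun hm => hwom _ hm rfl,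
        le_iff_eq_of_notMem fun hm => hw' _ hm rfl, lift_injective.eq_iff]
    · exact hag a ha i hi v

end Steps

/-! ### Unification of channel terms -/

/-- A unifier through which every unifier factors by itself is most general. -/
theorem isMGU_of_forall {θ : Var → Term} {s t : Term} (hθ : Unifies θ s t)
    (h : ∀ σ, s.subst σ = t.subst σ → ∀ v, σ v = (θ v).subst σ) : IsMGU θ s t :=
  ⟨hθ, fun σ hσ => ⟨σ, hσ.1, h σ hσ.2⟩⟩

theorem genTerm_lc (b : Option ℕ) (k : ℕ) : (genTerm b k).LC := by
  induction k with
  | zero => cases b <;> trivial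
  | succ k ih => exact ih

theorem genTerm_opn (b : Option ℕ) (k i : ℕ) (u : Term) : Term.opn i u (genTerm b k) = genTerm b k := by
  induction k with
  | zero => cases b <;> rfl
  | succ k ih => simp only [genTerm, Term.opn, ih]

theorem genTerm_occ {b : Option ℕ} {k : ℕ} {v : Var} (h : (genTerm b k).Occ v) :
    ∃ g, b = some g ∧ v = .gen g := by
  induction k with
  | zero =>
    cases b with
    | none => exact h.elim
    | some g => exact ⟨g, rfl, Eq.symm h⟩
  | succ k ih => exact ih h

theorem genTerm_add_subst_inj (b b' : Option ℕ) (k m : ℕ) (σ : Var → Term) :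
    (genTerm b k).subst σ = (genTerm b' (k + m)).subst σ ↔
      (genTerm b 0).subst σ = (genTerm b' m).subst σ := by
  induction k with
  | zero => rw [Nat.zero_add]
  | succ k ih =>
    rw [← ih, Nat.succ_add]
    simp only [genTerm, Term.subst, Term.succ.injEq]

theorem sizeOf_genTerm_subst (g m : ℕ) (σ : Var → Term) :
    sizeOf ((genTerm (some g) m).subst σ) = sizeOf (σ (.gen g)) + m := by
  induction m with
  | zero => rfl
  | succ m ih =>
    have : sizeOf ((genTerm (some g) (m + 1)).subst σ) =
      1 + sizeOf ((genTerm (some g) m).subst σ) := rfl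
    omega

/-- Solving the equation between two generations: `ρ` is what the solution does on generation
variables. -/
theorem exists_genTerm_mgu_of_le {b b' : Option ℕ} {k k' : ℕ} (hk : k ≤ k')
    (h : ∃ σ, (genTerm b k).subst σ = (genTerm b' k').subst σ) :
    ∃ ρ : ℕ → Term, (∀ g, (ρ g).LC) ∧
      (∀ θ : Var → Term, (∀ g, θ (.gen g) = ρ g) →
        (genTerm b k).subst θ = (genTerm b' k').subst θ) ∧
      ∀ σ, (genTerm b k).subst σ = (genTerm b' k').subst σ → ∀ g, σ (.gen g) = (ρ g).subst σ := by
  obtain ⟨m, rfl⟩ := Nat.exists_eq_add_of_le hk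
  simp only [genTerm_add_subst_inj] at h ⊢
  obtain ⟨σ, h⟩ := h
  cases b with
  | none =>
    cases m with
    | succ m => cases h
    | zero =>
      cases b' with
      | none => exact ⟨fun g => .fv (.gen g), fun _ => trivial, fun _ _ => rfl, fun _ _ _ => rfl⟩
      | some g' =>
        refine ⟨fun g => if g = g' then .zero else .fv (.gen g), fun g => ?_, fun θ hθ => ?_,
          fun σ hσ g => ?_⟩
        · dsimp only; split <;> trivial
        · simp [genTerm, Term.subst, hθ]
        · dsimp only
          split
          · rename_i e; subst e; exact hσ.symm
          · rfl
  | some g₀ =>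
    by_cases hb : b' = some g₀
    · -- occurs check: equal generation variables can only be unified at equal offsets
      subst hb
      have hm : m = 0 := by
        have := congrArg sizeOf h
        rw [sizeOf_genTerm_subst, sizeOf_genTerm_subst] at this
        omega
      subst hm
      exact ⟨fun g => .fv (.gen g), fun _ => trivial, fun _ _ => rfl, fun _ _ _ => rfl⟩
    · refine ⟨fun g => if g = g₀ then genTerm b' m else .fv (.gen g), fun g => ?_, fun θ hθ => ?_,
        fun σ hσ g => ?_⟩
      · dsimp only; split
        exacts [genTerm_lc _ _, trivial]
      · have hs : ∀ m, (genTerm b' m).subst θ = genTerm b' m := by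
          intro m
          induction m with
          | zero =>
            cases b' with
            | none => rfl
            | some g' =>
              have : g' ≠ g₀ := fun e => hb (e ▸ rfl)
              simp [genTerm, Term.subst, hθ, this]
          | succ m ih => simp only [genTerm, Term.subst, ih]
        rw [hs]
        simp [genTerm, Term.subst, hθ]
      · dsimp only
        split
        · rename_i e; subst e; exact hσ
        · rfl

theorem exists_genTerm_mgu {b b' : Option ℕ} {k k' : ℕ}
    (h : ∃ σ, (genTerm b k).subst σ = (genTerm b' k').subst σ) :
    ∃ ρ : ℕ → Term, (∀ g, (ρ g).LC) ∧
      (∀ θ : Var → Term, (∀ g, θ (.gen g) = ρ g) →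
        (genTerm b k).subst θ = (genTerm b' k').subst θ) ∧
      ∀ σ, (genTerm b k).subst σ = (genTerm b' k').subst σ → ∀ g, σ (.gen g) = (ρ g).subst σ := by
  rcases le_total k k' with hk | hk
  · exact exists_genTerm_mgu_of_le hk h
  · obtain ⟨ρ, h₁, h₂, h₃⟩ := exists_genTerm_mgu_of_le hk (h.imp fun _ => Eq.symm)
    exact ⟨ρ, h₁, fun θ hθ => (h₂ θ hθ).symm, fun σ hσ => h₃ σ hσ.symm⟩

/-- Unifiable channel terms have a most general unifier. -/
theorem exists_isMGU {x y : ℕ} {b b' : Option ℕ} {k k' : ℕ}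
    (h : ∃ σ, Unifies σ (.gch (.fv (.chan x)) (genTerm b k))
      (.gch (.fv (.chan y)) (genTerm b' k'))) :
    ∃ θ, IsMGU θ (.gch (.fv (.chan x)) (genTerm b k)) (.gch (.fv (.chan y)) (genTerm b' k')) := by
  obtain ⟨σ, -, h⟩ := h
  obtain ⟨ρ, h₁, h₂, h₃⟩ := exists_genTerm_mgu (b := b) (b' := b') (k := k) (k' := k')
    ⟨σ, (Term.gch.inj h).2⟩
  -- identify the two names, and solve the equation between the generations
  let θ : Var → Term
    | .chan z => if z = y then .fv (.chan x) else .fv (.chan z)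
    | .gen g => ρ g
  refine ⟨θ, isMGU_of_forall ⟨fun v => ?_, ?_⟩ fun σ hσ v => ?_⟩
  · cases v with
    | chan z => simp only [θ]; split <;> trivial
    | gen g => exact h₁ g
  · simp only [Term.subst, h₂ θ fun _ => rfl]
    simp [θ]
  · obtain ⟨e₁, e₂⟩ := Term.gch.inj hσ
    cases v with
    | chan z =>
      simp only [θ]
      split
      · rename_i e; subst e; exact e₁.symm
      · rfl
    | gen g => exact h₃ σ e₂ g

/-! ### Side conditions of the rules -/

theorem Seq.freshName_of {Γ : Multiset (GV PN × Form)} {Ω : Set (Rel PN)} {z : GV PN × Form} {w : PN}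
    (hΓ : ∀ p ∈ Γ, p.1.name ≠ w) (hz : z.1.name ≠ w) (hΩ : ∀ b ∈ relVars Ω, b.name ≠ w) :
    Seq.FreshName ⟨Γ, Ω, z⟩ w :=
  ⟨hΓ, hz, fun r hr => ⟨hΩ _ ⟨r, hr, .inl rfl⟩, hΩ _ ⟨r, hr, .inr rfl⟩⟩⟩

/-- The side formulas of the goals of the construction: the context holds at most one formula,
annotated by the position variable of a channel other than `y`. -/
def Ctx (Γ : Multiset (GV PN × Form)) (y : ℕ) : Prop :=
  Γ = 0 ∨ ∃ X F x, Γ = {(X, F)} ∧ X.name = PN.ch x ∧ x ≠ y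

theorem ctx_leftA {l : Option Ep} {y : ℕ} (h : ∀ e, l = some e → e.ch ≠ y) : Ctx (leftA l) y := by
  cases l with
  | none => exact .inl rfl
  | some e => exact .inr ⟨_, _, _, rfl, rfl, h e rfl⟩

theorem ctx_singleton {X : GV PN} {F : Form} {x y : ℕ} (hX : X.name = .ch x) (h : x ≠ y) :
    Ctx {(X, F)} y := .inr ⟨_, _, _, rfl, hX, h⟩

theorem Ctx.name {Γ y} (h : Ctx Γ y) {p : GV PN × Form} (hp : p ∈ Γ) : ∃ x, p.1.name = .ch x := by
  rcases h with rfl | ⟨X, F, x, rfl, hx, -⟩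
  · simp at hp
  · rw [Multiset.mem_singleton] at hp
    subst hp
    exact ⟨x, hx⟩

theorem Seq.distinct_of_names {s : Seq}
    (h : (s.succ.1.name ::ₘ s.ante.map fun p => p.1.name).Nodup) : s.Distinct := by
  refine Multiset.Nodup.of_map GV.name ?_
  simpa [Multiset.map_map] using h

section Distinct
variable {Γ : Multiset (GV PN × Form)} {y k : ℕ} {c Y : GV PN} {F G : Form} {Ω : Set (Rel PN)}

theorem Ctx.distinct (hΓ : Ctx Γ y) (hY : Y.name = .ch y) : Seq.Distinct ⟨Γ, Ω, (Y, G)⟩ := by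
  apply Seq.distinct_of_names
  rcases hΓ with rfl | ⟨X, F, x, rfl, hx, hne⟩
  · simp
  · simp [hY, hx, hne.symm]

theorem Ctx.distinct_cons (hΓ : Ctx Γ y) (hc : c.name = .cfg k) (hY : Y.name = .ch y) :
    Seq.Distinct ⟨(c, F) ::ₘ Γ, Ω, (Y, G)⟩ := by
  apply Seq.distinct_of_names
  rcases hΓ with rfl | ⟨X, F, x, rfl, hx, hne⟩
  · simp [hc, hY]
  · simp [hc, hY, hx, hne.symm]

theorem Ctx.distinct_msg (hΓ : Ctx Γ y) (hc : c.name = .cfg k) (hY : Y.name = .ch y) {d M} :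
    Seq.Distinct ⟨(freshL d, M) ::ₘ (c, F) ::ₘ Γ, Ω, (Y, G)⟩ := by
  apply Seq.distinct_of_names
  rcases hΓ with rfl | ⟨X, F, x, rfl, hx, hne⟩
  · simp [freshL, hc, hY]
  · simp [freshL, hc, hY, hx, hne.symm]

theorem Ctx.distinct_spawn (hΓ : Ctx Γ y) (hc : c.name = .cfg k) (hY : Y.name = .ch y) {d M}
    (hk : k ≤ d) : Seq.Distinct ⟨(freshC d, M) ::ₘ (c, F) ::ₘ Γ, Ω, (Y, G)⟩ := by
  have hkd : d + 1 ≠ k := by omega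
  apply Seq.distinct_of_names
  rcases hΓ with rfl | ⟨X, F, x, rfl, hx, hne⟩
  · simp [freshC, hc, hY, hkd]
  · simp [freshC, hc, hY, hx, hne.symm, hkd]

end Distinct

theorem distinct_msgAx {d : ℕ} {M : Form} {Ω : Set (Rel PN)} :
    Seq.Distinct ⟨{(freshL d, M)}, Ω, (freshR d, M)⟩ := by
  apply Seq.distinct_of_names
  simp [freshL, freshR]

/-! ### Sound blocks -/

section Sound
variable (S : TySig) (V : Defs) (D : Graph PJ) (P : St D.Node → Prop)

/-- The sequent at the bottom of a block. -/
def Blk.concl : Blk (St D.Node) → Seq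
  | .leaf s => starOf D s
  | .ax q => q
  | .un q _ => q
  | .bin q _ _ => q
  | .fam q _ _ => q

/-- All inferences of the block are correct, and its open leaves satisfy `P`. -/
def Sound : Blk (St D.Node) → Prop
  | .leaf s => P s
  | .ax q => LStep (stSig S V) q noPrem
  | .un q t => LStep (stSig S V) q (prem1 (t.concl D)) ∧ Sound t
  | .bin q t₁ t₂ =>
    LStep (stSig S V) q (prem2 (t₁.concl D) (t₂.concl D)) ∧ Sound t₁ ∧ Sound t₂
  | .fam q L t => LStep (stSig S V) q (premL L fun l => (t l).concl D) ∧ ∀ l, Sound (t l)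

variable {S V D P} {s : Set Var} {d k v : ℕ} {c x y : GV PN} {M K A B : Form}
  {Γ : Multiset (GV PN × Form)} {Ω : Set (Rel PN)} {rest : Set (Rel PN) → Blk (St D.Node)}

theorem name_ne_of_used {N} {a : GV PN} (h : NameUsed s d a.name) (hn : ¬ NameUsed s d N) :
    a.name ≠ N := fun e => hn (e ▸ h)

theorem Ctx.freshName_cons (hΓ : Ctx Γ v) (hc : c.name = .cfg k) (hy : y.name = .ch v) {F G : Form}
    (hΩ : ∀ b ∈ relVars Ω, NameUsed s d b.name) :
    Seq.FreshName ⟨(c, F) ::ₘ Γ, Ω, (y, G)⟩ (.msgL d) := by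
  refine Seq.freshName_of (fun p hp => ?_) (by simp [hy]) fun b hb =>
    name_ne_of_used (hΩ b hb) (lt_irrefl d)
  rcases Multiset.mem_cons.1 hp with rfl | hp
  · simp [hc]
  · obtain ⟨x, hx⟩ := hΓ.name hp; simp [hx]

theorem Ctx.freshName_msg (hΓ : Ctx Γ v) (hc : c.name = .cfg k) (hy : y.name = .ch v) {F G : Form}
    (hΩ : ∀ b ∈ relVars Ω, b.name ≠ .msgR d) :
    Seq.FreshName ⟨(freshL d, M) ::ₘ (c, F) ::ₘ Γ, Ω, (y, G)⟩ (.msgR d) := by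
  refine Seq.freshName_of (fun p hp => ?_) (by simp [hy]) hΩ
  rcases Multiset.mem_cons.1 hp with rfl | hp
  · simp [freshL]
  rcases Multiset.mem_cons.1 hp with rfl | hp
  · simp [hc]
  · obtain ⟨x, hx⟩ := hΓ.name hp; simp [hx]

theorem msgR_notUsed (hΩ : ∀ b ∈ relVars Ω, NameUsed s d b.name) {q : GV PN}
    (hq : q.name ≠ .msgR d) : ∀ b ∈ relVars (Ω ∪ same (freshL d) q), b.name ≠ .msgR d := by
  intro b hb
  rw [relVars_union] at hb
  rcases hb with hb | hb
  · exact name_ne_of_used (hΩ b hb) id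
  · rcases (links_same _ _).relVars hb with rfl | rfl
    exacts [by simp [freshL], hq]

theorem sound_toRight (hΓ : Ctx Γ v) (hc : c.name = .cfg k) (hy : y.name = .ch v)
    (hΩ : ∀ b ∈ relVars Ω, NameUsed s d b.name)
    (hr : (rest (Ω ∪ same (freshL d) c)).concl D = ⟨(c, K) ::ₘ Γ, Ω ∪ same (freshL d) c, (y, B)⟩)
    (hs : Sound S V D P (rest (Ω ∪ same (freshL d) c))) :
    Sound S V D P (toRight d c M K Γ Ω y B rest) := by
  refine ⟨⟨hΓ.distinct_cons hc hy, .tensL (hΓ.freshName_cons hc hy hΩ)⟩,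
    ⟨hΓ.distinct_msg hc hy, ?_⟩, ⟨distinct_msgAx, .id⟩, hs⟩
  rw [hr]
  exact LRule.tensR (Δ := {(freshL d, M)}) (Δ' := (c, K) ::ₘ Γ)
    (hΓ.freshName_msg hc hy (msgR_notUsed hΩ (by simp [hc])))

theorem cons_singleton_comm {T : Type} (a b : T) : a ::ₘ {b} = b ::ₘ {a} := Multiset.pair_comm a b

theorem lolliL_ante {T : Type} (a b : T) (Γ : Multiset T) : a ::ₘ b ::ₘ Γ = b ::ₘ ({a} + Γ) := by
  rw [Multiset.cons_swap, Multiset.singleton_add]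

theorem sound_toLeft (hx : x.name = .ch k) (hkv : k ≠ v) {k' : ℕ} (hc : c.name = .cfg k')
    {z : GV PN × Form} (hy : z.1.name = .ch v) (hΩ : ∀ b ∈ relVars Ω, NameUsed s d b.name)
    (hr : (rest (Ω ∪ same (freshL d) c)).concl D = ⟨(c, K) ::ₘ {(x, A)}, Ω ∪ same (freshL d) c, z⟩)
    (hs : Sound S V D P (rest (Ω ∪ same (freshL d) c))) :
    Sound S V D P (toLeft d c M K x A Ω z rest) := by
  have hΓ : ∀ F, Ctx {(x, F)} v := fun F => ctx_singleton hx hkv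
  refine ⟨⟨(hΓ _).distinct_cons hc hy, .tensL ((hΓ _).freshName_cons hc hy hΩ)⟩,
    ⟨(hΓ _).distinct_msg hc hy, ?_⟩, ⟨distinct_msgAx, .id⟩, hs⟩
  have hf := (hΓ (.lolli M A)).freshName_msg (M := M) (F := K) (G := z.2) hc hy
    (msgR_notUsed hΩ (q := c) (by simp [hc]))
  have he : (freshL d, M) ::ₘ (c, K) ::ₘ {(x, .lolli M A)} =
      (x, Form.lolli M A) ::ₘ ({(freshL d, M)} + {(c, K)}) := by
    rw [cons_singleton_comm (c, K) (x, Form.lolli M A), lolliL_ante]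
  rw [hr, cons_singleton_comm (c, K) (x, A)]
  simp only [Blk.concl]
  rw [he] at hf ⊢
  exact LRule.lolliL hf

theorem sound_fromLeft (hx : x.name = .ch k) (hkv : k ≠ v) {k' : ℕ} (hc : c.name = .cfg k')
    {z : GV PN × Form} (hy : z.1.name = .ch v) (hΩ : ∀ b ∈ relVars Ω, NameUsed s d b.name)
    (hr : (rest (Ω ∪ same (freshL d) x)).concl D = ⟨(c, K) ::ₘ {(x, A)}, Ω ∪ same (freshL d) x, z⟩)
    (hs : Sound S V D P (rest (Ω ∪ same (freshL d) x))) :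
    Sound S V D P (fromLeft d c M K x A Ω z rest) := by
  have hΓ : ∀ F, Ctx {(x, F)} v := fun F => ctx_singleton hx hkv
  have hf : ∀ F G : Form, Seq.FreshName ⟨(x, F) ::ₘ {(c, G)}, Ω, (z.1, z.2)⟩ (.msgL d) :=
      fun F G => by
    rw [show (x, F) ::ₘ {(c, G)} = (c, G) ::ₘ {(x, F)} from Multiset.pair_comm _ _]
    exact (hΓ F).freshName_cons (G := z.2) hc hy hΩ
  refine ⟨⟨(hΓ _).distinct_cons hc hy, ?_⟩, ⟨(hΓ _).distinct_msg hc hy, ?_⟩, ⟨distinct_msgAx, .id⟩,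
    hs⟩
  · rw [cons_singleton_comm (c, Form.lolli M K) (x, Form.tens M A)]
    have := LRule.tensL (Sg := stSig S V) (w := freshL d) (hf (.tens M A) (.lolli M K))
    rwa [show (x, A) ::ₘ {(c, Form.lolli M K)} =
      (c, .lolli M K) ::ₘ {(x, A)} from Multiset.pair_comm _ _] at this
  · have hf := (hΓ A).freshName_msg (M := M) (F := .lolli M K) (G := z.2) hc hy
      (msgR_notUsed hΩ (q := x) (by simp [hx]))
    rw [hr]
    simp only [Blk.concl]
    rw [lolliL_ante] at hf ⊢
    exact LRule.lolliL hf

theorem sound_fromRight (hΓ : Ctx Γ v) (hc : c.name = .cfg k) (hy : y.name = .ch v)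
    (hΩ : ∀ b ∈ relVars Ω, NameUsed s d b.name)
    (hr : (rest Ω).concl D = ⟨(c, K) ::ₘ Γ, Ω, (y, B)⟩)
    (hs : Sound S V D P (rest Ω)) :
    Sound S V D P (fromRight d c M K Γ Ω y B rest) := by
  have hf := hΓ.freshName_msg (M := M) (F := .lolli M K) (G := B) hc hy
    fun b hb => name_ne_of_used (hΩ b hb) (N := .msgR d) id
  refine ⟨⟨hΓ.distinct_cons hc hy, .lolliR (hΓ.freshName_cons hc hy hΩ)⟩,
    ⟨hΓ.distinct_msg hc hy, ?_⟩, ⟨distinct_msgAx, .id⟩, hs⟩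
  rw [hr]
  simp only [Blk.concl]
  rw [lolliL_ante] at hf ⊢
  exact LRule.lolliL hf

/-- Every block, also that of an ill-typed goal, starts with an inference and concludes the sequent
of its goal. -/
theorem block_concl (S : TySig) (D : Graph PJ) (s : St D.Node) :
    (∀ a, block S D s ≠ .leaf a) ∧ (block S D s).concl D = starOf D s := by
  unfold block
  dsimp only
  split <;> try (refine ⟨fun _ h => ?_, rfl⟩; cases h)
  all_goals split <;> exact ⟨fun _ h => (by cases h), rfl⟩

end Sound

/-! ### The blocks of the construction are sound -/

section Block
variable {S : TySig} {V : Defs} {D : Graph PJ} {om₀ : Set (Rel ℕ)}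

/-- The open goal `s` is for a judgment of the typing derivation and satisfies the invariant. -/
def GoalInv (S : TySig) (D : Graph PJ) (om₀ : Set (Rel ℕ)) (s : St D.Node) : Prop :=
  D.Reach s.node ∧ Inv S.n om₀ (D.concl s.node) s.depth s.c s.om

/-- `s'` is an open goal for a premise of the typing judgment at `s.node`, and satisfies the
invariant. -/
def NextGoal (S : TySig) (D : Graph PJ) (om₀ : Set (Rel ℕ)) (s s' : St D.Node) : Prop :=
  D.Step s.node s'.node ∧ Inv S.n om₀ (D.concl s'.node) s'.depth s'.c s'.om

/-- `b` is a sound piece of a derivation for the goal `s` that has an open leaf for each premise of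
the typing judgment at `s.node`. -/
def BlockSpec (S : TySig) (V : Defs) (D : Graph PJ) (om₀ : Set (Rel ℕ)) (s : St D.Node)
    (b : Blk (St D.Node)) : Prop :=
  Sound S V D (NextGoal S D om₀ s) b ∧ ∀ u, D.Step s.node u → ∃ s' ∈ b.leaves, s'.node = u

variable {s : St D.Node} {i : ℕ} {c : GV PN} {Ω : Set (Rel PN)} {j' : PJ}

theorem kid_concl (hp : (D.prem s.node i).map D.concl = some j') :
    (kid D s i c Ω).concl D = starSeq j'.left j'.proc j'.right c Ω := by
  obtain ⟨u, hu, rfl⟩ := Option.map_eq_some_iff.1 hp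
  simp [kid, Blk.concl, starOf, hu]

theorem sound_kid (hp : (D.prem s.node i).map D.concl = some j')
    (h : Inv S.n om₀ j' (s.depth + 1) c Ω) :
    Sound S V D (NextGoal S D om₀ s) (kid D s i c Ω) := by
  obtain ⟨u, hu, rfl⟩ := Option.map_eq_some_iff.1 hp
  refine ⟨⟨i, ?_⟩, ?_⟩ <;> simp only [hu, Option.getD_some]
  exact h

theorem step_iff_of_prem {s : St D.Node} {ps : ℕ → Option PJ}
    (hps : (fun i => (D.prem s.node i).map D.concl) = ps) {u : D.Node} (h : D.Step s.node u) :
    ∃ i, (ps i).isSome ∧ ∀ c Ω, ∃ s' ∈ (kid D s i c Ω).leaves, s'.node = u := by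
  obtain ⟨i, hi⟩ := h
  refine ⟨i, ?_, fun c Ω => ⟨_, rfl, ?_⟩⟩
  · rw [← hps]; simp [hi]
  · simp [hi]

theorem progF_mem {e : TEp} {a i A} (h : ProgDefn S (some e) a i A) :
    (stSig S V).defn .prog (progArgs (some e)) a i A := ⟨_, rfl, h⟩

theorem cfgF_mem {l : Option TEp} {r : TEp} {C : Conf} {a i A} (h : CfgDefn S V l r C a i A) :
    (stSig S V).defn .cfg (cfgArgs l r C) a i A := ⟨_, _, _, rfl, h⟩

variable {l : Option Ep} {y : Ep} {Λ : Set (Rel ℕ)} {t : Set Var}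

theorem Inv.ctx {n d} {P} (h : Inv n om₀ ⟨l, Λ, P, y, t⟩ d c Ω) : Ctx (leftA l) y.ch :=
  ctx_leftA h.wf.1

theorem Inv.notLater_left {n d} {P} {e : Ep} (h : Inv n om₀ ⟨some e, Λ, P, y, t⟩ d c Ω) :
    ∀ b ∈ (PJ.mk (some e) Λ P y t).vars, NotLater b e.gv := by
  rintro b (⟨_, h, rfl⟩ | rfl)
  · cases h; exact notLater_refl _
  · exact notLater_of_name (h.wf.1 e rfl).symm

theorem Inv.used {n d} {j : PJ} (h : Inv n om₀ j d c Ω) :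
    ∀ b ∈ relVars Ω, NameUsed j.seen d b.name := fun b hb => (h.vars b hb).2.2

theorem Inv.distinct {n d} {P : Proc} {F G : Form} {Ω' : Set (Rel PN)} {Y : GV PN}
    (h : Inv n om₀ ⟨l, Λ, P, y, t⟩ d c Ω) (hY : Y.name = .ch y.ch := by rfl) :
    Seq.Distinct ⟨(c, F) ::ₘ leftA l, Ω', (Y, G)⟩ := by
  obtain ⟨k, -, hc⟩ := h.c_name
  exact h.ctx.distinct_cons hc hY

theorem used_union {T : Set Var} {d : ℕ} {E : Set (Rel PN)} {p q : GV PN}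
    (h : ∀ b ∈ relVars Ω, NameUsed T d b.name) (hE : Links E p q) (hp : NameUsed T d p.name)
    (hq : NameUsed T d q.name) : ∀ b ∈ relVars (Ω ∪ E), NameUsed T d b.name := by
  intro b hb
  rw [relVars_union] at hb
  rcases hb with hb | hb
  · exact h b hb
  · rcases hE.relVars hb with rfl | rfl <;> assumption

theorem exists_leaf_of_prem1 {b : Blk (St D.Node)}
    (hp : (fun i => (D.prem s.node i).map D.concl) = prem1 j')
    (hb : b.leaves = (kid D s 0 c Ω).leaves) :
    ∀ u, D.Step s.node u → ∃ s' ∈ b.leaves, s'.node = u := by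
  intro u hu
  obtain ⟨i, hi, hu⟩ := step_iff_of_prem hp hu
  obtain rfl : i = 0 := by by_contra h; simp [prem1, h] at hi
  rw [hb]
  exact hu _ _

theorem exists_leaf_of_premL {b : Blk (St D.Node)} {L : Finset ℕ} {f : L → PJ}
    (hp : (fun i => (D.prem s.node i).map D.concl) = premL L f)
    (hb : b.leaves = ⋃ k : L, (kid D s k c Ω).leaves) :
    ∀ u, D.Step s.node u → ∃ s' ∈ b.leaves, s'.node = u := by
  intro u hu
  obtain ⟨i, hi, hu⟩ := step_iff_of_prem hp hu
  have hi : i ∈ L := by by_contra h; simp [premL, h] at hi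
  obtain ⟨s', hs', e⟩ := hu c Ω
  exact ⟨s', hb ▸ Set.mem_iUnion.2 ⟨⟨i, hi⟩, hs'⟩, e⟩

/-! ### Left rules for the second formula of an antecedent. -/

section LeftRules

variable {Sg : Sig} {c x : GV PN} {F G A : Form} {z : GV PN × Form} {p : Pred} {ts : List Term}

theorem LRule.muL_snd {i : ℕ} (h : Sg.defn p ts .mu i A) :
    LRule Sg ⟨(c, F) ::ₘ {(x, .atom p ts)}, Ω, z⟩
      (prem1 ⟨(c, F) ::ₘ {(x.next, A)}, Ω ∪ unfLt i x.next x, z⟩) := by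
  obtain ⟨z, C⟩ := z
  rw [cons_singleton_comm, cons_singleton_comm (c, F)]
  exact .muL h

theorem LRule.nuL_snd {i : ℕ} (h : Sg.defn p ts .nu i A) :
    LRule Sg ⟨(c, F) ::ₘ {(x, .atom p ts)}, Ω, z⟩
      (prem1 ⟨(c, F) ::ₘ {(x.next, A)}, Ω ∪ unfEq i x.next x, z⟩) := by
  obtain ⟨z, C⟩ := z
  rw [cons_singleton_comm, cons_singleton_comm (c, F)]
  exact .nuL h

theorem LRule.plusL_snd {I : Finset ℕ} {A : I → Form} :
    LRule Sg ⟨(c, F) ::ₘ {(x, .plus I A)}, Ω, z⟩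
      (premL I fun i => ⟨(c, F) ::ₘ {(x, A i)}, Ω, z⟩) := by
  simp only [cons_singleton_comm (c, F)]
  exact .plusL

theorem LRule.wthL_snd {I : Finset ℕ} {A : I → Form} (k : I) :
    LRule Sg ⟨(c, F) ::ₘ {(x, .wth I A)}, Ω, z⟩ (prem1 ⟨(c, F) ::ₘ {(x, A k)}, Ω, z⟩) := by
  simp only [cons_singleton_comm (c, F)]
  exact .wthL k

theorem LRule.oneL_snd :
    LRule Sg ⟨(c, F) ::ₘ {(x, .one)}, Ω, z⟩ (prem1 ⟨{(c, F)}, Ω, z⟩) := by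
  rw [cons_singleton_comm]
  exact .oneL

end LeftRules

theorem blockSpec_muR {T v : ℕ} {β : Gen} {P : Proc}
    (hj : D.concl s.node = ⟨l, Λ, .muR T P, ⟨v, β, .tv T⟩, t⟩) (hT : T ∈ S.dom)
    (hk : S.kind T = .mu)
    (hp : (fun i => (D.prem s.node i).map D.concl) =
      prem1 ⟨l, Λ ∪ unfEq (S.prio T) ⟨v, β.next⟩ ⟨v, β⟩, P, ⟨v, β.next, S.body T⟩, t⟩)
    (h : Inv S.n om₀ ⟨l, Λ, .muR T P, ⟨v, β, .tv T⟩, t⟩ s.depth s.c s.om) :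
    BlockSpec S V D om₀ s (block S D s) := by
  have h₀ := congrFun hp 0
  have h1 := h.cfgStep (links_unfLt (S.n + 2) _ _)
  have h2 := h1.advanceRight (S.body T) (Q := P) (Mirror.unfEq S.n (S.prio T) ⟨v, β⟩)
  have h3 := h2.msgStep (links_same _ _) (.inl rfl)
  obtain ⟨k, -, hc⟩ := h1.c_name
  simp only [block, hj]
  refine ⟨⟨⟨?_, ?_⟩, ⟨h1.distinct, .muR (progF_mem (.mu hT hk))⟩,
    sound_toRight h2.ctx hc rfl h2.used (kid_concl h₀) (sound_kid h₀ h3)⟩,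
    exists_leaf_of_prem1 hp (Set.empty_union _)⟩
  · simp only [starOf, hj]; exact h.distinct
  · simp only [starOf, hj]; exact .muL (cfgF_mem (.muR hT hk))

theorem blockSpec_nuR {T v : ℕ} {β : Gen} {P : Proc}
    (hj : D.concl s.node = ⟨l, Λ, .nuR T P, ⟨v, β, .tv T⟩, t⟩) (hT : T ∈ S.dom)
    (hk : S.kind T = .nu)
    (hp : (fun i => (D.prem s.node i).map D.concl) =
      prem1 ⟨l, Λ ∪ unfLt (S.prio T) ⟨v, β.next⟩ ⟨v, β⟩, P, ⟨v, β.next, S.body T⟩, t⟩)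
    (h : Inv S.n om₀ ⟨l, Λ, .nuR T P, ⟨v, β, .tv T⟩, t⟩ s.depth s.c s.om) :
    BlockSpec S V D om₀ s (block S D s) := by
  have h₀ := congrFun hp 0
  have h1 := h.cfgStep (links_unfLt (S.n + 2) _ _)
  have h2 := h1.advanceRight (S.body T) (Q := P) (Mirror.unfLt S.n (S.prio T) ⟨v, β⟩)
  obtain ⟨k, -, hc⟩ := h1.c_name
  simp only [block, hj]
  refine ⟨⟨⟨?_, ?_⟩, ⟨h1.distinct, .nuR (progF_mem (.nu hT hk))⟩,
    sound_fromRight h2.ctx hc rfl h2.used (kid_concl h₀) (sound_kid h₀ h2.deeper)⟩,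
    exists_leaf_of_prem1 hp (Set.empty_union _)⟩
  · simp only [starOf, hj]; exact h.distinct
  · simp only [starOf, hj]; exact .muL (cfgF_mem (.nuR hT hk))

theorem blockSpec_muL {T v : ℕ} {β : Gen} {P : Proc}
    (hj : D.concl s.node = ⟨some ⟨v, β, .tv T⟩, Λ, .muL T P, y, t⟩) (hT : T ∈ S.dom)
    (hk : S.kind T = .mu)
    (hp : (fun i => (D.prem s.node i).map D.concl) =
      prem1 ⟨some ⟨v, β.next, S.body T⟩, Λ ∪ unfLt (S.prio T) ⟨v, β.next⟩ ⟨v, β⟩, P, y, t⟩)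
    (h : Inv S.n om₀ ⟨some ⟨v, β, .tv T⟩, Λ, .muL T P, y, t⟩ s.depth s.c s.om) :
    BlockSpec S V D om₀ s (block S D s) := by
  have h₀ := congrFun hp 0
  have h1 := h.cfgStep (links_unfLt (S.n + 2) _ _)
  have h2 := h1.advanceLeft (S.body T) (Q := P) (Mirror.unfLt S.n (S.prio T) ⟨v, β⟩)
  have h3 := h2.msgStep (links_same _ _)
    (.inr ⟨⟨v, β.next⟩, (h.wf.2 _ mem_vars_left).1, rfl, h2.notLater_left⟩)
  obtain ⟨k, -, hc⟩ := h1.c_name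
  simp only [block, hj]
  refine ⟨⟨⟨?_, ?_⟩, ⟨h1.distinct, .muL_snd (progF_mem (.mu hT hk))⟩,
    sound_fromLeft rfl (h.wf.1 _ rfl) hc rfl h2.used (kid_concl h₀) (sound_kid h₀ h3)⟩,
    exists_leaf_of_prem1 hp (Set.empty_union _)⟩
  · simp only [starOf, hj]; exact h.distinct
  · simp only [starOf, hj]; exact .muL (cfgF_mem (.muL hT hk))

theorem blockSpec_nuL {T v : ℕ} {β : Gen} {P : Proc}
    (hj : D.concl s.node = ⟨some ⟨v, β, .tv T⟩, Λ, .nuL T P, y, t⟩) (hT : T ∈ S.dom)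
    (hk : S.kind T = .nu)
    (hp : (fun i => (D.prem s.node i).map D.concl) =
      prem1 ⟨some ⟨v, β.next, S.body T⟩, Λ ∪ unfEq (S.prio T) ⟨v, β.next⟩ ⟨v, β⟩, P, y, t⟩)
    (h : Inv S.n om₀ ⟨some ⟨v, β, .tv T⟩, Λ, .nuL T P, y, t⟩ s.depth s.c s.om) :
    BlockSpec S V D om₀ s (block S D s) := by
  have h₀ := congrFun hp 0
  have h1 := h.cfgStep (links_unfLt (S.n + 2) _ _)
  have h2 := h1.advanceLeft (S.body T) (Q := P) (Mirror.unfEq S.n (S.prio T) ⟨v, β⟩)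
  have h3 := h2.msgStep (links_same _ _) (.inl rfl)
  obtain ⟨k, -, hc⟩ := h1.c_name
  simp only [block, hj]
  refine ⟨⟨⟨?_, ?_⟩, ⟨h1.distinct, .nuL_snd (progF_mem (.nu hT hk))⟩,
    sound_toLeft rfl (h.wf.1 _ rfl) hc rfl h2.used (kid_concl h₀) (sound_kid h₀ h3)⟩,
    exists_leaf_of_prem1 hp (Set.empty_union _)⟩
  · simp only [starOf, hj]; exact h.distinct
  · simp only [starOf, hj]; exact .muL (cfgF_mem (.nuL hT hk))

theorem blockSpec_plusR {k v : ℕ} {β : Gen} {P : Proc} {L : Finset ℕ} {A : L → Ty}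
    (hj : D.concl s.node = ⟨l, Λ, .sendR k P, ⟨v, β, .plus L A⟩, t⟩) (hk : k ∈ L)
    (hp : (fun i => (D.prem s.node i).map D.concl) =
      prem1 ⟨l, Λ ∪ same ⟨v, β⟩ ⟨v, β.next⟩, P, ⟨v, β.next, A ⟨k, hk⟩⟩, t⟩)
    (h : Inv S.n om₀ ⟨l, Λ, .sendR k P, ⟨v, β, .plus L A⟩, t⟩ s.depth s.c s.om) :
    BlockSpec S V D om₀ s (block S D s) := by
  have h₀ := congrFun hp 0
  have h1 := h.cfgStep (links_unfLt (S.n + 2) _ _)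
  have h2 := h1.advanceRight (A ⟨k, hk⟩) (Q := P) (Mirror.same_unfEq S.n ⟨v, β⟩)
  have h3 := h2.msgStep (links_same _ _) (.inl rfl)
  obtain ⟨k, -, hc⟩ := h1.c_name
  simp only [block, hj, dif_pos hk]
  refine ⟨⟨⟨?_, ?_⟩, ⟨h1.distinct, .muR (progF_mem .plus)⟩, ⟨h1.distinct, .plusR ⟨_, hk⟩⟩,
    sound_toRight h2.ctx hc rfl h2.used (kid_concl h₀) (sound_kid h₀ h3)⟩,
    exists_leaf_of_prem1 hp (Set.empty_union _)⟩
  · simp only [starOf, hj]; exact h.distinct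
  · simp only [starOf, hj]; exact .muL (cfgF_mem (.sendR hk))

theorem blockSpec_wthL {k v : ℕ} {β : Gen} {P : Proc} {L : Finset ℕ} {A : L → Ty}
    (hj : D.concl s.node = ⟨some ⟨v, β, .wth L A⟩, Λ, .sendL k P, y, t⟩) (hk : k ∈ L)
    (hp : (fun i => (D.prem s.node i).map D.concl) =
      prem1 ⟨some ⟨v, β.next, A ⟨k, hk⟩⟩, Λ ∪ same ⟨v, β⟩ ⟨v, β.next⟩, P, y, t⟩)
    (h : Inv S.n om₀ ⟨some ⟨v, β, .wth L A⟩, Λ, .sendL k P, y, t⟩ s.depth s.c s.om) :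
    BlockSpec S V D om₀ s (block S D s) := by
  have h₀ := congrFun hp 0
  have h1 := h.cfgStep (links_unfLt (S.n + 2) _ _)
  have h2 := h1.advanceLeft (A ⟨k, hk⟩) (Q := P) (Mirror.same_unfLt S.n ⟨v, β⟩)
  have h3 := h2.msgStep (links_same _ _) (.inl rfl)
  obtain ⟨k, -, hc⟩ := h1.c_name
  simp only [block, hj, dif_pos hk]
  refine ⟨⟨⟨?_, ?_⟩, ⟨h1.distinct, .muL_snd (progF_mem .wth)⟩,
    ⟨(ctx_singleton rfl (h.wf.1 _ rfl)).distinct_cons hc rfl, .wthL_snd ⟨_, hk⟩⟩,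
    sound_toLeft rfl (h.wf.1 _ rfl) hc rfl h2.used (kid_concl h₀) (sound_kid h₀ h3)⟩,
    exists_leaf_of_prem1 hp (Set.empty_union _)⟩
  · simp only [starOf, hj]; exact h.distinct
  · simp only [starOf, hj]; exact .muL (cfgF_mem (.sendL hk))

theorem blockSpec_plusL {v : ℕ} {β : Gen} {L : Finset ℕ} {A : L → Ty} {P : L → Proc}
    (hj : D.concl s.node = ⟨some ⟨v, β, .plus L A⟩, Λ, .caseL L P, y, t⟩)
    (hp : (fun i => (D.prem s.node i).map D.concl) =
      premL L fun k => ⟨some ⟨v, β.next, A k⟩, Λ ∪ same ⟨v, β⟩ ⟨v, β.next⟩, P k, y, t⟩)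
    (h : Inv S.n om₀ ⟨some ⟨v, β, .plus L A⟩, Λ, .caseL L P, y, t⟩ s.depth s.c s.om) :
    BlockSpec S V D om₀ s (block S D s) := by
  have h₀ : ∀ k : L, (D.prem s.node k).map D.concl =
      some ⟨some ⟨v, β.next, A k⟩, Λ ∪ same ⟨v, β⟩ ⟨v, β.next⟩, P k, y, t⟩ := fun k =>
    (congrFun hp k).trans (dif_pos k.2)
  have h1 := h.cfgStep (links_unfLt (S.n + 2) _ _)
  have h2 := fun k => h1.advanceLeft (A k) (Q := P k) (Mirror.same_unfLt S.n ⟨v, β⟩)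
  have h3 := fun k => (h2 k).msgStep (links_same _ _)
    (.inr ⟨⟨v, β.next⟩, (h.wf.2 _ mem_vars_left).1, rfl, (h2 k).notLater_left⟩)
  obtain ⟨k, -, hc⟩ := h1.c_name
  have hX : ∀ F, Ctx {((lift ⟨v, β⟩).next, F)} y.ch := fun F => ctx_singleton rfl (h.wf.1 _ rfl)
  simp only [block, hj, dif_pos]
  refine ⟨⟨⟨?_, ?_⟩, ⟨h1.distinct, .muL_snd (progF_mem .plus)⟩,
    ⟨(hX _).distinct_cons hc rfl, .plusL_snd⟩, fun k =>
    ⟨⟨(hX _).distinct_cons hc rfl, .wthL k⟩,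
    sound_fromLeft rfl (h.wf.1 _ rfl) hc rfl (h2 k).used (kid_concl (h₀ k))
      (sound_kid (h₀ k) (h3 k))⟩⟩,
    exists_leaf_of_premL hp (Set.iUnion_congr fun _ => Set.empty_union _)⟩
  · simp only [starOf, hj]; exact h.distinct
  · simp only [starOf, hj]; exact .muL (cfgF_mem .caseL)

theorem blockSpec_wthR {v : ℕ} {β : Gen} {L : Finset ℕ} {A : L → Ty} {P : L → Proc}
    (hj : D.concl s.node = ⟨l, Λ, .caseR L P, ⟨v, β, .wth L A⟩, t⟩)
    (hp : (fun i => (D.prem s.node i).map D.concl) =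
      premL L fun k => ⟨l, Λ ∪ same ⟨v, β⟩ ⟨v, β.next⟩, P k, ⟨v, β.next, A k⟩, t⟩)
    (h : Inv S.n om₀ ⟨l, Λ, .caseR L P, ⟨v, β, .wth L A⟩, t⟩ s.depth s.c s.om) :
    BlockSpec S V D om₀ s (block S D s) := by
  have h₀ : ∀ k : L, (D.prem s.node k).map D.concl =
      some ⟨l, Λ ∪ same ⟨v, β⟩ ⟨v, β.next⟩, P k, ⟨v, β.next, A k⟩, t⟩ := fun k =>
    (congrFun hp k).trans (dif_pos k.2)
  have h1 := h.cfgStep (links_unfLt (S.n + 2) _ _)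
  have h2 := fun k => h1.advanceRight (A k) (Q := P k) (Mirror.same_unfEq S.n ⟨v, β⟩)
  obtain ⟨k, -, hc⟩ := h1.c_name
  simp only [block, hj, dif_pos]
  refine ⟨⟨⟨?_, ?_⟩, ⟨h1.distinct, .muR (progF_mem .wth)⟩, ⟨h1.distinct, .wthR⟩, fun k =>
    ⟨⟨h1.distinct, .wthL k⟩,
    sound_fromRight (h2 k).ctx hc rfl (h2 k).used (kid_concl (h₀ k))
      (sound_kid (h₀ k) (h2 k).deeper)⟩⟩,
    exists_leaf_of_premL hp (Set.iUnion_congr fun _ => Set.empty_union _)⟩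
  · simp only [starOf, hj]; exact h.distinct
  · simp only [starOf, hj]; exact .muL (cfgF_mem .caseR)

theorem blockSpec_call {X : ℕ}
    (hj : D.concl s.node = ⟨l, Λ, .call X, y, t⟩) (hX : X ∈ V.dom)
    (hl : l.map Ep.ty = V.left X) (hr : y.ty = V.right X)
    (hp : (fun i => (D.prem s.node i).map D.concl) = prem1 ⟨l, Λ, V.body X, y, t⟩)
    (h : Inv S.n om₀ ⟨l, Λ, .call X, y, t⟩ s.depth s.c s.om) :
    BlockSpec S V D om₀ s (block S D s) := by
  have h₀ := congrFun hp 0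
  have h1 := h.cfgStep (links_unfEq (S.n + 1) _ _)
  simp only [block, hj]
  refine ⟨⟨⟨?_, ?_⟩, sound_kid h₀ h1.proc.deeper⟩, exists_leaf_of_prem1 hp rfl⟩
  · simp only [starOf, hj]; exact h.distinct
  · rw [kid_concl h₀]
    simp only [starOf, hj]
    refine .nuL (cfgF_mem (.call hX ?_ hr))
    rw [← hl]; cases l <;> rfl

theorem blockSpec_id {v x : ℕ} {α β : Gen} {A : Ty}
    (hj : D.concl s.node = ⟨some ⟨x, α, A⟩, Λ, .fwd, ⟨v, β, A⟩, t⟩)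
    (hp : (fun i => (D.prem s.node i).map D.concl) = noPrem)
    (h : Inv S.n om₀ ⟨some ⟨x, α, A⟩, Λ, .fwd, ⟨v, β, A⟩, t⟩ s.depth s.c s.om) :
    BlockSpec S V D om₀ s (block S D s) := by
  have h1 := h.cfgStep (links_unfLt (S.n + 2) _ _)
  refine ⟨?_, fun u hu => ?_⟩
  · simp only [block, hj]
    split
    · rename_i hm
      simp only [hj] at hm
      refine ⟨⟨?_, ?_⟩, ⟨h1.distinct, .eqL _ hm.choose_spec⟩,
        ⟨(ctx_singleton rfl (h.wf.1 _ rfl)).distinct rfl, ?_⟩⟩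
      · simp only [starOf, hj]; exact h.distinct
      · simp only [starOf, hj]; exact .muL (cfgF_mem .fwd)
      · obtain ⟨e₁, e₂⟩ := Term.gch.inj hm.choose_spec.1.2
        -- the unifier identifies the two progress predicates, as the types are equal
        have e : ((Ep.mk x α A).progA.2).subst hm.choose =
            ((Ep.mk v β A).progA.2).subst hm.choose := by
          simp only [Ep.progA, progF, progArgs, TEp.args, Form.subst, List.map]
          exact congrArg₂ (fun a b => Form.atom .prog [a, b, .ty A]) e₁ e₂
        rw [← e]
        exact LRule.id
    · rename_i hm
      simp only [hj] at hm
      refine ⟨⟨?_, ?_⟩, ⟨h1.distinct, .eqLnone fun hu => hm (exists_isMGU hu)⟩⟩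
      · simp only [starOf, hj]; exact h.distinct
      · simp only [starOf, hj]; exact .muL (cfgF_mem .fwd)
  · obtain ⟨i, hi, -⟩ := step_iff_of_prem hp hu
    cases hi

theorem blockSpec_oneR {v : ℕ} {β : Gen}
    (hj : D.concl s.node = ⟨none, Λ, .close, ⟨v, β, .one⟩, t⟩)
    (hp : (fun i => (D.prem s.node i).map D.concl) = noPrem)
    (h : Inv S.n om₀ ⟨none, Λ, .close, ⟨v, β, .one⟩, t⟩ s.depth s.c s.om) :
    BlockSpec S V D om₀ s (block S D s) := by
  have h1 := h.cfgStep (links_unfLt (S.n + 2) _ _)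
  obtain ⟨k, -, hc⟩ := h1.c_name
  have hv : NameUsed t s.depth (.ch v) := (h.wf.2 _ mem_vars_right).1
  refine ⟨?_, fun u hu => ?_⟩
  · simp only [block, hj]
    refine ⟨⟨?_, ?_⟩, ⟨h1.distinct, .muR (progF_mem .one)⟩,
      sound_toRight h1.ctx hc rfl (used_union h1.used (links_unfEq _ _ _) hv hv) rfl
      ⟨⟨h1.distinct, .muR ⟨none, rfl, .emp⟩⟩, ⟨h1.distinct, .oneL⟩,
        ⟨Ctx.distinct (.inl rfl) rfl, .oneR⟩⟩⟩
    · simp only [starOf, hj]; exact h.distinct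
    · simp only [starOf, hj]; exact .muL (cfgF_mem .close)
  · obtain ⟨i, hi, -⟩ := step_iff_of_prem hp hu
    cases hi

theorem blockSpec_oneL {x : ℕ} {α : Gen} {Q : Proc}
    (hj : D.concl s.node = ⟨some ⟨x, α, .one⟩, Λ, .wait Q, y, t⟩)
    (hp : (fun i => (D.prem s.node i).map D.concl) = prem1 ⟨none, Λ, Q, y, t⟩)
    (h : Inv S.n om₀ ⟨some ⟨x, α, .one⟩, Λ, .wait Q, y, t⟩ s.depth s.c s.om) :
    BlockSpec S V D om₀ s (block S D s) := by
  have h₀ := congrFun hp 0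
  let a : GV ℕ := ⟨x, α⟩
  have hne : a.name ≠ y.ch := h.wf.1 _ rfl
  have hs : .chan a.name ∈ t := (h.wf.2 a mem_vars_left).1
  have h1 := h.cfgStep (links_unfLt (S.n + 2) _ _)
  have hX : ∀ b ∈ relVars (s.om ∪ unfLt (S.n + 2) s.c.next s.c), NotLater (lift a) b :=
    fun b hb => (h1.vars b hb).2.1 a mem_vars_left
  -- `[x^α : 1]` and then `[· : ·]` are unfolded, each time to a later generation of `x`
  have h2 := (h1.dropLeft.proc (Q := Q)).closedStep hne hs (next_notMem (a := lift a) hX)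
    (links_unfLt (S.n + 2) _ _)
  have h3 := h2.msgStep (links_same _ (lift a.next)) (.inr ⟨a.next, hs, rfl, by
    rintro b (⟨_, h, rfl⟩ | rfl)
    · cases h
    · exact notLater_of_name hne.symm⟩)
  have hX' : ∀ b ∈ relVars (s.om ∪ unfLt (S.n + 2) s.c.next s.c ∪
      unfLt (S.n + 2) (lift a.next) (lift a) ∪ same (freshL s.depth) (lift a.next)),
      NotLater (lift a.next) b := by
    intro b hb
    rw [relVars_union, relVars_union] at hb
    rcases hb with (hb | hb) | hb
    · exact (hX b hb).next
    · rcases (links_unfLt _ _ _).relVars hb with rfl | rfl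
      exacts [notLater_refl _, notLater_next_self (lift a)]
    · rcases (links_same _ _).relVars hb with rfl | rfl
      exacts [notLater_of_name (by simp [lift, freshL]), notLater_refl _]
  have h4 := h3.closedStep (a := a.next) hne hs (next_notMem (a := lift a.next) hX')
    (links_unfLt (S.n + 2) _ _)
  obtain ⟨k, -, hc⟩ := h1.c_name
  simp only [block, hj]
  refine ⟨⟨⟨?_, ?_⟩, ⟨h1.distinct, .muL_snd (progF_mem .one)⟩,
    sound_fromLeft rfl hne hc rfl h2.used rfl
      ⟨⟨(ctx_singleton rfl hne).distinct_cons hc rfl, .muL_snd ⟨none, rfl, .emp⟩⟩,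
        ⟨(ctx_singleton rfl hne).distinct_cons hc rfl, ?_⟩, sound_kid h₀ h4⟩⟩,
    exists_leaf_of_prem1 hp (Set.empty_union _)⟩
  · simp only [starOf, hj]; exact h.distinct
  · simp only [starOf, hj]; exact .muL (cfgF_mem .wait)
  · rw [kid_concl h₀]
    exact .oneL_snd

theorem ep_notOcc {e : Ep} (h : .chan e.ch ∈ t ∧ ∀ g, e.gen.base = some g → .gen g ∈ t) {v : Var}
    (hv : v ∉ t) : ¬ e.toT.nm.Occ v ∧ ¬ e.toT.gen.Occ v := by
  refine ⟨fun ho => hv ?_, fun ho => hv ?_⟩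
  · obtain rfl : Var.chan e.ch = v := ho
    exact h.1
  · obtain ⟨g, hb, rfl⟩ := genTerm_occ ho
    exact h.2 g hb

theorem progF_notOcc {e : TEp} {v : Var} (h : ¬ e.nm.Occ v ∧ ¬ e.gen.Occ v) :
    ¬ (progF (some e)).Occ v := by
  simp [progF, progArgs, TEp.args, Form.Occ, h, Term.Occ]

/-- The matrix of the definition of `Cfg` for spawning, at the channel `nm` of generation `gn`. -/
def spawnBody (l : Option TEp) (r : TEp) (A : Ty) (C₁ C₂ : Conf) (nm gn : Term) : Form :=
  .tens (cfgF l ⟨nm, gn, A⟩ C₁) (cfgF (some ⟨nm, gn, A⟩) r C₂)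

theorem spawnBody_notOcc {l : Option TEp} {r : TEp} {A : Ty} {C₁ C₂ : Conf} {nm gn : Term} {v : Var}
    (hl : ∀ e, l = some e → ¬ e.nm.Occ v ∧ ¬ e.gen.Occ v) (hr : ¬ r.nm.Occ v ∧ ¬ r.gen.Occ v)
    (hn : ¬ nm.Occ v) (hg : ¬ gn.Occ v) : ¬ (spawnBody l r A C₁ C₂ nm gn).Occ v := by
  cases l with
  | none => simp [spawnBody, cfgF, cfgArgs, progArgs, TEp.args, Form.Occ, Term.Occ, hr, hn, hg]
  | some e =>
    simp [spawnBody, cfgF, cfgArgs, progArgs, TEp.args, Form.Occ, Term.Occ, hr, hn, hg, hl e rfl]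

theorem spawnBody_opn (l : Option Ep) (r : Ep) (A : Ty) (C₁ C₂ : Conf) (nm gn : Term) (k : ℕ)
    (u : Term) : (spawnBody (l.map Ep.toT) r.toT A C₁ C₂ nm gn).opn k u =
      spawnBody (l.map Ep.toT) r.toT A C₁ C₂ (Term.opn k u nm) (Term.opn k u gn) := by
  cases l <;>
    simp [spawnBody, cfgF, cfgArgs, progArgs, TEp.args, Form.opn, Term.opn, Ep.toT, genTerm_opn]

theorem blockSpec_cut {A : Ty} {P Q : Proc} {w g : ℕ}
    (hj : D.concl s.node = ⟨l, Λ, .cut A P Q, y, t⟩) (hw : .chan w ∉ t) (hg : .gen g ∉ t)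
    (hp : (fun i => (D.prem s.node i).map D.concl) =
      prem2 ⟨l, Λ, P, ⟨w, ⟨some g, 0⟩, A⟩, insert (.chan w) (insert (.gen g) t)⟩
          ⟨some ⟨w, ⟨some g, 0⟩, A⟩, Λ, Q, y, insert (.chan w) (insert (.gen g) t)⟩)
    (h : Inv S.n om₀ ⟨l, Λ, .cut A P Q, y, t⟩ s.depth s.c s.om) :
    BlockSpec S V D om₀ s (block S D s) := by
  have h₀ := congrFun hp 0
  have h₁ := congrFun hp 1
  obtain ⟨u₀, hu₀, hc₀⟩ := Option.map_eq_some_iff.1 h₀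
  obtain ⟨k, hk, hc⟩ := h.c_name
  have hc' : s.c.next.name = .cfg k := hc
  have h1 := h.cfgStep (links_unfLt (S.n + 2) _ _)
  have hwl : ∀ e, l = some e → e.ch ≠ w := by
    rintro e rfl rfl
    exact hw (h.wf.2 _ mem_vars_left).1
  have hwy : w ≠ y.ch := by
    rintro rfl
    exact hw (h.wf.2 _ mem_vars_right).1
  have hP := h1.spawn (l' := l) (y' := ⟨w, ⟨some g, 0⟩, A⟩) (Q := P) (A := A) (g := g) hw hwl (by
    rintro b (⟨e, he, rfl⟩ | rfl)
    · exact .inr (.inl ⟨e, he, rfl⟩)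
    · exact .inl rfl) (.inr rfl)
  have hQ := h1.spawn (l' := some ⟨w, ⟨some g, 0⟩, A⟩) (y' := y) (Q := Q) (A := A) (g := g) hw
    (by rintro _ ⟨⟩; exact hwy) (by
    rintro b (⟨e, he, rfl⟩ | rfl)
    · cases he; exact .inl rfl
    · exact .inr (.inr rfl)) (.inl rfl)
  have hl : ∀ e, l = some e → ∀ v ∉ t, ¬ e.toT.nm.Occ v ∧ ¬ e.toT.gen.Occ v := by
    rintro e rfl v hv
    exact ep_notOcc (h.wf.2 _ mem_vars_left) hv
  have hr : ∀ v ∉ t, ¬ y.toT.nm.Occ v ∧ ¬ y.toT.gen.Occ v := fun v hv =>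
    ep_notOcc (h.wf.2 _ mem_vars_right) hv
  -- the spawned channel and its generation are eigenvariables: they do not occur in the sequent
  let Λ' := s.om ∪ unfLt (S.n + 2) s.c.next s.c
  let body := spawnBody (l.map Ep.toT) y.toT A (.proc P) (.proc Q)
  have hfv : ∀ {nm gn : Term} {F : Form} {Ω : Set (Rel PN)} {v : Var}, v ∉ t → ¬ nm.Occ v →
      ¬ gn.Occ v → (F.Occ v ↔ (body nm gn).Occ v) →
      Seq.FreshVar ⟨(s.c.next, F) ::ₘ leftA l, Ω, y.progA⟩ v := by
    intro nm gn F Ω v hv hnm hgn hF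
    refine ⟨fun p hp => ?_, progF_notOcc (hr v hv)⟩
    rcases Multiset.mem_cons.1 hp with rfl | hp
    · rw [hF]
      exact spawnBody_notOcc (fun e he => by
        obtain ⟨e', he', rfl⟩ := Option.map_eq_some_iff.1 he
        exact hl e' he' v hv) (hr v hv) hnm hgn
    · cases l with
      | none => simp [leftA] at hp
      | some e =>
        obtain rfl := Multiset.mem_singleton.1 hp
        exact progF_notOcc (hl e rfl v hv)
  simp only [block, hj, hu₀, Option.elim_some, hc₀]
  refine ⟨⟨⟨?_, ?_⟩, ⟨h1.distinct, ?_⟩, ⟨h1.distinct, ?_⟩, ⟨h1.distinct, .tensL ?_⟩,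
    ⟨h.ctx.distinct_spawn hc' rfl hk, ?_⟩, sound_kid h₀ hP, sound_kid h₁ hQ⟩, ?_⟩
  · simp only [starOf, hj]; exact h.distinct
  · simp only [starOf, hj]; exact .muL (cfgF_mem .cut)
  · have := LRule.exL (Sg := stSig S V) (A := .ex (body (.bv 1) (.bv 0))) (.chan w)
      (hfv (Ω := Λ') hw (nm := .bv 1) (gn := .bv 0) id id Iff.rfl)
    rw [show (Form.ex (body (.bv 1) (.bv 0))).opn 0 (.fv (.chan w)) =
      .ex (body (.fv (.chan w)) (.bv 0)) from congrArg Form.ex (spawnBody_opn l y A _ _ _ _ _ _)]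
      at this
    exact this
  · have := LRule.exL (Sg := stSig S V) (A := body (.fv (.chan w)) (.bv 0)) (.gen g)
      (hfv (Ω := Λ') hg (nm := .fv (.chan w)) (gn := .bv 0) (by rintro ⟨⟩) id Iff.rfl)
    rw [show (body (.fv (.chan w)) (.bv 0)).opn 0 (.fv (.gen g)) =
      body (.fv (.chan w)) (.fv (.gen g)) from spawnBody_opn l y A _ _ _ _ _ _] at this
    exact this
  · refine Seq.freshName_of (fun p hp => ?_) (by simp [lift, freshC]) fun b hb =>
      name_ne_of_used (h1.used b hb) (Nat.not_succ_le_self s.depth)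
    rcases Multiset.mem_cons.1 hp with rfl | hp
    · have : k ≠ s.depth + 1 := by omega
      simp [hc', freshC, this]
    · obtain ⟨x, hx⟩ := h.ctx.name hp
      simp [hx, freshC]
  · rw [kid_concl h₀, kid_concl h₁]
    have hf : Seq.FreshName ⟨(freshC s.depth, procF l ⟨w, ⟨some g, 0⟩, A⟩ P) ::ₘ leftA l +
        {(s.c.next, procF (some ⟨w, ⟨some g, 0⟩, A⟩) y Q)}, Λ' ∪ same (freshC s.depth) s.c.next,
        (y.progA.1, y.progA.2)⟩ (.ch w) := by
      refine Seq.freshName_of (fun p hp => ?_) (by simp [Ep.progA, lift, Ep.gv, hwy.symm])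
        fun b hb => ?_
      · rcases Multiset.mem_add.1 hp with hp | hp
        · rcases Multiset.mem_cons.1 hp with rfl | hp
          · simp [freshC]
          · cases l with
            | none => simp [leftA] at hp
            | some e =>
              obtain rfl := Multiset.mem_singleton.1 hp
              simp [Ep.progA, lift, Ep.gv, hwl e rfl]
        · obtain rfl := Multiset.mem_singleton.1 hp
          simp [hc']
      · rw [relVars_union] at hb
        rcases hb with hb | hb
        · exact h1.notMem_ch hw hb
        · rcases (links_same _ _).relVars hb with rfl | rfl
          exacts [by simp [freshC], by simp [hc']]
    have := LRule.cut (Sg := stSig S V) (w := lift (Ep.mk w ⟨some g, 0⟩ A).gv)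
      (A := progF (some (Ep.mk w ⟨some g, 0⟩ A).toT)) hf
    rw [Multiset.cons_add, add_comm (leftA l), Multiset.singleton_add, cons_singleton_comm] at this
    exact this
  · intro u hu
    obtain ⟨i, hi, hu⟩ := step_iff_of_prem hp hu
    by_cases h0 : i = 0
    · subst h0
      obtain ⟨s', hs', e⟩ := hu (freshC s.depth) (Λ' ∪ same (freshC s.depth) s.c.next)
      exact ⟨s', .inl hs', e⟩
    · obtain rfl : i = 1 := by by_contra h; simp [prem2, h0, h] at hi
      obtain ⟨s', hs', e⟩ := hu s.c.next (Λ' ∪ same (freshC s.depth) s.c.next)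
      exact ⟨s', .inr hs', e⟩

/-- The blocks for well-typed processes are correct. -/
theorem blockSpec (hr : PRule S V (D.concl s.node) fun i => (D.prem s.node i).map D.concl)
    (h : Inv S.n om₀ (D.concl s.node) s.depth s.c s.om) :
    BlockSpec S V D om₀ s (block S D s) := by
  generalize hj : D.concl s.node = j at hr h
  generalize hp : (fun i => (D.prem s.node i).map D.concl) = ps at hr
  cases hr with
  | id => exact blockSpec_id hj hp h
  | cut hw hg => exact blockSpec_cut hj hw hg hp h
  | oneR => exact blockSpec_oneR hj hp h
  | oneL => exact blockSpec_oneL hj hp h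
  | plusR hk => exact blockSpec_plusR hj hk hp h
  | plusL => exact blockSpec_plusL hj hp h
  | wthR => exact blockSpec_wthR hj hp h
  | wthL hk => exact blockSpec_wthL hj hk hp h
  | muR hT hk => exact blockSpec_muR hj hT hk hp h
  | muL hT hk => exact blockSpec_muL hj hT hk hp h
  | nuR hT hk => exact blockSpec_nuR hj hT hk hp h
  | nuL hT hk => exact blockSpec_nuL hj hT hk hp h
  | call hX hl hr => exact blockSpec_call hj hX hl hr hp h

end Block

/-! ### The built derivation -/

section Stack
variable {S : TySig} {V : Defs} {D : Graph PJ} {η : Gen} {Ω : Set (Rel PN)} {om₀ : Set (Rel ℕ)}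

theorem Sound.mono {P P' : St D.Node → Prop} (h : ∀ s, P s → P' s) {t : Blk (St D.Node)}
    (ht : Sound S V D P t) : Sound S V D P' t := by
  induction t with
  | leaf s => exact h s ht
  | ax q => exact ht
  | un q t ih => exact ⟨ht.1, ih ht.2⟩
  | bin q t₁ t₂ ih₁ ih₂ => exact ⟨ht.1, ih₁ ht.2.1, ih₂ ht.2.2⟩
  | fam q L t ih => exact ⟨ht.1, fun l => ih l (ht.2 l)⟩

theorem Sound.leaves {P : St D.Node → Prop} {t : Blk (St D.Node)} (ht : Sound S V D P t)
    {s : St D.Node} (hs : s ∈ t.leaves) : P s := by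
  induction t with
  | leaf s' => obtain rfl : s = s' := hs; exact ht
  | ax q => exact hs.elim
  | un q t ih => exact ih ht.2 hs
  | bin q t₁ t₂ ih₁ ih₂ => exact hs.elim (ih₁ ht.2.1) (ih₂ ht.2.2)
  | fam q L t ih =>
    obtain ⟨l, hl⟩ := Set.mem_iUnion.1 hs
    exact ih l (ht.2 l) hl

theorem build_concl (t : Blk (St D.Node)) : (build S D η Ω).concl t = t.concl D := by
  cases t with
  | leaf s => exact (block_concl S D s).2
  | _ => rfl

theorem GoalInv.block (hD : D.IsDerivation (PRule S V)) {s : St D.Node} (h : GoalInv S D om₀ s) :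
    BlockSpec S V D om₀ s (block S D s) := blockSpec (hD s.node h.1) h.2

/-- Unfolding an open goal to its block. -/
theorem Sound.force (hD : D.IsDerivation (PRule S V)) {t : Blk (St D.Node)}
    (h : Sound S V D (GoalInv S D om₀) t) :
    Sound S V D (GoalInv S D om₀) (force S D t) ∧ (∀ a, SP.force S D t ≠ .leaf a) ∧
      (SP.force S D t).concl D = t.concl D := by
  cases t with
  | leaf s =>
    have h : GoalInv S D om₀ s := h
    refine ⟨(h.block hD).1.mono fun s' hs' => ?_, block_concl S D s⟩
    exact ⟨h.1.tail hs'.1, hs'.2⟩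
  | _ => exact ⟨h, fun _ h => (by cases h), rfl⟩

theorem prem1_map {J J' : Type} (f : J → J') (a : J) :
    (fun i => (prem1 a i).map f) = prem1 (f a) := by
  funext i; simp only [prem1]; split <;> rfl

theorem prem2_map {J J' : Type} (f : J → J') (a b : J) :
    (fun i => (prem2 a b i).map f) = prem2 (f a) (f b) := by
  funext i; simp only [prem2]; split
  · rfl
  · split <;> rfl

theorem premL_map {J J' : Type} (f : J → J') (L : Finset ℕ) (a : L → J) :
    (fun i => (premL L a i).map f) = premL L fun l => f (a l) := by
  funext i; simp only [premL]; split <;> rfl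

theorem build_prem (t : Blk (St D.Node)) : (build S D η Ω).prem t =
    match force S D t with
    | .leaf _ => noPrem
    | .ax _ => noPrem
    | .un _ t => prem1 t
    | .bin _ t₁ t₂ => prem2 t₁ t₂
    | .fam _ L t => premL L t := rfl

theorem step_of_prem1 {t t' : Blk (St D.Node)} {q} (h : force S D t = .un q t') :
    (build S D η Ω).Step t t' := ⟨0, by rw [build_prem, h]; rfl⟩

theorem step_of_prem2_left {t t₁ t₂ : Blk (St D.Node)} {q} (h : force S D t = .bin q t₁ t₂) :
    (build S D η Ω).Step t t₁ := ⟨0, by rw [build_prem, h]; rfl⟩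

theorem step_of_prem2_right {t t₁ t₂ : Blk (St D.Node)} {q} (h : force S D t = .bin q t₁ t₂) :
    (build S D η Ω).Step t t₂ := ⟨1, by rw [build_prem, h]; rfl⟩

theorem step_of_premL {t : Blk (St D.Node)} {L : Finset ℕ} {t' : L → Blk (St D.Node)} {q}
    (h : force S D t = .fam q L t') (l : L) : (build S D η Ω).Step t (t' l) :=
  ⟨l, by rw [build_prem, h]; exact dif_pos l.2⟩

/-- The immediate subtrees of a block. -/
def Blk.IsChild {α : Type} (t' : Blk α) : Blk α → Prop
  | .leaf _ => False
  | .ax _ => False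
  | .un _ t => t' = t
  | .bin _ t₁ t₂ => t' = t₁ ∨ t' = t₂
  | .fam _ _ t => ∃ l, t' = t l

theorem isChild_of_step {t t' : Blk (St D.Node)} (h : (build S D η Ω).Step t t') :
    t'.IsChild (force S D t) := by
  obtain ⟨i, hi⟩ := h
  rw [build_prem] at hi
  cases hf : force S D t with
  | leaf s => rw [hf] at hi; cases hi
  | ax q => rw [hf] at hi; cases hi
  | un q t =>
    rw [hf] at hi
    simp only [prem1] at hi
    split at hi <;> cases hi
    rfl
  | bin q t₁ t₂ =>
    rw [hf] at hi
    simp only [prem2] at hi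
    split at hi
    · cases hi; exact .inl rfl
    · split at hi <;> cases hi
      exact .inr rfl
  | fam q L t =>
    rw [hf] at hi
    simp only [premL] at hi
    split at hi <;> cases hi
    exact ⟨_, rfl⟩

theorem Sound.child {P : St D.Node → Prop} {t t' : Blk (St D.Node)} (h : Sound S V D P t)
    (hc : t'.IsChild t) : Sound S V D P t' := by
  cases t with
  | leaf => exact hc.elim
  | ax => exact hc.elim
  | un => cases hc; exact h.2
  | bin => rcases hc with rfl | rfl; exacts [h.2.1, h.2.2]
  | fam => obtain ⟨l, rfl⟩ := hc; exact h.2 l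

theorem leaves_child {α : Type} {t t' : Blk α} (hc : t'.IsChild t) : t'.leaves ⊆ t.leaves := by
  cases t with
  | leaf => exact hc.elim
  | ax => exact hc.elim
  | un => cases hc; exact subset_rfl
  | bin =>
    rcases hc with rfl | rfl
    exacts [Set.subset_union_left, Set.subset_union_right]
  | fam => obtain ⟨l, rfl⟩ := hc; exact Set.subset_iUnion_of_subset l subset_rfl

/-- The initial goal of the construction. -/
def rootGoal (D : Graph PJ) (η : Gen) (Ω : Set (Rel PN)) : St D.Node := ⟨D.root, 0, ⟨.cfg 0, η⟩, Ω⟩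

theorem sound_of_reach (hD : D.IsDerivation (PRule S V)) (h : GoalInv S D om₀ (rootGoal D η Ω))
    {t : Blk (St D.Node)} (ht : (build S D η Ω).Reach t) : Sound S V D (GoalInv S D om₀) t := by
  induction ht with
  | refl => exact h
  | tail _ hs ih => exact (ih.force hD).1.child (isChild_of_step hs)

theorem build_isDerivation (hD : D.IsDerivation (PRule S V))
    (h : GoalInv S D om₀ (rootGoal D η Ω)) :
    (build S D η Ω).IsDerivation (LStep (stSig S V)) := by
  have hconcl : (build S D η Ω).concl = Blk.concl D := funext build_concl
  suffices key : ∀ t : Blk (St D.Node), (build S D η Ω).Reach t → LStep (stSig S V) (t.concl D)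
      fun i => ((build S D η Ω).prem t i).map (Blk.concl D) by
    intro t ht
    rw [hconcl]
    exact key t ht
  intro t ht
  obtain ⟨hs, hl, hc⟩ := (sound_of_reach hD h ht).force hD
  rw [← hc, build_prem]
  cases hf : force S D t with
  | leaf s => exact (hl s hf).elim
  | ax q => rw [hf] at hs; exact hs
  | un q t => rw [hf] at hs; exact (congrArg (LStep _ q) (prem1_map (Blk.concl D) t)).mpr hs.1
  | bin q t₁ t₂ => rw [hf] at hs; exact (congrArg (LStep _ q) (prem2_map (Blk.concl D) t₁ t₂)).mpr hs.1
  | fam q L t => rw [hf] at hs; exact (congrArg (LStep _ q) (premL_map (Blk.concl D) L t)).mpr hs.1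

theorem reach_leaf {t : Blk (St D.Node)} (ht : (build S D η Ω).Reach t) {s : St D.Node}
    (hs : s ∈ t.leaves) : (build S D η Ω).Reach (.leaf s) := by
  induction t with
  | leaf s' => obtain rfl : s = s' := hs; exact ht
  | ax q => exact hs.elim
  | un q t ih => exact ih (ht.tail (step_of_prem1 rfl)) hs
  | bin q t₁ t₂ ih₁ ih₂ =>
    exact hs.elim (ih₁ (ht.tail (step_of_prem2_left rfl))) (ih₂ (ht.tail (step_of_prem2_right rfl)))
  | fam q L t ih =>
    obtain ⟨l, hl⟩ := Set.mem_iUnion.1 hs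
    exact ih l (ht.tail (step_of_premL rfl l)) hl

theorem reach_block {s s' : St D.Node} (hr : (build S D η Ω).Reach (.leaf s))
    (hs : s' ∈ (block S D s).leaves) : (build S D η Ω).Reach (.leaf s') := by
  have hl := (block_concl S D s).1
  have hf : force S D (.leaf s) = block S D s := rfl
  cases hb : block S D s with
  | leaf a => exact (hl a hb).elim
  | ax q => rw [hb] at hs; exact hs.elim
  | un q t =>
    rw [hb] at hs hf
    exact reach_leaf (hr.tail (step_of_prem1 hf)) hs
  | bin q t₁ t₂ =>
    rw [hb] at hs hf
    rcases hs with hs | hs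
    exacts [reach_leaf (hr.tail (step_of_prem2_left hf)) hs,
      reach_leaf (hr.tail (step_of_prem2_right hf)) hs]
  | fam q L t =>
    rw [hb] at hs hf
    obtain ⟨l, hl⟩ := Set.mem_iUnion.1 hs
    exact reach_leaf (hr.tail (step_of_premL hf l)) hl

theorem goalInv_of_reach (hD : D.IsDerivation (PRule S V)) (h : GoalInv S D om₀ (rootGoal D η Ω))
    {s : St D.Node} (hr : (build S D η Ω).Reach (.leaf s)) : GoalInv S D om₀ s :=
  sound_of_reach hD h hr

theorem nodeR_leaf (hD : D.IsDerivation (PRule S V)) (h : GoalInv S D om₀ (rootGoal D η Ω))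
    {s : St D.Node} (hr : (build S D η Ω).Reach (.leaf s)) :
    NodeR S D η Ω s.node (.leaf s) :=
  ⟨hr, ⟨s, rfl, rfl⟩, s.c, s.om, build_concl _, (goalInv_of_reach hD h hr).2.agree⟩

theorem nodeR_isBisim (hD : D.IsDerivation (PRule S V)) (h : GoalInv S D om₀ (rootGoal D η Ω)) :
    IsBisim D.Step (StarStep S D) (NodeR S D η Ω) := by
  rintro _ _ ⟨hr, ⟨s, rfl, rfl⟩, -⟩
  have hb := (goalInv_of_reach hD h hr).block hD
  constructor
  · intro u' hu
    obtain ⟨s', hs', rfl⟩ := hb.2 u' hu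
    exact ⟨.leaf s', ⟨s, s', rfl, rfl, hs'⟩, nodeR_leaf hD h (reach_block hr hs')⟩
  · rintro _ ⟨_, s', ⟨⟩, rfl, hs'⟩
    exact ⟨s'.node, (hb.1.leaves hs').1, nodeR_leaf hD h (reach_block hr hs')⟩

/-! ### Infinite branches -/

section Branch
variable {b : ℕ → Blk (St D.Node)} (hb : ∀ k, (build S D η Ω).Step (b k) (b (k + 1)))
include hb

/-- Blocks are finite: an infinite branch leaves each of them through an open leaf. -/
theorem exists_leaf_ge (t : Blk (St D.Node)) : ∀ k, b k = t →
    ∃ m ≥ k, ∃ s' ∈ t.leaves, b m = .leaf s' := by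
  induction t with
  | leaf s => exact fun k hk => ⟨k, le_rfl, s, rfl, hk⟩
  | ax q =>
    intro k hk
    have hc : (b (k + 1)).IsChild (force S D (.ax q)) := isChild_of_step (hk ▸ hb k)
    exact hc.elim
  | un q t ih =>
    intro k hk
    have hc : (b (k + 1)).IsChild (force S D (.un q t)) := isChild_of_step (hk ▸ hb k)
    obtain ⟨m, hm, r⟩ := ih (k + 1) hc
    exact ⟨m, by omega, r⟩
  | bin q t₁ t₂ ih₁ ih₂ =>
    intro k hk
    have hc : (b (k + 1)).IsChild (force S D (.bin q t₁ t₂)) := isChild_of_step (hk ▸ hb k)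
    rcases hc with h | h
    · obtain ⟨m, hm, s', hs', e⟩ := ih₁ (k + 1) h
      exact ⟨m, by omega, s', .inl hs', e⟩
    · obtain ⟨m, hm, s', hs', e⟩ := ih₂ (k + 1) h
      exact ⟨m, by omega, s', .inr hs', e⟩
  | fam q L t ih =>
    intro k hk
    have hc : (b (k + 1)).IsChild (force S D (.fam q L t)) := isChild_of_step (hk ▸ hb k)
    obtain ⟨l, h⟩ := hc
    obtain ⟨m, hm, s', hs', e⟩ := ih l (k + 1) h
    exact ⟨m, by omega, s', Set.mem_iUnion.2 ⟨l, hs'⟩, e⟩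

theorem exists_goal_gt {k : ℕ} {s : St D.Node} (hk : b k = .leaf s) :
    ∃ m > k, ∃ s' ∈ (block S D s).leaves, b m = .leaf s' := by
  have hc : (b (k + 1)).IsChild (block S D s) := isChild_of_step (hk ▸ hb k)
  obtain ⟨m, hm, s', hs', e⟩ := exists_leaf_ge hb _ (k + 1) rfl
  exact ⟨m, hm, s', leaves_child hc hs', e⟩

/-- The open goals that an infinite branch passes through. -/
theorem exists_goals {s₀ : St D.Node} (h0 : b 0 = .leaf s₀) :
    ∃ (p : ℕ → ℕ) (σ : ℕ → St D.Node), StrictMono p ∧ σ 0 = s₀ ∧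
      (∀ k, b (p k) = .leaf (σ k)) ∧ ∀ k, σ (k + 1) ∈ (block S D (σ k)).leaves := by
  choose! m hm s' hs' e using fun (k : ℕ) (s : St D.Node) (hk : b k = .leaf s) =>
    exists_goal_gt hb hk
  let q : ℕ → ℕ × St D.Node := fun k => Nat.rec (0, s₀) (fun _ r => (m r.1 r.2, s' r.1 r.2)) k
  have hq : ∀ k, b (q k).1 = .leaf (q k).2 := by
    intro k
    induction k with
    | zero => exact h0
    | succ k ih => exact e _ _ ih
  exact ⟨fun k => (q k).1, fun k => (q k).2, strictMono_nat_of_lt_succ fun k => hm _ _ (hq k), rfl,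
    hq, fun k => hs' _ _ (hq k)⟩

end Branch

theorem reach_of_branch {J : Type} {G : Graph J} {b : ℕ → G.Node} (hb : G.IsBranch b) (k : ℕ) :
    G.Reach (b k) := by
  induction k with
  | zero => rw [hb.1]; exact .refl
  | succ k ih => exact ih.tail (hb.2 k)

/-- A trace on the branch of the typing derivation that follows the goals of an infinite branch is
also a trace on that branch. -/
theorem isTrace_lift (hD : D.IsDerivation (PRule S V)) (h : GoalInv S D ∅ (rootGoal D η Ω))
    {b : ℕ → Blk (St D.Node)} (hb : (build S D η Ω).IsBranch b) {p : ℕ → ℕ} {σ : ℕ → St D.Node}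
    (hp : StrictMono p) (hσ : ∀ k, b (p k) = .leaf (σ k)) {vars : PJ → Set (GV ℕ)}
    {vars' : Seq → Set (GV PN)}
    (hv : ∀ s : St D.Node, ∀ a ∈ vars (D.concl s.node), lift a ∈ vars' (starOf D s))
    (ht : D.IsTrace S.n PJ.om vars fun k => (σ k).node) :
    (build S D η Ω).IsTrace (S.n + 2) Seq.om vars' b := by
  obtain ⟨f, x, hf, hx, hs⟩ := ht
  have hc : ∀ k, (build S D η Ω).concl (b (p k)) = starOf D (σ k) := fun k => by
    rw [hσ, build_concl]; rfl
  refine ⟨p ∘ f, lift ∘ x, hp.comp hf, fun k => ?_, fun k => ?_⟩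
  · simp only [Function.comp, hc]
    exact hv _ _ (hx k)
  · simp only [Function.comp, hc]
    exact (goalInv_of_reach hD h (hσ _ ▸ reach_of_branch hb _)).2.mirrored.snapLt
      (Nat.le_add_right _ _) (hs k)

theorem lift_mem_leftVars (s : St D.Node) :
    ∀ a ∈ (D.concl s.node).leftVars, lift a ∈ (starOf D s).leftVars := by
  rintro _ ⟨e, he, rfl⟩
  refine ⟨e.progA, Multiset.mem_cons_of_mem ?_, rfl⟩
  rw [he]
  exact Multiset.mem_singleton_self _

theorem lift_mem_rightVars (s : St D.Node) :
    ∀ a ∈ (D.concl s.node).rightVars, lift a ∈ (starOf D s).rightVars := by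
  rintro _ rfl; rfl

theorem build_valid (hD : D.IsDerivation (PRule S V)) (h : GoalInv S D ∅ (rootGoal D η Ω))
    (hG : Guarded S D) : Valid (S.n + 2) (build S D η Ω) := by
  intro b hb
  obtain ⟨p, σ, hp, h0, hσ, hs⟩ := exists_goals hb.2 (s₀ := rootGoal D η Ω) hb.1
  have hbr : D.IsBranch fun k => (σ k).node := by
    refine ⟨by simp only [h0]; rfl, fun k => ?_⟩
    have hr := goalInv_of_reach hD h (hσ k ▸ reach_of_branch hb _)
    exact ((hr.block hD).1.leaves (hs k)).1
  exact (hG _ hbr).imp (isTrace_lift hD h hb hp hσ lift_mem_leftVars)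
    (isTrace_lift hD h hb hp hσ lift_mem_rightVars)

end Stack

/-! ### The initial goal -/

/-- `OwnGens` in terms of the variables that occur in the relations. -/
theorem OwnGens.relVars {N : Type} {used : Set N} {ends : Set (GV N)} {Ω : Set (Rel N)}
    (h : OwnGens used ends Ω) {b : GV N} (hb : b ∈ SP.relVars Ω) :
    b.name ∈ used ∧ ∀ a ∈ ends, NotLater a b := by
  obtain ⟨r, hr, hb⟩ := hb
  obtain ⟨h₁, h₂, h₃⟩ := h r hr
  have hn : b.name ∈ used := by
    rcases hb with rfl | rfl
    exacts [h₂, h₁ ▸ h₂]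
  refine ⟨hn, fun a ha e₁ e₂ => ?_⟩
  by_contra hlt
  have hb' : b = ⟨a.name, ⟨a.gen.base, a.gen.off + (b.gen.off - a.gen.off - 1) + 1⟩⟩ := by
    rcases b with ⟨x, g, k⟩
    simp only at e₁ e₂ hlt ⊢
    rw [e₁, e₂]
    congr 2
    omega
  have := h₃ a ha (b.gen.off - a.gen.off - 1)
  rw [← hb'] at this
  rcases hb with hb | hb
  exacts [this.1 hb, this.2 hb]

/-- The assumptions on the roots of the two derivations establish the invariant. -/
theorem goalInv_root {S : TySig} {D : Graph PJ} {η : Gen} {Ω : Set (Rel PN)}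
    (hroot : (D.concl D.root).WF)
    (h₁ : OwnGens {x | .chan x ∈ (D.concl D.root).seen} (D.concl D.root).vars (D.concl D.root).om)
    (h₂ : OwnGens {w | ∃ x, .chan x ∈ (D.concl D.root).seen ∧ w = .ch x}
      (lift '' (D.concl D.root).vars) Ω)
    (h₃ : RelR S (D.concl D.root) ((build S D η Ω).concl (build S D η Ω).root)) :
    GoalInv S D (D.concl D.root).om (rootGoal D η Ω) := by
  refine ⟨.refl, hroot, fun b hb => h₁.relVars hb, fun r hr => (h₁ r hr).1, ⟨0, le_rfl, rfl⟩,
    fun b hb => ?_, ?_, ⟨fun _ _ _ _ h => .inl h, fun _ _ _ _ h => .inl h⟩⟩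
  · obtain ⟨⟨x, hx, hn⟩, hl⟩ := h₂.relVars hb
    exact ⟨notLater_of_name (by simp [rootGoal, hn]), fun a ha => hl _ ⟨a, ha, rfl⟩, by
      rw [hn]; exact hx⟩
  · obtain ⟨c, Ω', e, h⟩ := h₃
    obtain rfl : Ω = Ω' := congrArg Seq.om ((build_concl (.leaf (rootGoal D η Ω))).symm.trans e)
    exact h

end SP

theorem mainTheorem3 (S : SP.TySig) (V : SP.Defs) (D : SP.Graph SP.PJ)
    (hD : D.IsDerivation (SP.PRule S V)) (hroot : (D.concl D.root).WF) (η : SP.Gen) :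
    -- the bisimulation
    (∀ Ω : Set (SP.Rel SP.PN),
      SP.OwnGens {x | .chan x ∈ (D.concl D.root).seen} (D.concl D.root).vars (D.concl D.root).om →
      SP.OwnGens {w | ∃ x, .chan x ∈ (D.concl D.root).seen ∧ w = .ch x}
        (SP.lift '' (D.concl D.root).vars) Ω →
      SP.RelR S (D.concl D.root) ((SP.build S D η Ω).concl (SP.build S D η Ω).root) →
      (SP.build S D η Ω).IsDerivation (SP.LStep (SP.stSig S V)) ∧
      SP.NodeR S D η Ω D.root (SP.build S D η Ω).root ∧
      SP.IsBisim D.Step (SP.StarStep S D) (SP.NodeR S D η Ω)) ∧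
    -- the case of empty sets of relations: snapshot inequalities and validity are preserved
    ((D.concl D.root).om = ∅ →
      (SP.build S D η ∅).concl (SP.build S D η ∅).root =
        SP.starSeq (D.concl D.root).left (D.concl D.root).proc (D.concl D.root).right
          ⟨.cfg 0, η⟩ ∅ ∧
      (SP.build S D η ∅).IsDerivation (SP.LStep (SP.stSig S V)) ∧
      SP.NodeR S D η ∅ D.root (SP.build S D η ∅).root ∧
      SP.IsBisim D.Step (SP.StarStep S D) (SP.NodeR S D η ∅) ∧
      (∀ u v u' v', SP.NodeR S D η ∅ u v →
        Relation.ReflTransGen (SP.JointStep S D η ∅) (u, v) (u', v') →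
        (∀ a ∈ (D.concl u).leftVars, ∀ a' ∈ (D.concl u').leftVars,
          SP.SnapLt (D.concl u').om S.n a' a →
          SP.SnapLt ((SP.build S D η ∅).concl v').om (S.n + 2) (SP.lift a') (SP.lift a)) ∧
        (∀ a ∈ (D.concl u).rightVars, ∀ a' ∈ (D.concl u').rightVars,
          SP.SnapLt (D.concl u').om S.n a' a →
          SP.SnapLt ((SP.build S D η ∅).concl v').om (S.n + 2) (SP.lift a') (SP.lift a))) ∧
      (SP.Guarded S D → SP.Valid (S.n + 2) (SP.build S D η ∅))) := by
  refine ⟨fun Ω h₁ h₂ h₃ => ?_, fun hom => ?_⟩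
  · have h := SP.goalInv_root hroot h₁ h₂ h₃
    exact ⟨SP.build_isDerivation hD h, SP.nodeR_leaf hD h .refl, SP.nodeR_isBisim hD h⟩
  · have hc : (SP.build S D η ∅).concl (SP.build S D η ∅).root =
        SP.starSeq (D.concl D.root).left (D.concl D.root).proc (D.concl D.root).right
          ⟨.cfg 0, η⟩ ∅ := SP.build_concl _
    have he : ∀ {N : Type} (a : SP.GV N), a ∉ SP.relVars (∅ : Set (SP.Rel N)) := by
      rintro N a ⟨r, hr, -⟩; exact hr
    have h := SP.goalInv_root (η := η) (Ω := ∅) (S := S) hroot (by rw [hom]; exact fun _ h => h.elim)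
      (fun _ h => h.elim) ⟨_, _, hc, fun a _ i _ w => by
        rw [hom, SP.le_iff_eq_of_notMem (he a), SP.le_iff_eq_of_notMem (he _),
          SP.lift_injective.eq_iff]⟩
    rw [hom] at h
    refine ⟨hc, SP.build_isDerivation hD h, SP.nodeR_leaf hD h .refl, SP.nodeR_isBisim hD h,
      fun u v u' v' hR hsteps => ?_, SP.build_valid hD h⟩
    have hR' : SP.NodeR S D η ∅ u' v' := by
      rcases Relation.ReflTransGen.cases_tail hsteps with e | ⟨_, -, hs⟩
      · cases e; exact hR
      · exact hs.2.2
    obtain ⟨hr, ⟨s, rfl, rfl⟩, -⟩ := hR'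
    have hm := (SP.goalInv_of_reach hD h hr).2.mirrored
    have hc' : (SP.build S D η ∅).concl (.leaf s) = SP.starOf D s := SP.build_concl _
    rw [hc']
    exact ⟨fun _ _ _ _ => hm.snapLt (Nat.le_add_right _ _),
      fun _ _ _ _ => hm.snapLt (Nat.le_add_right _ _)⟩
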